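/- **Setting.** Let $\mathcal M$ be a finite set of microgrids, and let $\mathcal T=\{1,\dots,T\}$ be the time slots. An internal schedule $x_i=(g_i,q_{b,i},q_{s,i},(x_n)_{n\in\mathcal N_i},r_{c,i},r_{d,i})$ of microgrid $i$ consists of wind power used, power bought from and sold to the main grid, elastic loads of its users, and storage charging and discharging. Given net received energy $E_i=(E_i^t)_{t}$, it is feasible if for all $t\in\mathcal T$, $n\in\mathcal N_i$: $0\le g_i^t\le\eta_i^tG_i$, $0\le q_{b,i}^t\le Q_{b,i}^{\max}$, $0\le q_{s,i}^t\le Q_{s,i}^{\max}$, $\sum_t x_n^t=D_n$, $d_n^{t,\min}\le x_n^t\le d_n^{t,\max}$, $0\le r_{c,i}^t\le r_{c,i}^{\max}$, $0\le r_{d,i}^t\le r_{d,i}^{\max}$; the stored energy $s_i^t=s_i^{t-1}+\eta_{c,i}r_{c,i}^t-r_{d,i}^t/\eta_{d,i}$ (with given $s_i^0$ and $\eta_{c,i},\eta_{d,i}\in(0,1]$) satisfies $(1-DoD_i)S_i^{\max}\le s_i^t\le S_i^{\max}$ and $s_i^T=s_i^0$; $q_{s,i}^t\le\eta_i^tG_i-g_i^t+s_i^t$;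 and $g_i^t+q_{b,i}^t+r_{d,i}^t+E_i^t=q_{s,i}^t+r_{c,i}^t+b_i^t+\sum_{n\in\mathcal N_i}x_n^t$. Its operating cost is $C_i^O(x_i)=\sum_t(p_b^tq_{b,i}^t-p_s^tq_{s,i}^t)+\sum_{n\in\mathcal N_i}\beta_n\sum_t(x_n^t-y_n^t)^2+c_s\sum_t(r_{c,i}^t+r_{d,i}^t)$ with $\beta_n\ge0$. Assume that every microgrid has a feasible schedule with $E_i=0$, and let $C_i^{Non}$ be its minimal operating cost over these schedules. *P1*: minimize $\sum_{i}C_i^O(x_i)$ over schedules $x$ and trades $e=(e_{i,j}^t)_{i\ne j,\,t}$ such that $x_i$ is feasible for $E_i^t=\sum_{j\ne i}e_{i,j}^t$ and $e_{i,j}^t+e_{j,i}^t=0$. *P2* (for an optimal solution $(x^*,e^*)$ of P1, $\mathcal M'=\{i:e_i^*\ne0\}$ and $\delta_i^*=C_i^{Non}-C_i^O(x_i^*)$): maximize $\prod_{i\in\mathcal M'}(\delta_i^*-\sum_{j\in\mathcal M'\setminus i}\pi_{i,j})$ over payments $\pi=(\pi_{i,j})_{i\ne j\in\mathcal M'}$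 with $\pi_{i,j}+\pi_{j,i}=0$ and $\sum_{j\in\mathcal M'\setminus i}\pi_{i,j}\le\delta_i^*$. *Algorithm, Step 1*, with step sizes $\rho_1(k)>0$: start with $\lambda(0)=0$ and any $\hat e(0)$. For $k=0,1,2,\dots$, each microgrid $i$ chooses a minimizer $(x_i(k+1),e_i(k+1))$ of $$C_i^O(x_i)+\sum_{j\ne i}\sum_t\Big(\tfrac{\rho_1(k)}2(\hat e_{i,j}^t(k)-e_{i,j}^t)^2-\lambda_{i,j}^t(k)e_{i,j}^t\Big)$$ over the $(x_i,e_i)$ for which $x_i$ is feasible for $E_i^t=\sum_{j\neq i}e_{i,j}^t$; then $$\hat e_{i,j}^t(k+1)=\frac{\rho_1(k)\,(e_{i,j}^t(k+1)-e_{j,i}^t(k+1))-(\lambda_{i,j}^t(k)-\lambda_{j,i}^t(k))}{2\rho_1(k)},$$ $$\lambda_{i,j}^t(k+1)=\lambda_{i,j}^t(k)+\rho_1(k)\,(\hat e_{i,j}^t(k+1)-e_{i,j}^t(k+1)).$$ *Step 2*, with step sizes $\rho_2(k)>0$: start with $\gamma(0)=0$ and any $\hat\pi(0)$. For $k=0,1,2,\dots$,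 each $i\in\mathcal M'$ minimizes $$-\ln\Big(\delta_i^*-\sum_{j\in\mathcal M'\setminus i}\pi_{i,j}\Big)+\sum_{j\in\mathcal M'\setminus i}\Big(\tfrac{\rho_2(k)}2(\hat\pi_{i,j}(k)-\pi_{i,j})^2-\gamma_{i,j}(k)\pi_{i,j}\Big)$$ over the $\pi_i$ with $\sum_{j\in\mathcal M'\setminus i}\pi_{i,j}<\delta_i^*$, which gives $\pi_i(k+1)$; then $\hat\pi$ and $\gamma$ are updated by the same formulas as $\hat e$ and $\lambda$, with $(\pi,\hat\pi,\gamma,\rho_2)$ in place of $(e,\hat e,\lambda,\rho_1)$. Call $\rho:\{0,1,2,\dots\}\to\mathbb R$ a *proper step size sequence* if it is positive and nonincreasing, $\sum_k\rho(k)=\infty$, and for some constant $C$, $\rho(k)\le(1+\frac{C}{k+1})\rho(k+1)$ for all $k$. **Theorem 2.** The sequence $\rho(0)=1$, $\rho(k)=1/k$ $(k\ge1)$ is proper. Let $\rho_1,\rho_2$ be any proper step size sequences. (Step 1) For every $\hat e(0)$ the algorithm can be run, that is, all local problems have solutions. For every run, as $k\to\infty$: the residual $\sum_i\|\hat e_i(k)-e_i(k)\|$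 tends to $0$ (so for every tolerance $\epsilon_1>0$ the stopping test is met after finitely many iterations); the cost $\sum_iC_i^O(x_i(k))$ tends to the optimal value of P1; and the iterates converge to the set of optimal solutions of P1, that is, there are optimal solutions $(x^{*(k)},e^{*(k)})$ of P1 with $x(k)-x^{*(k)}\to0$, $e(k)-e^{*(k)}\to0$ and $\hat e(k)-e^{*(k)}\to0$. (Step 2) Let $(x^*,e^*)$ be any optimal solution of P1 such that, if $\mathcal M'\ne\emptyset$, trading strictly reduces the total cost of the group: $\sum_{i\in\mathcal M'}C_i^O(x_i^*)<\sum_{i\in\mathcal M'}C_i^{Non}$. Then for every $\hat\pi(0)$ the algorithm can be run, and for every run $\sum_{i\in\mathcal M'}\|\hat\pi_i(k)-\pi_i(k)\|\to0$, and $\pi(k)$ and $\hat\pi(k)$ both converge to one and the same optimal solution $\pi^*$ of P2. -/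

import Mathlib

open Filter Topology
open scoped BigOperators

namespace Microgrids

/-! ### The model of one microgrid -/

/-- The data of a microgrid over `T` time slots. Slot `t = 1, …, T` is the element `t - 1` of `Fin T`. -/
structure Microgrid (T : ℕ) where
  /-- installed wind capacity -/
  windCapacity : ℝ
  /-- wind generation per unit of capacity -/
  windFactor : Fin T → ℝ
  /-- maximal power bought from the main grid in one slot -/
  buyMax : ℝ
  /-- maximal power sold to the main grid in one slot -/
  sellMax : ℝ
  /-- aggregate inelastic load -/
  inelastic : Fin T → ℝ
  /-- number of users with an elastic load -/
  users : ℕ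
  /-- total elastic energy requirement of each user -/
  demand : Fin users → ℝ
  /-- lower bounds of the elastic loads -/
  loadMin : Fin users → Fin T → ℝ
  /-- upper bounds of the elastic loads -/
  loadMax : Fin users → Fin T → ℝ
  /-- most preferred elastic loads -/
  preferred : Fin users → Fin T → ℝ
  /-- sensitivity of each user to deviations from the preferred load -/
  sensitivity : Fin users → ℝ
  sensitivity_nonneg : ∀ n, 0 ≤ sensitivity n
  /-- storage capacity -/
  storageMax : ℝ
  /-- admissible depth of discharge -/
  depth : ℝ
  /-- initial level of stored energy -/
  storageInit : ℝ
  /-- maximal charging rate -/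
  chargeMax : ℝ
  /-- maximal discharging rate -/
  dischargeMax : ℝ
  /-- charging efficiency -/
  effCharge : ℝ
  effCharge_pos : 0 < effCharge
  effCharge_le : effCharge ≤ 1
  /-- discharging efficiency -/
  effDischarge : ℝ
  effDischarge_pos : 0 < effDischarge
  effDischarge_le : effDischarge ≤ 1

/-- The internal decision variables of a microgrid with `N` users over `T` slots. -/
structure Schedule (N T : ℕ) where
  /-- wind power used -/
  wind : Fin T → ℝ
  /-- power bought from the main grid -/
  buy : Fin T → ℝ
  /-- power sold to the main grid -/
  sell : Fin T → ℝ
  /-- elastic loads of the users -/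
  load : Fin N → Fin T → ℝ
  /-- charging of the storage -/
  charge : Fin T → ℝ
  /-- discharging of the storage -/
  discharge : Fin T → ℝ

/-- A distance between schedules: the sum of the absolute differences of all entries. -/
def Schedule.l1Dist {N T : ℕ} (x y : Schedule N T) : ℝ :=
  ∑ t, (|x.wind t - y.wind t| + |x.buy t - y.buy t| + |x.sell t - y.sell t|
    + |x.charge t - y.charge t| + |x.discharge t - y.discharge t|
    + ∑ n, |x.load n t - y.load n t|)

namespace Microgrid

variable {T : ℕ} (m : Microgrid T)

/-- The stored energy `s^k` after the first `k` slots. -/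
noncomputable def storage (x : Schedule m.users T) (k : ℕ) : ℝ :=
  m.storageInit + ∑ τ : Fin T, if (τ : ℕ) < k then
    m.effCharge * x.charge τ - x.discharge τ / m.effDischarge else 0

theorem storage_zero (x : Schedule m.users T) : m.storage x 0 = m.storageInit := by
  simp [storage]

/-- The storage dynamics. -/
theorem storage_succ (x : Schedule m.users T) (t : Fin T) :
    m.storage x (t + 1) =
      m.storage x t + m.effCharge * x.charge t - x.discharge t / m.effDischarge := by
  have key : ∀ f : Fin T → ℝ, (∑ τ : Fin T, if (τ : ℕ) < (t : ℕ) + 1 then f τ else 0)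
      = (∑ τ : Fin T, if (τ : ℕ) < (t : ℕ) then f τ else 0) + f t := by
    intro f
    have h : ∀ τ : Fin T, (if (τ : ℕ) < (t : ℕ) + 1 then f τ else 0)
        = (if (τ : ℕ) < (t : ℕ) then f τ else 0) + (if τ = t then f τ else 0) := by
      intro τ
      have : τ = t ↔ (τ : ℕ) = (t : ℕ) := Fin.ext_iff
      split_ifs <;> simp_all <;> omega
    simp only [h, Finset.sum_add_distrib, Finset.sum_ite_eq', Finset.mem_univ, if_true]
  simp only [storage, key (fun τ => m.effCharge * x.charge τ - x.discharge τ / m.effDischarge)]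
  ring

/-- All constraints on the schedule of one microgrid when `net t` is the total energy that it
receives in slot `t` from the other microgrids. -/
structure Feasible (x : Schedule m.users T) (net : Fin T → ℝ) : Prop where
  wind : ∀ t, 0 ≤ x.wind t ∧ x.wind t ≤ m.windFactor t * m.windCapacity
  buy : ∀ t, 0 ≤ x.buy t ∧ x.buy t ≤ m.buyMax
  sell : ∀ t, 0 ≤ x.sell t ∧ x.sell t ≤ m.sellMax
  load_total : ∀ n, ∑ t, x.load n t = m.demand n
  load : ∀ n t, m.loadMin n t ≤ x.load n t ∧ x.load n t ≤ m.loadMax n t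
  charge : ∀ t, 0 ≤ x.charge t ∧ x.charge t ≤ m.chargeMax
  discharge : ∀ t, 0 ≤ x.discharge t ∧ x.discharge t ≤ m.dischargeMax
  storage : ∀ t : Fin T, (1 - m.depth) * m.storageMax ≤ m.storage x (t + 1) ∧
    m.storage x (t + 1) ≤ m.storageMax
  storage_terminal : m.storage x T = m.storageInit
  sell_available : ∀ t : Fin T,
    x.sell t ≤ m.windFactor t * m.windCapacity - x.wind t + m.storage x (t + 1)
  balance : ∀ t, x.wind t + x.buy t + x.discharge t + net t
    = x.sell t + x.charge t + m.inelastic t + ∑ n, x.load n t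

end Microgrid

/-! ### The interconnected system and its two optimization problems -/

/-- A system of microgrids, with the prices of the main grid and the unit cost of storage use. -/
structure System (M : Type*) (T : ℕ) where
  /-- the microgrids -/
  grid : M → Microgrid T
  /-- buying price of the main grid -/
  priceBuy : Fin T → ℝ
  /-- selling price (feed-in tariff) of the main grid -/
  priceSell : Fin T → ℝ
  /-- amortized cost of charging and discharging -/
  storageCost : ℝ

/-- The trading variables `e i j t` (and their auxiliary and dual variables); the diagonal entries `e i i t` are no
variables of the model, and every feasible trade has them equal to `0`. -/
abbrev Trade (M : Type*) (T : ℕ) := M → M → Fin T → ℝ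

namespace System

variable {M : Type*} {T : ℕ} (S : System M T)

/-- The type of the schedules of microgrid `i`. -/
abbrev Sched (i : M) := Schedule (S.grid i).users T

/-- The operating cost of microgrid `i`: energy cost, discomfort cost, cost of storage use. -/
def opCost (i : M) (x : S.Sched i) : ℝ :=
  (∑ t, (S.priceBuy t * x.buy t - S.priceSell t * x.sell t))
  + (∑ n, (S.grid i).sensitivity n * ∑ t, (x.load n t - (S.grid i).preferred n t) ^ 2)
  + S.storageCost * ((∑ t, x.charge t) + ∑ t, x.discharge t)

/-- The noncooperative benchmark of microgrid `i`: its minimal operating cost without trading. -/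
noncomputable def nonCost (i : M) : ℝ :=
  sInf {c | ∃ x : S.Sched i, (S.grid i).Feasible x 0 ∧ c = S.opCost i x}

variable [Fintype M] [DecidableEq M]

/-- The constraints of microgrid `i` on its schedule and its trades `e j t`, `j ≠ i`. -/
structure LocalFeasible (i : M) (x : S.Sched i) (e : M → Fin T → ℝ) : Prop where
  schedule : (S.grid i).Feasible x (fun t => ∑ j ∈ Finset.univ.erase i, e j t)
  diag : ∀ t, e i t = 0

/-- The social operating cost. -/
def socialCost (x : ∀ i, S.Sched i) : ℝ := ∑ i, S.opCost i (x i)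

/-- The constraints of problem P1. -/
structure P1Feasible (x : ∀ i, S.Sched i) (e : Trade M T) : Prop where
  loc : ∀ i, S.LocalFeasible i (x i) (e i)
  clearing : ∀ i j t, i ≠ j → e i j t + e j i t = 0

/-- `(x, e)` is an optimal solution of P1: it minimizes the social operating cost. -/
structure P1Optimal (x : ∀ i, S.Sched i) (e : Trade M T) : Prop where
  feasible : S.P1Feasible x e
  le : ∀ x' e', S.P1Feasible x' e' → S.socialCost x ≤ S.socialCost x'

/-- Objective of the local problem of microgrid `i` in Step 1. -/
noncomputable def localObjective1 (i : M) (ρ : ℝ) (eHat lam : M → Fin T → ℝ) (x : S.Sched i)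
    (e : M → Fin T → ℝ) : ℝ :=
  S.opCost i x + ∑ j ∈ Finset.univ.erase i, ∑ t,
    (ρ / 2 * (eHat j t - e j t) ^ 2 - lam j t * e j t)

/-- `(x, e)` solves the local problem of microgrid `i` in Step 1. -/
structure LocalSolution1 (i : M) (ρ : ℝ) (eHat lam : M → Fin T → ℝ) (x : S.Sched i)
    (e : M → Fin T → ℝ) : Prop where
  feasible : S.LocalFeasible i x e
  le : ∀ x' e', S.LocalFeasible i x' e' →
    S.localObjective1 i ρ eHat lam x e ≤ S.localObjective1 i ρ eHat lam x' e'

/-- A run of Step 1 of the algorithm with step sizes `ρ`. The local solutions may be any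
minimizers, and the initial auxiliary variables `eHat 0` are arbitrary. (`x 0` and `e 0` play no
role.) -/
structure Step1Run (ρ : ℕ → ℝ) where
  x : ℕ → ∀ i, S.Sched i
  e : ℕ → Trade M T
  eHat : ℕ → Trade M T
  lam : ℕ → Trade M T
  lam_zero : lam 0 = 0
  lower : ∀ k i, S.LocalSolution1 i (ρ k) (eHat k i) (lam k i) (x (k + 1) i) (e (k + 1) i)
  eHat_succ : ∀ k i j t, eHat (k + 1) i j t =
    (ρ k * (e (k + 1) i j t - e (k + 1) j i t) - (lam k i j t - lam k j i t)) / (2 * ρ k)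
  lam_succ : ∀ k i j t, lam (k + 1) i j t =
    lam k i j t + ρ k * (eHat (k + 1) i j t - e (k + 1) i j t)

/-- The quantity `∑ i, ‖eHat_i(k) - e_i(k)‖` of the stopping test of Step 1. -/
noncomputable def Step1Run.residual {S : System M T} {ρ : ℕ → ℝ} (R : S.Step1Run ρ) (k : ℕ) : ℝ :=
  ∑ i, √(∑ j ∈ Finset.univ.erase i, ∑ t, (R.eHat k i j t - R.e k i j t) ^ 2)

/-- The cost reduction `δ i` of microgrid `i` under the schedules `x`. -/
noncomputable def gain (x : ∀ i, S.Sched i) (i : M) : ℝ := S.nonCost i - S.opCost i (x i)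

end System

section Payment

variable {M : Type*} [Fintype M] [DecidableEq M]

open scoped Classical in
/-- The set of the microgrids with a nonzero trading vector. -/
noncomputable def traders {T : ℕ} (e : Trade M T) : Finset M :=
  Finset.univ.filter fun i => ∃ j t, e i j t ≠ 0

/-- The total payment made by microgrid `i` to the other members of the trading group `G`. -/
def payment (G : Finset M) (i : M) (p : M → ℝ) : ℝ := ∑ j ∈ G.erase i, p j

/-- The constraints of problem P2 for the group `G` and the cost reductions `δ`. Entries of the
payment matrix that do not belong to a pair of distinct members of `G` are no variables and are
set to `0`. -/
structure P2Feasible (G : Finset M) (δ : M → ℝ) (p : M → M → ℝ) : Prop where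
  support : ∀ i j, ¬ (i ∈ G ∧ j ∈ G.erase i) → p i j = 0
  clearing : ∀ i ∈ G, ∀ j ∈ G.erase i, p i j + p j i = 0
  rational : ∀ i ∈ G, payment G i (p i) ≤ δ i

/-- The Nash product. -/
def nashProduct (G : Finset M) (δ : M → ℝ) (p : M → M → ℝ) : ℝ :=
  ∏ i ∈ G, (δ i - payment G i (p i))

/-- `p` is an optimal solution of P2: it maximizes the Nash product. -/
structure P2Optimal (G : Finset M) (δ : M → ℝ) (p : M → M → ℝ) : Prop where
  feasible : P2Feasible G δ p
  ge : ∀ p', P2Feasible G δ p' → nashProduct G δ p' ≤ nashProduct G δ p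

/-- The constraints of the local problem of `i ∈ G` in Step 2, the inequality being strict because
the logarithm in the objective has to be defined. -/
structure LocalFeasible2 (G : Finset M) (δ : M → ℝ) (i : M) (p : M → ℝ) : Prop where
  support : ∀ j, j ∉ G.erase i → p j = 0
  rational : payment G i p < δ i

/-- Objective of the local problem of microgrid `i` in Step 2. -/
noncomputable def localObjective2 (G : Finset M) (δ : M → ℝ) (i : M) (ρ : ℝ)
    (pHat gam : M → ℝ) (p : M → ℝ) : ℝ :=
  -Real.log (δ i - payment G i p)
    + ∑ j ∈ G.erase i, (ρ / 2 * (pHat j - p j) ^ 2 - gam j * p j)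

/-- `p` solves the local problem of microgrid `i` in Step 2. -/
structure LocalSolution2 (G : Finset M) (δ : M → ℝ) (i : M) (ρ : ℝ) (pHat gam : M → ℝ)
    (p : M → ℝ) : Prop where
  feasible : LocalFeasible2 G δ i p
  le : ∀ p', LocalFeasible2 G δ i p' →
    localObjective2 G δ i ρ pHat gam p ≤ localObjective2 G δ i ρ pHat gam p'

/-- A run of Step 2 of the algorithm with step sizes `ρ`; the initial auxiliary variables `pHat 0`
are arbitrary. (`p 0` plays no role.) -/
structure Step2Run (G : Finset M) (δ : M → ℝ) (ρ : ℕ → ℝ) where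
  p : ℕ → M → M → ℝ
  pHat : ℕ → M → M → ℝ
  gam : ℕ → M → M → ℝ
  gam_zero : gam 0 = 0
  lower : ∀ k, ∀ i ∈ G, LocalSolution2 G δ i (ρ k) (pHat k i) (gam k i) (p (k + 1) i)
  outside : ∀ k, ∀ i ∉ G, p (k + 1) i = 0
  pHat_succ : ∀ k i j, pHat (k + 1) i j =
    (ρ k * (p (k + 1) i j - p (k + 1) j i) - (gam k i j - gam k j i)) / (2 * ρ k)
  gam_succ : ∀ k i j, gam (k + 1) i j =
    gam k i j + ρ k * (pHat (k + 1) i j - p (k + 1) i j)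

/-- The quantity `∑ i, ‖pHat_i(k) - p_i(k)‖` of the stopping test of Step 2. -/
noncomputable def Step2Run.residual {G : Finset M} {δ : M → ℝ} {ρ : ℕ → ℝ}
    (R : Step2Run G δ ρ) (k : ℕ) : ℝ :=
  ∑ i ∈ G, √(∑ j ∈ G.erase i, (R.pHat k i j - R.p k i j) ^ 2)

end Payment

/-! ### Step sizes -/

/-- Proper step sizes: positive, nonincreasing, with divergent sum, and such that the ratio of
consecutive terms is at most `1 + C / (k + 1)` for some constant `C`. All positive constants and
the sequences `1 / (k + 1) ^ a` with `0 < a ≤ 1` are examples. -/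
structure ProperStepsize (ρ : ℕ → ℝ) : Prop where
  pos : ∀ k, 0 < ρ k
  antitone : Antitone ρ
  not_summable : ¬ Summable ρ
  slow : ∃ C : ℝ, ∀ k : ℕ, ρ k ≤ (1 + C / (k + 1)) * ρ (k + 1)

/-- The step sizes `ρ(0) = 1` and `ρ(k) = 1 / k` for `k ≥ 1`. -/
noncomputable def harmonicStep (k : ℕ) : ℝ := if k = 0 then 1 else 1 / (k : ℝ)

end Microgrids

open Microgrids

namespace Microgrids

/-! ### Step sizes -/

/-! Both steps of the algorithm are the same consensus iteration. The cost of a node depends on its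
trades only through their net amount, so at a local minimizer the quantity `lam + ρ * (eHat - e)` is
the same for all partners of a node: it is a node price. After the first update the auxiliary array
is antisymmetric and the multiplier array symmetric, and from the second update on the residuals are
symmetric too. Symmetric and antisymmetric arrays are orthogonal, so local optimality becomes one
subgradient inequality in which multipliers pair with residuals and the consensus increment, scaled
by the step size, pairs with consensus displacements (`ExchangeRun.splitRun`).

The difficulty is that the step size may tend to zero. The usual Fejér argument (`SplitRun.fejer`)
bounds the multipliers and shows only that the scaled consensus increments vanish. The consensus
variables are bounded separately (`ExchangeRun.consensus_bounded`): their increments are differences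
of node prices, so their circulation part is frozen, and each row sum obeys a stable two-dimensional
linear recursion driven by the net exchanges (`bounded_of_filter`).

Given this bound, monotonicity of subgradients at consecutive iterates makes the sum of the squared
residual and the squared consensus increment almost decreasing. The changing step size costs O(1/k)
times the squared increment, and boundedness turns this cost into a telescoping term plus a summable
one (`SplitRun.change_tendsto`). Hence second differences vanish, then first differences, and the
residual norm converges. A positive limit would make the Lagrangian grow like the divergent sum of
the step sizes, although a feasible point bounds it from above (`SplitRun.tendsto_residual_zero`).

In Step 1 the feasible schedules form compact polytopes and the costs are convex quadratics. Farkas'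
lemma gives a common price as multiplier (`exists_multiplier`), which yields convergence of the
cost. Compactness then gives nearby optimal schedules, and the trades are recovered from the net
amounts and the frozen circulation.

In Step 2 there is no compactness. The Fejér argument equalizes the node prices, that is, the
inverse slacks, and `Step2Run.sum_inv_slack_ge` keeps their sum away from zero, so the slacks are
eventually bounded. They all converge to the mean gain, and equal division is optimal by the
inequality of arithmetic and geometric means (`p2Optimal_of_equal`). -/

theorem properStepsize_harmonicStep : ProperStepsize harmonicStep := by
  refine ⟨fun k => ?_, antitone_nat_of_succ_le fun k => ?_, ?_, 2, fun k => ?_⟩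
  · rcases k with _ | k
    · simp [harmonicStep]
    · simp only [harmonicStep, Nat.succ_ne_zero, if_false]
      positivity
  · rcases k with _ | k
    · simp [harmonicStep]
    · simp only [harmonicStep, Nat.succ_ne_zero, if_false]
      push_cast
      apply one_div_le_one_div_of_le <;> [positivity; linarith]
  · intro h
    have h' := (summable_nat_add_iff 1).2 h
    have : (fun k : ℕ => harmonicStep (k + 1)) = fun k : ℕ => 1 / ((k + 1 : ℕ) : ℝ) := by
      funext k
      simp [harmonicStep]
    rw [this] at h'
    exact Real.not_summable_one_div_natCast ((summable_nat_add_iff 1).1 h')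
  · rcases k with _ | k
    · simp [harmonicStep]
    · simp only [harmonicStep, Nat.succ_ne_zero, if_false]
      push_cast
      have : (0 : ℝ) ≤ k := Nat.cast_nonneg k
      rw [div_le_iff₀ (by positivity)]
      field_simp
      nlinarith

namespace ProperStepsize

variable {ρ : ℕ → ℝ}

theorem exists_slow (h : ProperStepsize ρ) :
    ∃ C : ℝ, 0 ≤ C ∧ ∀ k : ℕ, ρ k / ρ (k + 1) ≤ 1 + C / (k + 1) := by
  obtain ⟨C, hC⟩ := h.slow
  refine ⟨|C|, abs_nonneg C, fun k => ?_⟩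
  rw [div_le_iff₀ (h.pos _)]
  refine (hC k).trans (mul_le_mul_of_nonneg_right ?_ (h.pos _).le)
  gcongr
  exact le_abs_self C

theorem one_le_div (h : ProperStepsize ρ) (k : ℕ) : 1 ≤ ρ k / ρ (k + 1) := by
  rw [_root_.one_le_div (h.pos _)]
  exact h.antitone k.le_succ

/-- The initial auxiliary variables need not be antisymmetric, so every run is studied after a shift
by one step. -/
theorem succ (h : ProperStepsize ρ) : ProperStepsize (fun k => ρ (k + 1)) := by
  refine ⟨fun k => h.pos _, fun a b hab => h.antitone (by omega),
    fun hs => h.not_summable ((summable_nat_add_iff 1).1 hs), ?_⟩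
  obtain ⟨C, hC0, hC⟩ := h.exists_slow
  refine ⟨C, fun k => ?_⟩
  have := hC (k + 1)
  rw [div_le_iff₀ (h.pos _)] at this
  refine this.trans (mul_le_mul_of_nonneg_right ?_ (h.pos _).le)
  push_cast
  gcongr
  linarith

end ProperStepsize

/-! ### Real sequences -/

theorem summable_inv_succ_sq : Summable fun k : ℕ => 1 / ((k : ℝ) + 1) ^ 2 := by
  have := (summable_nat_add_iff 1).2 (Real.summable_one_div_nat_pow.2 one_lt_two)
  simpa using this

/-- A sequence which is bounded below and decreases up to summable errors converges, and its
decrements are summable. -/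
theorem tendsto_of_le_sub_add {u D s : ℕ → ℝ} {b : ℝ} (hb : ∀ k, b ≤ u k) (hD : ∀ k, 0 ≤ D k)
    (hs0 : ∀ k, 0 ≤ s k) (hs : Summable s) (h : ∀ k, u (k + 1) ≤ u k - D k + s k) :
    (∃ l, Tendsto u atTop (𝓝 l)) ∧ Summable D := by
  have hle : ∀ k, ∑ j ∈ Finset.range k, s j ≤ ∑' j, s j := fun k =>
    hs.sum_le_tsum _ fun j _ => hs0 j
  constructor
  · have ha : Antitone fun k => u k - ∑ j ∈ Finset.range k, s j := by
      refine antitone_nat_of_succ_le fun k => ?_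
      rw [Finset.sum_range_succ]
      linarith [h k, hD k]
    have hbd : BddBelow (Set.range fun k => u k - ∑ j ∈ Finset.range k, s j) := by
      refine ⟨b - ∑' j, s j, ?_⟩
      rintro _ ⟨k, rfl⟩
      simp only
      linarith [hb k, hle k]
    refine ⟨_, ((tendsto_atTop_ciInf ha hbd).add hs.hasSum.tendsto_sum_nat).congr fun k => ?_⟩
    ring
  · refine summable_of_sum_range_le (c := u 0 + (∑' j, s j) - b) hD fun k => ?_
    have : ∑ j ∈ Finset.range k, D j ≤ u 0 + (∑ j ∈ Finset.range k, s j) - u k := by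
      induction k with
      | zero => simp
      | succ k ih =>
        rw [Finset.sum_range_succ, Finset.sum_range_succ]
        linarith [h k]
    linarith [hle k, hb k]

/-- A sequence contracting up to a bounded perturbation is bounded. -/
theorem bddAbove_of_eventually_le_mul_add {Q : ℕ → ℝ} {q K : ℝ} (hq0 : 0 ≤ q) (hq : q < 1)
    (h : ∀ᶠ k in atTop, Q (k + 1) ≤ q * Q k + K) : ∃ B, ∀ k, Q k ≤ B := by
  obtain ⟨N, hN⟩ := eventually_atTop.1 h
  set B := max (Q N) (K / (1 - q)) with hB
  have hK : K ≤ (1 - q) * B := by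
    have : K / (1 - q) ≤ B := le_max_right _ _
    rw [div_le_iff₀ (by linarith)] at this
    linarith
  have key : ∀ j, Q (N + j) ≤ B := by
    intro j
    induction j with
    | zero => exact le_max_left _ _
    | succ j ih =>
      have := hN (N + j) (by omega)
      rw [← add_assoc]
      nlinarith
  obtain ⟨B', hB'⟩ := ((Finset.range N).image Q).bddAbove
  refine ⟨max B B', fun k => ?_⟩
  rcases lt_or_ge k N with hk | hk
  · exact le_max_of_le_right (hB' (by simpa using ⟨k, hk, rfl⟩))
  · obtain ⟨j, rfl⟩ := Nat.exists_eq_add_of_le hk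
    exact le_max_of_le_left (key j)

theorem exists_abs_le_of_eventually {u : ℕ → ℝ} {b : ℝ} (h : ∀ᶠ k in atTop, |u k| ≤ b) :
    ∃ B, ∀ k, |u k| ≤ B := by
  refine bddAbove_of_eventually_le_mul_add (q := 0) (K := b) le_rfl zero_lt_one ?_
  filter_upwards [(tendsto_add_atTop_nat 1).eventually h] with k hk
  simpa using hk

/-- If a bounded sequence has second differences tending to zero, then so do its first
differences. -/
theorem tendsto_sub_zero_of_bounded {U : Type*} [NormedAddCommGroup U] [NormedSpace ℝ U]
    {a : ℕ → U} {B : ℝ} (hB : ∀ k, ‖a k‖ ≤ B)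
    (h : Tendsto (fun k => (a (k + 2) - a (k + 1)) - (a (k + 1) - a k)) atTop (𝓝 0)) :
    Tendsto (fun k => a (k + 1) - a k) atTop (𝓝 0) := by
  set d : ℕ → U := fun k => a (k + 1) - a k with hd
  have h1 : ∀ m, Tendsto (fun k => d (k + m) - d k) atTop (𝓝 0) := by
    intro m
    induction m with
    | zero => simp
    | succ m ih =>
      have h2 := h.comp (tendsto_add_atTop_nat m)
      refine ((h2.add ih).congr fun k => ?_).trans (by simp)
      simp only [hd, Function.comp]
      rw [show k + m + 2 = k + (m + 1) + 1 by ring, show k + (m + 1) = k + m + 1 by ring]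
      abel
  -- Over a fixed window of length `m` the increments are nearly constant, so the displacement is
  -- about `m • d k`. It is at most `2 * B` in norm, and a large `m` forces `d k` to be small.
  have h3 : ∀ m : ℕ, Tendsto (fun k => a (k + m) - a k - (m : ℝ) • d k) atTop (𝓝 0) := by
    intro m
    induction m with
    | zero => simp
    | succ m ih =>
      refine ((ih.add (h1 m)).congr fun k => ?_).trans (by simp)
      simp only [hd, ← add_assoc, Nat.cast_add, Nat.cast_one, add_smul, one_smul]
      abel
  rw [Metric.tendsto_atTop]
  intro ε hε
  have hB0 : 0 ≤ B := (norm_nonneg _).trans (hB 0)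
  obtain ⟨m, hm⟩ := exists_nat_gt ((2 * B + 1) / ε)
  have hm0 : (0 : ℝ) < m := lt_of_le_of_lt (by positivity) hm
  obtain ⟨N, hN⟩ := Metric.tendsto_atTop.1 (h3 m) 1 one_pos
  refine ⟨N, fun k hk => ?_⟩
  have h4 := hN k hk
  rw [dist_zero_right] at h4 ⊢
  have h5 : (m : ℝ) • d k = (a (k + m) - a k) - (a (k + m) - a k - (m : ℝ) • d k) := by abel
  have h6 : (m : ℝ) * ‖d k‖ < 2 * B + 1 := by
    have : ‖(m : ℝ) • d k‖ = m * ‖d k‖ := by rw [norm_smul, Real.norm_natCast]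
    rw [← this, h5]
    have := norm_sub_le (a (k + m) - a k) (a (k + m) - a k - (m : ℝ) • d k)
    have := norm_sub_le (a (k + m)) (a k)
    linarith [hB (k + m), hB k]
  rw [div_lt_iff₀ hε] at hm
  by_contra hcon
  push Not at hcon
  nlinarith

/-! ### The alternating direction iteration in a product of inner product spaces -/

/-- The iteration of the alternating direction method with varying step sizes, split into the
components in the consensus space (`a`) and in its orthogonal complement (multipliers `l`,
residuals `r`). The numbers `f k` are the objective values, and `sub` is the subgradient
inequality at the iterates. -/
structure SplitRun {U W : Type*} [NormedAddCommGroup U] [InnerProductSpace ℝ U]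
    [NormedAddCommGroup W] [InnerProductSpace ℝ W] (ρ : ℕ → ℝ) (a : ℕ → U) (l r : ℕ → W)
    (f : ℕ → ℝ) : Prop where
  step : ∀ k, l (k + 1) = l k - ρ k • r (k + 1)
  sub : ∀ k m, f (k + 1) - ρ k * inner ℝ (a (k + 1) - a k) (a (m + 1) - a (k + 1))
    + inner ℝ (l (k + 1)) (r (m + 1) - r (k + 1)) ≤ f (m + 1)

namespace SplitRun

variable {U W : Type*} [NormedAddCommGroup U] [InnerProductSpace ℝ U]
  [NormedAddCommGroup W] [InnerProductSpace ℝ W] {ρ : ℕ → ℝ} {a : ℕ → U} {l r : ℕ → W} {f : ℕ → ℝ}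

/-- The sum of squares of the primal residual and of the change of the consensus variable. -/
noncomputable def change (a : ℕ → U) (r : ℕ → W) (k : ℕ) : ℝ :=
  ‖r (k + 1)‖ ^ 2 + ‖a (k + 1) - a k‖ ^ 2

/-- The second differences that measure the decrease of `change`. -/
noncomputable def dissipation (ρ : ℕ → ℝ) (a : ℕ → U) (r : ℕ → W) (k : ℕ) : ℝ :=
  ‖r (k + 2) - r (k + 1)‖ ^ 2
    + ‖(a (k + 2) - a (k + 1)) - (ρ k / ρ (k + 1)) • (a (k + 1) - a k)‖ ^ 2

/-- Monotonicity of the subgradient: adding the inequalities at two consecutive iterates, each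
tested against the other, cancels the objective values. Polarization of the remaining inner products
produces the dissipation. -/
theorem change_succ_le (h : SplitRun ρ a l r f) (hρ : ∀ k, 0 < ρ k) (k : ℕ) :
    change a r (k + 1) ≤ ‖r (k + 1)‖ ^ 2 + (ρ k / ρ (k + 1)) ^ 2 * ‖a (k + 1) - a k‖ ^ 2
      - dissipation ρ a r k := by
  have h1 := h.sub k (k + 1)
  have h2 := h.sub (k + 1) k
  have hl : l (k + 1 + 1) = l (k + 1) - ρ (k + 1) • r (k + 1 + 1) := h.step (k + 1)
  simp only [hl] at h2
  unfold change dissipation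
  simp only [show k + 2 = k + 1 + 1 from rfl]
  generalize r (k + 1 + 1) = r2 at *
  generalize r (k + 1) = r1 at *
  generalize hd2 : a (k + 1 + 1) - a (k + 1) = d2 at *
  have hd2' : a (k + 1) - a (k + 1 + 1) = - d2 := by rw [← hd2]; abel
  rw [hd2'] at h2
  generalize a (k + 1) - a k = d1 at *
  generalize l (k + 1) = l1 at *
  have hp := hρ (k + 1)
  set σ := ρ k / ρ (k + 1) with hσ
  have hk : ρ k = σ * ρ (k + 1) := by rw [hσ]; field_simp
  rw [hk] at h1
  generalize ρ (k + 1) = p at *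
  rw [inner_neg_right, real_inner_self_eq_norm_sq, inner_sub_left, inner_smul_left,
    inner_sub_right, inner_sub_right, real_inner_self_eq_norm_sq] at h2
  rw [inner_sub_right] at h1
  rw [norm_sub_sq_real r2 r1, norm_sub_sq_real d2 (σ • d1), inner_smul_right, norm_smul, mul_pow,
    Real.norm_eq_abs, sq_abs, real_inner_comm d1 d2]
  simp only [conj_trivial] at h2
  have h3 : p * (‖r2‖ ^ 2 - inner ℝ r2 r1 + ‖d2‖ ^ 2 - σ * inner ℝ d1 d2) ≤ 0 := by linarith
  have h4 := nonpos_of_mul_nonpos_right h3 hp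
  linarith

theorem dissipation_nonneg {X Y : Type*} [NormedAddCommGroup X] [InnerProductSpace ℝ X]
    [NormedAddCommGroup Y] {ρ : ℕ → ℝ} {a : ℕ → X} {r : ℕ → Y} (k : ℕ) :
    0 ≤ dissipation ρ a r k := by
  unfold dissipation
  positivity

/-- The arithmetic of one step of `change_tendsto`, with `t = 1 / (k + 1)`, `d` the squared
increment and `s` the root of the dissipation. The factor `σ ^ 2 - 1` is at most a multiple of `t`,
and the product of `t` and `s` is split into `s ^ 2 / 2`, which half of the dissipation absorbs, and
a multiple of `t ^ 2`. -/
theorem le_of_step_estimates {C B t σ s d q q' q'' : ℝ} (hC : 0 ≤ C) (ht : 0 ≤ t)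
    (ht1 : t ≤ 1) (hσ1 : 1 ≤ σ) (hσ : σ ≤ 1 + C * t) (hd : 0 ≤ d)
    (h : d ≤ q' - q + B * (s + 2 * B * C * t)) (hq : t * q' ≤ q'' + 2 * B ^ 2 * t ^ 2) :
    (σ ^ 2 - 1) * d ≤ (2 * C + C ^ 2) * q'' - (2 * C + C ^ 2) * (t * q) + s ^ 2 / 2
      + ((2 * C + C ^ 2) ^ 2 * B ^ 2 / 2 + 2 * B ^ 2 * C * (2 * C + C ^ 2)
        + 2 * (2 * C + C ^ 2) * B ^ 2) * t ^ 2 := by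
  have h1 : σ ^ 2 - 1 ≤ (2 * C + C ^ 2) * t := by
    have : σ ^ 2 ≤ (1 + C * t) ^ 2 := by gcongr
    have : C ^ 2 * t ^ 2 ≤ C ^ 2 * t := by
      have : t ^ 2 ≤ t := by nlinarith
      gcongr
    linarith
  have hC₁ : 0 ≤ 2 * C + C ^ 2 := by positivity
  generalize 2 * C + C ^ 2 = C₁ at *
  have h2 := mul_le_mul_of_nonneg_right h1 hd
  have h3 := mul_le_mul_of_nonneg_left h (mul_nonneg hC₁ ht)
  have h4 := mul_le_mul_of_nonneg_left hq hC₁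
  have h5 := sq_nonneg (C₁ * t * B - s)
  linarith

/-- The growth allowed by `change_succ_le` is O(1/k) times the squared increment, which need not be
summable a priori. With `q k` the inner product of `a k` and its increment, the squared increment is
`q (k + 1) - q k` up to a second difference. Summation by parts therefore replaces the growth by the
bounded correction in `Ψ` and errors of order 1/k². -/
theorem change_tendsto (h : SplitRun ρ a l r f) (hρ : ProperStepsize ρ) {B : ℝ}
    (hB : ∀ k, ‖a k‖ ≤ B) :
    (∃ w, Tendsto (change a r) atTop (𝓝 w)) ∧ Summable (dissipation ρ a r) := by
  obtain ⟨C, hC0, hC⟩ := hρ.exists_slow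
  have hB0 : 0 ≤ B := (norm_nonneg _).trans (hB 0)
  set C₁ := 2 * C + C ^ 2 with hC₁
  have hC₁0 : 0 ≤ C₁ := by positivity
  set q : ℕ → ℝ := fun k => inner ℝ (a k) (a (k + 1) - a k) with hq
  have hd : ∀ k, ‖a (k + 1) - a k‖ ≤ 2 * B := fun k =>
    (norm_sub_le _ _).trans (by linarith [hB k, hB (k + 1)])
  have hqB : ∀ k, |q k| ≤ 2 * B ^ 2 := fun k =>
    (abs_real_inner_le_norm _ _).trans ((mul_le_mul (hB k) (hd k) (norm_nonneg _) hB0).trans_eq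
      (by ring))
  set C₂ := C₁ ^ 2 * B ^ 2 / 2 + 2 * B ^ 2 * C * C₁ + 2 * C₁ * B ^ 2 with hC₂
  set Ψ : ℕ → ℝ := fun k => change a r k - C₁ * (q k / (k + 1)) with hΨ
  have hΨb : ∀ k, -(2 * C₁ * B ^ 2) ≤ Ψ k := by
    intro k
    have h1 : 0 ≤ change a r k := by unfold change; positivity
    have h2 : q k / (k + 1) ≤ 2 * B ^ 2 :=
      (div_le_of_le_mul₀ (by positivity) (by positivity) (by
        have := le_abs_self (q k)
        have : (0 : ℝ) ≤ k := Nat.cast_nonneg k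
        nlinarith [hqB k, sq_nonneg B]))
    simp only [hΨ]
    nlinarith
  have hstep : ∀ k, Ψ (k + 1) ≤ Ψ k - dissipation ρ a r k / 2 + C₂ * (1 / ((k : ℝ) + 1) ^ 2) := by
    intro k
    have hk0 : (0 : ℝ) ≤ k := Nat.cast_nonneg k
    have h1 := h.change_succ_le hρ.pos k
    set σ := ρ k / ρ (k + 1) with hσ
    have hσ1 : 1 ≤ σ := hρ.one_le_div k
    have hσC : σ ≤ 1 + C / (k + 1) := hC k
    set t : ℝ := 1 / ((k : ℝ) + 1) with ht
    have ht0 : 0 < t := by positivity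
    have ht1 : t ≤ 1 := by
      rw [ht, div_le_one (by positivity)]
      linarith
    have hσC' : σ ≤ 1 + C * t := by rw [ht, mul_one_div]; exact hσC
    have htt : 1 / ((k : ℝ) + 1) ^ 2 = t ^ 2 := by rw [ht]; simp
    set D := dissipation ρ a r k with hD
    have hD0 : 0 ≤ D := dissipation_nonneg k
    set d1 := a (k + 1) - a k with hd1
    set d2 := a (k + 2) - a (k + 1) with hd2
    have h2 : ‖d2 - d1‖ ≤ √D + 2 * B * C * t := by
      have e1 : d2 - d1 = (d2 - σ • d1) + (σ - 1) • d1 := by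
        rw [sub_smul, one_smul]
        abel
      have e2 : ‖d2 - σ • d1‖ ≤ √D := by
        apply Real.le_sqrt_of_sq_le
        rw [hD, dissipation]
        have : 0 ≤ ‖r (k + 2) - r (k + 1)‖ ^ 2 := by positivity
        linarith
      have e3 : ‖(σ - 1) • d1‖ ≤ 2 * B * C * t := by
        rw [norm_smul, Real.norm_of_nonneg (by linarith)]
        have := mul_le_mul (show σ - 1 ≤ C * t by linarith) (hd k) (norm_nonneg _) (by positivity)
        linarith
      rw [e1]
      exact (norm_add_le _ _).trans (add_le_add e2 e3)
    -- Discrete product rule for `q`; the second difference `d2 - d1` is controlled by the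
    -- dissipation and by `σ - 1`.
    have h3 : ‖d1‖ ^ 2 ≤ q (k + 1) - q k + B * (√D + 2 * B * C * t) := by
      have e1 : q (k + 1) - q k = ‖d1‖ ^ 2 + inner ℝ (a (k + 1)) (d2 - d1) := by
        have e0 : inner ℝ (a (k + 1)) d1 = inner ℝ (a k) d1 + ‖d1‖ ^ 2 := by
          rw [← real_inner_self_eq_norm_sq, ← inner_add_left, hd1, add_sub_cancel]
        have e2 : q (k + 1) = inner ℝ (a (k + 1)) d2 := rfl
        have e3 : q k = inner ℝ (a k) d1 := rfl
        rw [e2, e3, inner_sub_right _ d2 d1, e0]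
        ring
      have e2 : -(B * (√D + 2 * B * C * t)) ≤ inner ℝ (a (k + 1)) (d2 - d1) := by
        have := (abs_le.1 (abs_real_inner_le_norm (a (k + 1)) (d2 - d1))).1
        have := mul_le_mul (hB (k + 1)) h2 (norm_nonneg _) hB0
        linarith
      linarith
    -- The weight in `Ψ (k + 1)` is `1 / (k + 2)` rather than `t`; their difference is at most `t ^
    -- 2`.
    have h8 : t * q (k + 1) ≤ q (k + 1) / ((k + 1 : ℕ) + 1) + 2 * B ^ 2 * t ^ 2 := by
      have e0 : t - 1 / ((k : ℝ) + 2) = t * (1 / ((k : ℝ) + 2)) := by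
        rw [ht]
        field_simp
        ring
      have e1 : 1 / ((k : ℝ) + 2) ≤ t := by
        rw [ht]
        gcongr
        linarith
      have e2 : t - 1 / ((k : ℝ) + 2) ≤ t ^ 2 := by
        rw [e0, pow_two]
        gcongr
      have e3 : (t - 1 / ((k : ℝ) + 2)) * q (k + 1) ≤ t ^ 2 * (2 * B ^ 2) :=
        (mul_le_mul_of_nonneg_left ((le_abs_self _).trans (hqB (k + 1))) (sub_nonneg.2 e1)).trans
          (mul_le_mul_of_nonneg_right e2 (by positivity))
      have e4 : q (k + 1) / ((k + 1 : ℕ) + 1) = 1 / ((k : ℝ) + 2) * q (k + 1) := by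
        push_cast
        rw [show (k : ℝ) + 1 + 1 = k + 2 by ring]
        ring
      rw [e4]
      linarith
    have h9 : q k / ((k : ℝ) + 1) = t * q k := by rw [ht]; ring
    have h10 : change a r (k + 1) ≤ change a r k + (σ ^ 2 - 1) * ‖d1‖ ^ 2 - D := by
      have e : change a r k = ‖r (k + 1)‖ ^ 2 + ‖d1‖ ^ 2 := rfl
      linarith
    simp only [hΨ]
    rw [htt, h9]
    have h11 := le_of_step_estimates hC0 ht0.le ht1 hσ1 hσC'
      (sq_nonneg ‖d1‖) h3 h8
    rw [Real.sq_sqrt hD0] at h11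
    simp only [hC₂, hC₁]
    linarith
  obtain ⟨⟨w, hw⟩, hs⟩ := tendsto_of_le_sub_add hΨb
    (fun k => div_nonneg (dissipation_nonneg (ρ := ρ) (a := a) (r := r) k) zero_le_two)
    (fun k => by positivity) (summable_inv_succ_sq.mul_left C₂) hstep
  refine ⟨⟨w, ?_⟩, (hs.mul_left 2).congr fun k => by ring⟩
  have hz : Tendsto (fun k : ℕ => q k / ((k : ℝ) + 1)) atTop (𝓝 0) := by
    refine squeeze_zero_norm (a := fun k : ℕ => 2 * B ^ 2 * (1 / ((k : ℝ) + 1))) (fun k => ?_) ?_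
    · rw [Real.norm_eq_abs, abs_div, abs_of_pos (show (0 : ℝ) < k + 1 by positivity), mul_one_div]
      gcongr
      exact hqB k
    · have := tendsto_one_div_add_atTop_nhds_zero_nat (𝕜 := ℝ).const_mul (2 * B ^ 2)
      rwa [mul_zero] at this
  have := hw.add (hz.const_mul C₁)
  simp only [hΨ] at this
  refine (this.congr fun k => by ring).trans (by simp)

/-- Summable dissipation and step ratios tending to one make the second differences of the bounded
sequence `a` vanish. -/
theorem tendsto_diff_zero (h : SplitRun ρ a l r f) (hρ : ProperStepsize ρ) {B : ℝ}
    (hB : ∀ k, ‖a k‖ ≤ B) : Tendsto (fun k => a (k + 1) - a k) atTop (𝓝 0) := by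
  refine tendsto_sub_zero_of_bounded hB ?_
  obtain ⟨C, hC0, hC⟩ := hρ.exists_slow
  have hD := (h.change_tendsto hρ hB).2.tendsto_atTop_zero
  have hs : Tendsto (fun k => √(dissipation ρ a r k)) atTop (𝓝 0) := by
    simpa [Function.comp_def] using (Real.continuous_sqrt.tendsto 0).comp hD
  have hz : Tendsto (fun k : ℕ => 2 * B * C * (1 / ((k : ℝ) + 1))) atTop (𝓝 0) := by
    simpa using tendsto_one_div_add_atTop_nhds_zero_nat.const_mul (2 * B * C)
  refine squeeze_zero_norm (fun k => ?_) (by simpa using hs.add hz)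
  set σ := ρ k / ρ (k + 1) with hσ
  have e1 : (a (k + 2) - a (k + 1)) - (a (k + 1) - a k)
      = ((a (k + 2) - a (k + 1)) - σ • (a (k + 1) - a k)) + (σ - 1) • (a (k + 1) - a k) := by
    rw [sub_smul, one_smul]
    abel
  rw [e1]
  refine (norm_add_le _ _).trans (add_le_add (Real.le_sqrt_of_sq_le ?_) ?_)
  · rw [dissipation]
    have : 0 ≤ ‖r (k + 2) - r (k + 1)‖ ^ 2 := by positivity
    linarith
  · have hσ1 : 1 ≤ σ := hρ.one_le_div k
    have hσC : σ ≤ 1 + C / (k + 1) := hC k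
    have hσC' : σ - 1 ≤ C * (1 / (k + 1)) := by rw [mul_one_div]; linarith
    rw [norm_smul, Real.norm_of_nonneg (by linarith)]
    have hd : ‖a (k + 1) - a k‖ ≤ 2 * B :=
      (norm_sub_le _ _).trans (by linarith [hB k, hB (k + 1)])
    have := mul_le_mul hσC' hd (norm_nonneg _) (by positivity)
    refine this.trans_eq ?_
    simp only [one_div]
    ring

/-- The residuals vanish if the consensus variables are bounded and there is a feasible point. -/
theorem tendsto_residual_zero (h : SplitRun ρ a l r f) (hρ : ProperStepsize ρ) {B : ℝ}
    (hB : ∀ k, ‖a k‖ ≤ B) {a' : U} {f' : ℝ}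
    (hf : ∀ k, f (k + 1) - ρ k * inner ℝ (a (k + 1) - a k) (a' - a (k + 1))
      - inner ℝ (l (k + 1)) (r (k + 1)) ≤ f') :
    Tendsto r atTop (𝓝 0) := by
  have hd := h.tendsto_diff_zero hρ hB
  obtain ⟨⟨w, hw⟩, -⟩ := h.change_tendsto hρ hB
  have hdn : Tendsto (fun k => ‖a (k + 1) - a k‖) atTop (𝓝 0) := by simpa using hd.norm
  have hr : Tendsto (fun k => ‖r (k + 1)‖ ^ 2) atTop (𝓝 w) := by
    have := hw.sub (hdn.pow 2)
    simp only [change] at this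
    refine (this.congr fun k => by ring).trans (by simp)
  have hw0 : 0 ≤ w := ge_of_tendsto' hr fun k => by positivity
  suffices hw' : w = 0 by
    rw [hw'] at hr
    refine (tendsto_add_atTop_iff_nat 1).1 (tendsto_zero_iff_norm_tendsto_zero.2 ?_)
    have := (Real.continuous_sqrt.tendsto 0).comp hr
    simpa [Function.comp_def, Real.sqrt_sq (norm_nonneg _)] using this
  by_contra hne
  have hwpos : 0 < w := lt_of_le_of_ne hw0 (Ne.symm hne)
  obtain ⟨C, hC0, hC⟩ := hρ.exists_slow
  -- The Lagrangian along the run. The multiplier update adds the step size times the squared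
  -- residual to it, and `hf` bounds it from above.
  set K : ℕ → ℝ := fun k => f (k + 1) - inner ℝ (l (k + 1)) (r (k + 1)) with hK
  have hstep : ∀ k, K k + ρ (k + 1) * ‖r (k + 2)‖ ^ 2
      - ρ k * inner ℝ (a (k + 1) - a k) (a (k + 2) - a (k + 1)) ≤ K (k + 1) := by
    intro k
    have h1 := h.sub k (k + 1)
    have hl : l (k + 1 + 1) = l (k + 1) - ρ (k + 1) • r (k + 1 + 1) := h.step (k + 1)
    simp only [hK, hl, inner_sub_left (l (k + 1)), inner_smul_left, conj_trivial,
      real_inner_self_eq_norm_sq]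
    rw [inner_sub_right (l (k + 1))] at h1
    simp only [show k + 2 = k + 1 + 1 from rfl]
    linarith
  have hKb : ∀ k, K k ≤ f' + ρ 0 * (2 * B) * (‖a'‖ + B) := by
    intro k
    have h1 := hf k
    have h2 := abs_real_inner_le_norm (a (k + 1) - a k) (a' - a (k + 1))
    have h3 : ‖a (k + 1) - a k‖ ≤ 2 * B :=
      (norm_sub_le _ _).trans (by linarith [hB k, hB (k + 1)])
    have h4 : ‖a' - a (k + 1)‖ ≤ ‖a'‖ + B :=
      (norm_sub_le _ _).trans (by linarith [hB (k + 1)])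
    have hB0 : 0 ≤ B := (norm_nonneg _).trans (hB 0)
    have h5 : inner ℝ (a (k + 1) - a k) (a' - a (k + 1)) ≤ 2 * B * (‖a'‖ + B) :=
      (le_abs_self _).trans (h2.trans (mul_le_mul h3 h4 (norm_nonneg _) (by positivity)))
    have h6 : ρ k * inner ℝ (a (k + 1) - a k) (a' - a (k + 1)) ≤ ρ 0 * (2 * B * (‖a'‖ + B)) :=
      (mul_le_mul_of_nonneg_left h5 (hρ.pos k).le).trans
        (mul_le_mul_of_nonneg_right (hρ.antitone (Nat.zero_le k)) (by positivity))
    simp only [hK]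
    linarith
  have hprod : Tendsto (fun k => (1 + C) * (‖a (k + 1) - a k‖ * ‖a (k + 2) - a (k + 1)‖))
      atTop (𝓝 0) := by
    simpa using (hdn.mul (hdn.comp (tendsto_add_atTop_nat 1))).const_mul (1 + C)
  -- The squared residual eventually exceeds `w / 2`, and the cross term of two vanishing increments
  -- costs at most `w / 4`.
  have hev : ∀ᶠ k in atTop, K k + ρ (k + 1) * (w / 4) ≤ K (k + 1) := by
    have e1 := (hr.comp (tendsto_add_atTop_nat 1)).eventually_const_lt
      (show w / 2 < w by linarith)
    have e2 := hprod.eventually_lt_const (show 0 < w / 4 by linarith)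
    filter_upwards [e1, e2] with k h1 h2
    have h3 := hstep k
    have hp := hρ.pos (k + 1)
    have h4 : ρ k ≤ ρ (k + 1) * (1 + C) := by
      have := hC k
      rw [div_le_iff₀ hp] at this
      have h5 : C / ((k : ℝ) + 1) ≤ C := div_le_self hC0 (by linarith [(Nat.cast_nonneg k : (0:ℝ) ≤ k)])
      nlinarith
    have h5 : ρ k * inner ℝ (a (k + 1) - a k) (a (k + 2) - a (k + 1)) ≤ ρ (k + 1) * (w / 4) := by
      have e := real_inner_le_norm (a (k + 1) - a k) (a (k + 2) - a (k + 1))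
      calc _ ≤ ρ k * (‖a (k + 1) - a k‖ * ‖a (k + 2) - a (k + 1)‖) :=
            mul_le_mul_of_nonneg_left e (hρ.pos k).le
        _ ≤ ρ (k + 1) * (1 + C) * (‖a (k + 1) - a k‖ * ‖a (k + 2) - a (k + 1)‖) :=
            mul_le_mul_of_nonneg_right h4 (by positivity)
        _ ≤ _ := by
          rw [mul_assoc]
          exact mul_le_mul_of_nonneg_left h2.le hp.le
    have h6 : w / 2 < ‖r (k + 2)‖ ^ 2 := h1
    nlinarith
  obtain ⟨N, hN⟩ := eventually_atTop.1 hev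
  have hsum : ∀ m, ∑ j ∈ Finset.range m, ρ (N + 1 + j) * (w / 4) ≤ K (N + m) - K N := by
    intro m
    induction m with
    | zero => simp
    | succ m ih =>
      rw [Finset.sum_range_succ]
      have := hN (N + m) (by omega)
      rw [show N + 1 + m = N + m + 1 by ring, show N + (m + 1) = N + m + 1 by ring]
      linarith
  have hsm : Summable fun j => ρ (N + 1 + j) * (w / 4) :=
    summable_of_sum_range_le (fun j => (mul_pos (hρ.pos _) (by linarith)).le)
      fun m => (hsum m).trans (sub_le_sub_right (hKb (N + m)) _)
  have hsm' : Summable fun j => ρ (j + (N + 1)) := by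
    have := hsm.mul_right (w / 4)⁻¹
    refine this.congr fun j => ?_
    rw [add_comm (N + 1) j]
    field_simp
  exact hρ.not_summable ((summable_nat_add_iff (N + 1)).1 hsm')

/-- If a multiplier exists, then the multipliers of the iteration are bounded, and the scaled
residuals vanish. -/
theorem fejer (h : SplitRun ρ a l r f) (hρ : ProperStepsize ρ) {a' : U} {l' : W} {f' : ℝ}
    (hf : ∀ k, f (k + 1) - ρ k * inner ℝ (a (k + 1) - a k) (a' - a (k + 1))
      - inner ℝ (l (k + 1)) (r (k + 1)) ≤ f')
    (hl : ∀ k, f' + inner ℝ l' (r (k + 1)) ≤ f (k + 1)) :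
    (∃ B, ∀ k, ‖l k‖ ≤ B) ∧ Tendsto (fun k => ρ k • (a (k + 1) - a k)) atTop (𝓝 0) := by
  -- The weighted squared distance to a saddle point. The weight of its second term does not
  -- increase because the step sizes do not.
  set V : ℕ → ℝ := fun k => ‖l k - l'‖ ^ 2 + ρ k ^ 2 * ‖a k - a'‖ ^ 2 with hV
  have hstep : ∀ k, V (k + 1) ≤ V k - ‖ρ k • (a (k + 1) - a k)‖ ^ 2 := by
    intro k
    have h1 := hf k
    have h2 := hl k
    have h3 := h.step k
    have hp := hρ.pos k
    have e1 : l k - l' = (l (k + 1) - l') + ρ k • r (k + 1) := by rw [h3]; abel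
    have e2 : a k - a' = (a (k + 1) - a') - (a (k + 1) - a k) := by abel
    have e3 : a' - a (k + 1) = -(a (k + 1) - a') := by abel
    have h4 : ρ (k + 1) ^ 2 * ‖a (k + 1) - a'‖ ^ 2 ≤ ρ k ^ 2 * ‖a (k + 1) - a'‖ ^ 2 := by
      have := hρ.antitone k.le_succ
      have := (hρ.pos (k + 1)).le
      gcongr
    -- Adding the upper bound `hf` and the saddle point bound `hl` eliminates both objective values.
    have h5 : ρ k * (ρ k * inner ℝ (a (k + 1) - a') (a (k + 1) - a k)
        - inner ℝ (l (k + 1) - l') (r (k + 1))) ≤ 0 := by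
      refine mul_nonpos_of_nonneg_of_nonpos hp.le ?_
      rw [e3, inner_neg_right, real_inner_comm] at h1
      rw [inner_sub_left (l (k + 1))]
      linarith
    simp only [hV]
    rw [e1, e2, norm_add_sq_real, norm_sub_sq_real (a (k + 1) - a'), inner_smul_right, norm_smul, norm_smul,
      mul_pow, mul_pow, Real.norm_eq_abs, sq_abs]
    have h6 : 0 ≤ ρ k ^ 2 * ‖r (k + 1)‖ ^ 2 := by positivity
    nlinarith
  obtain ⟨-, hs⟩ := tendsto_of_le_sub_add (u := V) (b := 0) (s := 0)
    (D := fun k => ‖ρ k • (a (k + 1) - a k)‖ ^ 2)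
    (fun k => by simp only [hV]; positivity) (fun k => by positivity) (fun k => le_rfl)
    summable_zero (fun k => by simpa using hstep k)
  have hVa : ∀ k, V k ≤ V 0 := by
    intro k
    induction k with
    | zero => exact le_rfl
    | succ k ih => nlinarith [hstep k, sq_nonneg ‖ρ k • (a (k + 1) - a k)‖]
  constructor
  · refine ⟨√(V 0) + ‖l'‖, fun k => ?_⟩
    have h1 : ‖l k - l'‖ ≤ √(V 0) := by
      apply Real.le_sqrt_of_sq_le
      have := hVa k
      have h2 : 0 ≤ ρ k ^ 2 * ‖a k - a'‖ ^ 2 := by positivity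
      simp only [hV] at this ⊢
      linarith
    have := norm_add_le (l k - l') l'
    rw [sub_add_cancel] at this
    linarith
  · have := (Real.continuous_sqrt.tendsto 0).comp hs.tendsto_atTop_zero
    refine tendsto_zero_iff_norm_tendsto_zero.2 ?_
    simpa [Function.comp_def, Real.sqrt_sq (norm_nonneg _)] using this

/-- Convergence of the objective values. -/
theorem tendsto_value (h : SplitRun ρ a l r f) (hρ : ProperStepsize ρ) {B : ℝ}
    (hB : ∀ k, ‖a k‖ ≤ B) {a' : U} {l' : W} {f' : ℝ}
    (hf : ∀ k, f (k + 1) - ρ k * inner ℝ (a (k + 1) - a k) (a' - a (k + 1))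
      - inner ℝ (l (k + 1)) (r (k + 1)) ≤ f')
    (hl : ∀ k, f' + inner ℝ l' (r (k + 1)) ≤ f (k + 1)) :
    Tendsto (fun k => f (k + 1)) atTop (𝓝 f') := by
  have hr := (h.tendsto_residual_zero hρ hB hf).comp (tendsto_add_atTop_nat 1)
  obtain ⟨⟨L, hL⟩, hd⟩ := h.fejer hρ hf hl
  have hrn : Tendsto (fun k => ‖r (k + 1)‖) atTop (𝓝 0) := by simpa using hr.norm
  have h1 : Tendsto (fun k => f' + inner ℝ l' (r (k + 1))) atTop (𝓝 f') := by
    have := (tendsto_const_nhds (x := l')).inner (𝕜 := ℝ) hr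
    simpa using this.const_add f'
  have h2 : Tendsto (fun k => f' + ‖ρ k • (a (k + 1) - a k)‖ * (‖a'‖ + B) + L * ‖r (k + 1)‖)
      atTop (𝓝 f') := by
    have hdn : Tendsto (fun k => ‖ρ k • (a (k + 1) - a k)‖) atTop (𝓝 0) := by simpa using hd.norm
    simpa using ((hdn.mul_const (‖a'‖ + B)).const_add f').add (hrn.const_mul L)
  refine tendsto_of_tendsto_of_tendsto_of_le_of_le h1 h2 hl fun k => ?_
  have h3 := hf k
  have h4 := real_inner_le_norm (ρ k • (a (k + 1) - a k)) (a' - a (k + 1))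
  rw [inner_smul_left, conj_trivial] at h4
  have h5 : ‖a' - a (k + 1)‖ ≤ ‖a'‖ + B :=
    (norm_sub_le _ _).trans (by linarith [hB (k + 1)])
  have h6 := mul_le_mul_of_nonneg_left h5 (norm_nonneg (ρ k • (a (k + 1) - a k)))
  have h7 := real_inner_le_norm (l (k + 1)) (r (k + 1))
  have h8 := mul_le_mul_of_nonneg_right (hL (k + 1)) (norm_nonneg (r (k + 1)))
  simp only
  linarith

end SplitRun

/-! ### The exchange iteration between the nodes of a complete graph -/

/-- A linear filter with eigenvalues inside the unit disc: bounded input gives bounded output. -/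
theorem bounded_of_filter {h V E σ : ℕ → ℝ} {c B : ℝ} (hc0 : 0 ≤ c) (hc : c ≤ 1 / 2)
    (hE : ∀ k, |E k| ≤ B) (hσ : ∀ᶠ k in atTop, σ k ^ 2 ≤ 6 / 5)
    (hV : ∀ k, V (k + 1) = h k - E k + c * σ k * V k)
    (hh : ∀ k, h (k + 1) = h k - (1 - c) * V (k + 1)) : ∃ B, ∀ k, |h k| ≤ B := by
  -- With the weight `c * (1 - c)`, the recursion without input and with `σ = 1` multiplies this
  -- form by exactly `c`.
  set Q : ℕ → ℝ := fun k => h k ^ 2 + c * (1 - c) * V k ^ 2 with hQ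
  have hcc : 0 ≤ c * (1 - c) := mul_nonneg hc0 (by linarith)
  obtain ⟨K, hK⟩ : ∃ K, ∀ k, Q k ≤ K := by
    -- The rate 3/4 is the product of 1/2 from `c`, 6/5 from `σ ^ 2` and 5/4 from splitting off the
    -- input. The input itself is counted with the factor 5.
    refine bddAbove_of_eventually_le_mul_add (q := 3 / 4) (K := 5 * (1 - c) * B ^ 2)
      (by norm_num) (by norm_num) ?_
    filter_upwards [hσ] with k hk
    set X := c * h k - c * σ k * (1 - c) * V k with hX
    set Y := h k + c * σ k * V k with hY
    have h1 : h (k + 1) = X + (1 - c) * E k := by rw [hh, hV, hX]; ring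
    have h2 : V (k + 1) = Y - E k := by rw [hV, hY]; ring
    have h3 : X ^ 2 + c * (1 - c) * Y ^ 2 = c * (h k ^ 2 + c * (1 - c) * (σ k ^ 2 * V k ^ 2)) := by
      rw [hX, hY]; ring
    have h4 : E k ^ 2 ≤ B ^ 2 := sq_le_sq' (by linarith [(abs_le.1 (hE k)).1]) (abs_le.1 (hE k)).2
    have h5 : c * (h k ^ 2 + c * (1 - c) * (σ k ^ 2 * V k ^ 2)) ≤ 3 / 5 * Q k := by
      have : σ k ^ 2 * V k ^ 2 ≤ 6 / 5 * V k ^ 2 := mul_le_mul_of_nonneg_right hk (sq_nonneg _)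
      have h6 : h k ^ 2 + c * (1 - c) * (σ k ^ 2 * V k ^ 2) ≤ 6 / 5 * Q k := by
        have := mul_le_mul_of_nonneg_left this hcc
        simp only [hQ]
        linarith [sq_nonneg (h k)]
      have h7 : 0 ≤ Q k := by simp only [hQ]; positivity
      calc _ ≤ c * (6 / 5 * Q k) := mul_le_mul_of_nonneg_left h6 hc0
        _ ≤ 1 / 2 * (6 / 5 * Q k) := mul_le_mul_of_nonneg_right hc (by positivity)
        _ = _ := by ring
    have h6 : (X + (1 - c) * E k) ^ 2 ≤ 5 / 4 * X ^ 2 + 5 * ((1 - c) * E k) ^ 2 := by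
      linarith [sq_nonneg (X / 2 - 2 * ((1 - c) * E k))]
    have h7 : (Y - E k) ^ 2 ≤ 5 / 4 * Y ^ 2 + 5 * E k ^ 2 := by
      linarith [sq_nonneg (Y / 2 + 2 * E k)]
    have h8 := mul_le_mul_of_nonneg_left h7 hcc
    have h9 := mul_le_mul_of_nonneg_left h4 (show 0 ≤ 5 * (1 - c) by linarith)
    have h10 : Q (k + 1) = (X + (1 - c) * E k) ^ 2 + c * (1 - c) * (Y - E k) ^ 2 := by
      simp only [hQ, h1, h2]
    rw [h10]
    linarith
  refine ⟨√K, fun k => Real.abs_le_sqrt ((le_add_of_nonneg_right ?_).trans (hK k))⟩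
  positivity

/-! ### Arrays as Euclidean vectors, and orthogonality of symmetric and antisymmetric arrays -/

section Dot

variable {M τ : Type*}

/-- The array `x` as a point of a Euclidean space. -/
noncomputable def toEuclidean (x : M → M → τ → ℝ) : EuclideanSpace ℝ (M × M × τ) :=
  WithLp.toLp 2 fun p => x p.1 p.2.1 p.2.2

theorem toEuclidean_apply (x : M → M → τ → ℝ) (p : M × M × τ) :
    toEuclidean x p = x p.1 p.2.1 p.2.2 := rfl

theorem toEuclidean_sub (x y : M → M → τ → ℝ) :
    toEuclidean x - toEuclidean y = toEuclidean (x - y) := rfl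

theorem toEuclidean_smul (s : ℝ) (x : M → M → τ → ℝ) :
    s • toEuclidean x = toEuclidean (s • x) := rfl

variable [Fintype M] [Fintype τ]

theorem inner_toEuclidean (x y : M → M → τ → ℝ) :
    inner ℝ (toEuclidean x) (toEuclidean y) = ∑ i, ∑ j, ∑ t, x i j t * y i j t := by
  simp only [PiLp.inner_apply, toEuclidean_apply, Fintype.sum_prod_type, RCLike.inner_apply,
    conj_trivial, mul_comm]

theorem inner_toEuclidean_eq_zero {x y : M → M → τ → ℝ} (hx : ∀ i j t, x i j t = -x j i t)
    (hy : ∀ i j t, y i j t = y j i t) : inner ℝ (toEuclidean x) (toEuclidean y) = 0 := by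
  rw [inner_toEuclidean]
  have h : ∑ i, ∑ j, ∑ t, x i j t * y i j t = -∑ i, ∑ j, ∑ t, x i j t * y i j t := by
    conv_lhs => rw [Finset.sum_comm]
    simp only [← Finset.sum_neg_distrib]
    refine Finset.sum_congr rfl fun i _ => Finset.sum_congr rfl fun j _ =>
      Finset.sum_congr rfl fun t _ => ?_
    rw [hx j i, hy j i]
    ring
  linarith

theorem abs_le_norm_toEuclidean (x : M → M → τ → ℝ) (i j : M) (t : τ) :
    |x i j t| ≤ ‖toEuclidean x‖ :=
  PiLp.norm_apply_le (toEuclidean x) (i, j, t)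

theorem norm_toEuclidean_le {x : M → M → τ → ℝ} {B : ℝ} (hB : ∀ i j t, |x i j t| ≤ B) :
    ‖toEuclidean x‖ ≤ √(∑ _p : M × M × τ, B ^ 2) := by
  rw [EuclideanSpace.norm_eq]
  refine Real.sqrt_le_sqrt (Finset.sum_le_sum fun p _ => ?_)
  rw [Real.norm_eq_abs]
  exact pow_le_pow_left₀ (abs_nonneg _) (hB _ _ _) 2

end Dot

/-- The exchange iteration from its second step on: `x` are the local copies, `a` the consensus
variables, `l` the multipliers, and `g` the node prices. Only the entries of pairs of distinct
members of `G` are variables. -/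
structure ExchangeRun {M τ : Type*} (G : Finset M) (ρ : ℕ → ℝ) (x a l : ℕ → M → M → τ → ℝ)
    (g : ℕ → M → τ → ℝ) : Prop where
  anti : ∀ k i j t, a k i j t = -a k j i t
  symm : ∀ k i j t, l k i j t = l k j i t
  off_x : ∀ k i j t, ¬ (i ∈ G ∧ j ∈ G ∧ i ≠ j) → x k i j t = 0
  off_a : ∀ k i j t, ¬ (i ∈ G ∧ j ∈ G ∧ i ≠ j) → a k i j t = 0
  off_l : ∀ k i j t, ¬ (i ∈ G ∧ j ∈ G ∧ i ≠ j) → l k i j t = 0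
  step : ∀ k i j t, l (k + 1) i j t = l k i j t - ρ k * (x (k + 1) i j t - a (k + 1) i j t)
  price : ∀ k, ∀ i ∈ G, ∀ j ∈ G, i ≠ j → ∀ t,
    l k i j t + ρ k * (a k i j t - x (k + 1) i j t) = g (k + 1) i t

namespace ExchangeRun

variable {M τ : Type*} {G : Finset M} {ρ : ℕ → ℝ}
  {x a l : ℕ → M → M → τ → ℝ} {g : ℕ → M → τ → ℝ}

/-- The updates of the algorithm yield an exchange iteration from the first step on. -/
theorem of_updates {x a l : ℕ → M → M → τ → ℝ} {g : ℕ → M → τ → ℝ} (hρ : ∀ k, 0 < ρ k)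
    (hl0 : l 0 = 0) (hoff : ∀ k i j t, ¬ (i ∈ G ∧ j ∈ G ∧ i ≠ j) → x (k + 1) i j t = 0)
    (ha : ∀ k i j t, a (k + 1) i j t =
      (ρ k * (x (k + 1) i j t - x (k + 1) j i t) - (l k i j t - l k j i t)) / (2 * ρ k))
    (hl : ∀ k i j t, l (k + 1) i j t = l k i j t + ρ k * (a (k + 1) i j t - x (k + 1) i j t))
    (hg : ∀ k, ∀ i ∈ G, ∀ j ∈ G, i ≠ j → ∀ t,
      l k i j t + ρ k * (a k i j t - x (k + 1) i j t) = g (k + 1) i t) :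
    ExchangeRun G (fun k => ρ (k + 1)) (fun k => x (k + 1)) (fun k => a (k + 1))
      (fun k => l (k + 1)) (fun k => g (k + 1)) := by
  have hloff : ∀ k i j t, ¬ (i ∈ G ∧ j ∈ G ∧ i ≠ j) → l k i j t = 0 := by
    intro k
    induction k with
    | zero => intro i j t _; simp [hl0]
    | succ k ih =>
      intro i j t hp
      have hp' : ¬ (j ∈ G ∧ i ∈ G ∧ j ≠ i) := fun hc => hp ⟨hc.2.1, hc.1, hc.2.2.symm⟩
      rw [hl, ha, hoff k i j t hp, hoff k j i t hp', ih i j t hp, ih j i t hp']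
      simp
  refine ⟨fun k i j t => ?_, fun k i j t => ?_, fun k => hoff k, fun k i j t hp => ?_,
    fun k => hloff (k + 1), fun k i j t => ?_, fun k => hg (k + 1)⟩
  · rw [ha, ha k j i, ← neg_div]
    congr 1
    ring
  · have hp := (hρ k).ne'
    rw [hl, hl k j i, ha, ha k j i]
    field_simp
    ring
  · have hp' : ¬ (j ∈ G ∧ i ∈ G ∧ j ≠ i) := fun hc => hp ⟨hc.2.1, hc.1, hc.2.2.symm⟩
    rw [ha, hoff k i j t hp, hoff k j i t hp', hloff k i j t hp, hloff k j i t hp']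
    simp
  · rw [hl (k + 1)]
    ring

theorem price_left (h : ExchangeRun G ρ x a l g) (k : ℕ) {i j : M} (hi : i ∈ G) (hj : j ∈ G)
    (hij : i ≠ j) (t : τ) :
    l (k + 1) i j t - ρ k * (a (k + 1) i j t - a k i j t) = g (k + 1) i t := by
  have h1 := h.step k i j t
  have h2 := h.price k i hi j hj hij t
  linarith

/-- Adding the price relations of the two ends of an edge cancels the antisymmetric increment. -/
theorem mult_eq (h : ExchangeRun G ρ x a l g) (k : ℕ) {i j : M} (hi : i ∈ G) (hj : j ∈ G)
    (hij : i ≠ j) (t : τ) : l (k + 1) i j t = (g (k + 1) i t + g (k + 1) j t) / 2 := by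
  have h1 := h.price_left k hi hj hij t
  have h2 := h.price_left k hj hi hij.symm t
  rw [h.symm (k + 1) j i, h.anti (k + 1) j i, h.anti k j i] at h2
  linarith

/-- The increment is a potential difference with the node prices as potential. This is what freezes
the circulation and ties price equalization to vanishing scaled increments. -/
theorem diff_eq (h : ExchangeRun G ρ x a l g) (hρ : ∀ k, 0 < ρ k) (k : ℕ) {i j : M} (hi : i ∈ G)
    (hj : j ∈ G) (t : τ) :
    a (k + 1) i j t - a k i j t = (g (k + 1) j t - g (k + 1) i t) / (2 * ρ k) := by
  have hp := hρ k
  rcases eq_or_ne i j with rfl | hij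
  · have h1 := h.off_a k i i t (by simp)
    have h2 := h.off_a (k + 1) i i t (by simp)
    simp [h1, h2]
  · have h1 := h.price_left k hi hj hij t
    have h2 := h.mult_eq k hi hj hij t
    rw [eq_div_iff (by positivity)]
    linarith

/-- The residual of the clearing constraints is symmetric. -/
theorem residual_symm (h : ExchangeRun G ρ x a l g) (hρ : ∀ k, 0 < ρ k) (k : ℕ) (i j : M) (t : τ) :
    x (k + 1) i j t - a (k + 1) i j t = x (k + 1) j i t - a (k + 1) j i t := by
  have h1 := h.step k i j t
  have h2 := h.step k j i t
  rw [h.symm (k + 1) j i, h.symm k j i] at h2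
  have h3 : ρ k * (x (k + 1) i j t - a (k + 1) i j t)
      = ρ k * (x (k + 1) j i t - a (k + 1) j i t) := by linarith
  exact mul_left_cancel₀ (hρ k).ne' h3

variable [Fintype M]

theorem sum_eq {y : M → M → τ → ℝ} (hy : ∀ i j t, ¬ (i ∈ G ∧ j ∈ G ∧ i ≠ j) → y i j t = 0)
    (i : M) (t : τ) : ∑ j, y i j t = ∑ j ∈ G, y i j t :=
  (Finset.sum_subset (Finset.subset_univ G) fun j _ hj => hy i j t fun hc => hj hc.2.1).symm

theorem sum_diff (h : ExchangeRun G ρ x a l g) (hρ : ∀ k, 0 < ρ k) (k : ℕ) {i : M} (hi : i ∈ G)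
    (t : τ) : ∑ j, a (k + 1) i j t = ∑ j, a k i j t
      - (G.card * g (k + 1) i t - ∑ j ∈ G, g (k + 1) j t) / (2 * ρ k) := by
  rw [sum_eq (h.off_a _), sum_eq (h.off_a _)]
  have : ∑ j ∈ G, (a (k + 1) i j t - a k i j t)
      = ∑ j ∈ G, (g (k + 1) j t - g (k + 1) i t) / (2 * ρ k) :=
    Finset.sum_congr rfl fun j hj => h.diff_eq hρ k hi hj t
  rw [Finset.sum_sub_distrib, ← Finset.sum_div, Finset.sum_sub_distrib, Finset.sum_const,
    nsmul_eq_mul] at this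
  rw [sub_eq_iff_eq_add] at this
  rw [this]
  ring

/-- The circulation part of the consensus variables does not change. -/
theorem circulation (h : ExchangeRun G ρ x a l g) (hρ : ∀ k, 0 < ρ k) (k : ℕ) {i j : M}
    (hi : i ∈ G) (hj : j ∈ G) (t : τ) :
    a k i j t - (∑ m, a k i m t - ∑ m, a k j m t) / G.card
      = a 0 i j t - (∑ m, a 0 i m t - ∑ m, a 0 j m t) / G.card := by
  have hG : (G.card : ℝ) ≠ 0 := by
    exact_mod_cast (Finset.card_pos.2 ⟨i, hi⟩).ne'
  induction k with
  | zero => rfl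
  | succ k ih =>
    -- The entry and the divided difference of the row sums both change by `(g (k + 1) j t - g (k +
    -- 1) i t) / (2 * ρ k)`.
    rw [← ih, h.sum_diff hρ k hi, h.sum_diff hρ k hj]
    have h1 := h.diff_eq hρ k hi hj t
    rw [sub_eq_iff_eq_add] at h1
    rw [h1]
    have hp := (hρ k).ne'
    field_simp
    ring

theorem sum_sum_eq_zero (h : ExchangeRun G ρ x a l g) (k : ℕ) (t : τ) :
    ∑ i ∈ G, ∑ j, a k i j t = 0 := by
  simp only [fun i => sum_eq (h.off_a k) i t]
  have h1 : ∑ i ∈ G, ∑ j ∈ G, a k i j t = -∑ i ∈ G, ∑ j ∈ G, a k i j t := by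
    conv_lhs => rw [Finset.sum_comm]
    simp only [← Finset.sum_neg_distrib]
    exact Finset.sum_congr rfl fun i _ => Finset.sum_congr rfl fun j _ => h.anti k j i t
  linarith

/-- The net residual of a node in terms of the node prices. -/
theorem sum_residual (h : ExchangeRun G ρ x a l g) (hρ : ∀ k, 0 < ρ k) (k : ℕ) {i : M} (hi : i ∈ G)
    (t : τ) : ∑ j, x (k + 2) i j t = ∑ j, a (k + 2) i j t
      + (((G.card - 2) * g (k + 1) i t + ∑ j ∈ G, g (k + 1) j t)
        - ((G.card - 2) * g (k + 2) i t + ∑ j ∈ G, g (k + 2) j t)) / (2 * ρ (k + 1)) := by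
  classical
  have hp := hρ (k + 1)
  have h1 : ∀ m, ∑ j, l (m + 1) i j t
      = ((G.card - 2) * g (m + 1) i t + ∑ j ∈ G, g (m + 1) j t) / 2 := by
    intro m
    rw [sum_eq (h.off_l _), ← Finset.add_sum_erase G _ hi, h.off_l _ i i t (by simp), zero_add]
    have : ∑ j ∈ G.erase i, l (m + 1) i j t
        = ∑ j ∈ G.erase i, (g (m + 1) i t + g (m + 1) j t) / 2 :=
      Finset.sum_congr rfl fun j hj => h.mult_eq m hi (Finset.mem_of_mem_erase hj)
        (Finset.ne_of_mem_erase hj).symm t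
    rw [this, ← Finset.add_sum_erase G (fun j => g (m + 1) j t) hi, ← Finset.sum_div,
      Finset.sum_add_distrib, Finset.sum_const, nsmul_eq_mul, Finset.card_erase_of_mem hi,
      Nat.cast_sub (Finset.card_pos.2 ⟨i, hi⟩)]
    push_cast
    ring
  have h2 : ∑ j, l (k + 2) i j t = ∑ j, l (k + 1) i j t
      - ρ (k + 1) * (∑ j, x (k + 2) i j t - ∑ j, a (k + 2) i j t) := by
    rw [← Finset.sum_sub_distrib, Finset.mul_sum, ← Finset.sum_sub_distrib]
    exact Finset.sum_congr rfl fun j _ => h.step (k + 1) i j t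
  rw [h1 k, show k + 2 = k + 1 + 1 from rfl, h1 (k + 1)] at h2
  rw [← sub_eq_iff_eq_add', eq_div_iff (by positivity)]
  simp only [show k + 1 + 1 = k + 2 from rfl] at h2
  linarith

/-- Consensus variables clear exactly, so the total imbalance is pure residual and hence a drop of
multipliers. A positive imbalance lowers the sum of the prices and a negative one raises it. -/
theorem sum_sum_residual (h : ExchangeRun G ρ x a l g) (hρ : ∀ k, 0 < ρ k) (k : ℕ) (t : τ) :
    ∑ i ∈ G, ∑ j, x (k + 2) i j t
      = (G.card - 1) * (∑ i ∈ G, g (k + 1) i t - ∑ i ∈ G, g (k + 2) i t) / ρ (k + 1) := by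
  have hp := (hρ (k + 1)).ne'
  rw [Finset.sum_congr rfl fun m hm => h.sum_residual hρ k hm t, Finset.sum_add_distrib,
    h.sum_sum_eq_zero, zero_add, ← Finset.sum_div, Finset.sum_sub_distrib,
    Finset.sum_add_distrib, Finset.sum_add_distrib, ← Finset.mul_sum, ← Finset.mul_sum,
    Finset.sum_const, Finset.sum_const, nsmul_eq_mul, nsmul_eq_mul]
  field_simp
  ring

/-- Subtracting the mean over the nodes decouples them: the row sum and the centered price `u` of
one node form the linear filter of `bounded_of_filter`, with the centered net exchange `E` as
bounded input. -/
theorem net_bounded (h : ExchangeRun G ρ x a l g) (hρ : ProperStepsize ρ) (hG : 2 ≤ G.card) {B : ℝ}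
    (hx : ∀ k, ∀ i ∈ G, ∀ t, |∑ j, x (k + 1) i j t| ≤ B) {i : M} (hi : i ∈ G) (t : τ) :
    ∃ B', ∀ k, |∑ j, a k i j t| ≤ B' := by
  set n : ℝ := (G.card : ℝ) with hn
  have hn2 : (2 : ℝ) ≤ n := by rw [hn]; exact_mod_cast hG
  set c : ℝ := (n - 2) / (2 * (n - 1)) with hc
  have hn1 : (0 : ℝ) < 2 * (n - 1) := by linarith
  have hc0 : 0 ≤ c := div_nonneg (by linarith) hn1.le
  have hc1 : c ≤ 1 / 2 := by
    rw [hc, div_le_iff₀ hn1]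
    linarith
  set u : ℕ → ℝ := fun k => g k i t - (∑ j ∈ G, g k j t) / n with hu
  set E : ℕ → ℝ := fun k => ∑ j, x (k + 2) i j t - (∑ m ∈ G, ∑ j, x (k + 2) m j t) / n with hE
  have hEB : ∀ k, |E k| ≤ B + (∑ _m ∈ G, B) / n := by
    intro k
    refine (abs_sub _ _).trans (add_le_add (hx (k + 1) i hi t) ?_)
    rw [abs_div, abs_of_pos (show 0 < n by linarith)]
    refine div_le_div_of_nonneg_right ?_ (by linarith)
    exact (Finset.abs_sum_le_sum_abs _ _).trans (Finset.sum_le_sum fun m hm => hx (k + 1) m hm t)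
  have hEe : ∀ k, E k = ∑ j, a (k + 2) i j t
      + (n - 2) / 2 * ((u (k + 1) - u (k + 2)) / ρ (k + 1)) := by
    intro k
    have hp := (hρ.pos (k + 1)).ne'
    have h1 := h.sum_sum_residual hρ.pos k t
    rw [← hn] at h1
    have hn0 : n ≠ 0 := by linarith
    simp only [hE, hu]
    rw [h1, h.sum_residual hρ.pos k hi t, ← hn]
    field_simp
    ring
  -- Scaled so that one step lowers the row sum by `(1 - c) * V k`, where `1 - c = n / (2 * (n -
  -- 1))`.
  set V : ℕ → ℝ := fun k => (n - 1) * u (k + 1) / ρ k with hV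
  have hn1' : n - 1 ≠ 0 := by linarith
  have hdiff : ∀ k, ∑ j, a (k + 1) i j t = ∑ j, a k i j t - (1 - c) * V k := by
    intro k
    have hp := (hρ.pos k).ne'
    have hn0 : n ≠ 0 := by linarith
    rw [h.sum_diff hρ.pos k hi t, ← hn]
    simp only [hV, hc, hu]
    field_simp
    ring
  obtain ⟨C, hC0, hC⟩ := hρ.exists_slow
  obtain ⟨B', hB'⟩ : ∃ B', ∀ k, |(fun k => ∑ j, a (k + 1) i j t) k| ≤ B' := by
    refine bounded_of_filter (V := V) (E := E) (σ := fun k => ρ k / ρ (k + 1)) hc0 hc1 hEB ?_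
      (fun k => ?_) (fun k => hdiff (k + 1))
    · have h0 : Tendsto (fun k : ℕ => (1 + C * (1 / ((k : ℝ) + 1))) ^ 2) atTop (𝓝 1) := by
        have := ((tendsto_one_div_add_atTop_nhds_zero_nat (𝕜 := ℝ).const_mul C).const_add 1).pow 2
        simpa only [mul_zero, add_zero, one_pow] using this
      filter_upwards [h0.eventually_lt_const (show (1 : ℝ) < 6 / 5 by norm_num)] with k hk
      refine le_trans (pow_le_pow_left₀ (zero_le_one.trans (hρ.one_le_div k)) ?_ 2) hk.le
      rw [mul_one_div]
      exact hC k
    · have hp := (hρ.pos k).ne'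
      have hp' := (hρ.pos (k + 1)).ne'
      have h2 := hdiff (k + 1)
      rw [hEe k]
      simp only [show k + 1 + 1 = k + 2 from rfl] at h2 ⊢
      rw [h2]
      simp only [hV, hc]
      field_simp
      ring
  refine ⟨max B' |∑ j, a 0 i j t|, fun k => ?_⟩
  rcases k with _ | k
  · exact le_max_right _ _
  · exact le_max_of_le_left (hB' k)

variable [Fintype τ]

/-- The consensus variables are bounded if the net exchanges of the nodes are. -/
theorem consensus_bounded (h : ExchangeRun G ρ x a l g) (hρ : ProperStepsize ρ) {B : ℝ}
    (hx : ∀ k, ∀ i ∈ G, ∀ t, |∑ j, x (k + 1) i j t| ≤ B) :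
    ∃ B', ∀ k, ‖toEuclidean (a k)‖ ≤ B' := by
  suffices hs : ∀ i j t, ∃ B', ∀ k, |a k i j t| ≤ B' by
    choose b hb using hs
    refine ⟨_, fun k => norm_toEuclidean_le (B := ∑ p : M × M × τ, |b p.1 p.2.1 p.2.2|)
      fun i j t => (hb i j t k).trans ((le_abs_self _).trans ?_)⟩
    exact Finset.single_le_sum (f := fun p : M × M × τ => |b p.1 p.2.1 p.2.2|)
      (fun p _ => abs_nonneg _) (Finset.mem_univ (i, j, t))
  intro i j t
  by_cases hp : i ∈ G ∧ j ∈ G ∧ i ≠ j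
  · obtain ⟨hi, hj, hij⟩ := hp
    have hG : 2 ≤ G.card := Finset.one_lt_card.2 ⟨i, hi, j, hj, hij⟩
    obtain ⟨b1, h1⟩ := h.net_bounded hρ hG hx hi t
    obtain ⟨b2, h2⟩ := h.net_bounded hρ hG hx hj t
    refine ⟨|a 0 i j t - (∑ m, a 0 i m t - ∑ m, a 0 j m t) / G.card| + (b1 + b2) / G.card,
      fun k => ?_⟩
    have h3 := h.circulation hρ.pos k hi hj t
    rw [sub_eq_iff_eq_add] at h3
    rw [h3]
    refine (abs_add_le _ _).trans (add_le_add le_rfl ?_)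
    rw [abs_div, Nat.abs_cast]
    gcongr
    exact (abs_sub _ _).trans (add_le_add (h1 k) (h2 k))
  · exact ⟨0, fun k => by rw [h.off_a k i j t hp, abs_zero]⟩

/-- The subgradient in terms of the multipliers and of the change of the consensus variables. -/
theorem sum_price_mul (h : ExchangeRun G ρ x a l g) (k : ℕ) {z : M → M → τ → ℝ}
    (hz : ∀ i j t, ¬ (i ∈ G ∧ j ∈ G ∧ i ≠ j) → z i j t = 0) :
    ∑ i ∈ G, ∑ t, g (k + 1) i t * ∑ j, z i j t
      = inner ℝ (toEuclidean (l (k + 1) - ρ k • (a (k + 1) - a k))) (toEuclidean z) := by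
  rw [inner_toEuclidean, ← Finset.sum_subset (Finset.subset_univ G)
    fun i _ hi => Finset.sum_eq_zero fun j _ => Finset.sum_eq_zero fun t _ => by
      rw [hz i j t (fun hc => hi hc.1), mul_zero]]
  refine Finset.sum_congr rfl fun i hi => ?_
  rw [Finset.sum_comm]
  refine Finset.sum_congr rfl fun t _ => ?_
  rw [Finset.mul_sum]
  refine Finset.sum_congr rfl fun j _ => ?_
  by_cases hp : i ∈ G ∧ j ∈ G ∧ i ≠ j
  · rw [← h.price_left k hp.1 hp.2.1 hp.2.2 t]
    simp
  · rw [hz i j t hp, mul_zero, mul_zero]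

/-- The cross terms vanish by orthogonality: consensus increments see only the antisymmetric part of
a displacement, multipliers only the symmetric part. -/
theorem sum_price_mul' (h : ExchangeRun G ρ x a l g) (k : ℕ)
    {y r : M → M → τ → ℝ} (hy : ∀ i j t, y i j t = -y j i t) (hr : ∀ i j t, r i j t = r j i t)
    (hz : ∀ i j t, ¬ (i ∈ G ∧ j ∈ G ∧ i ≠ j) → (y + r) i j t = 0) :
    ∑ i ∈ G, ∑ t, g (k + 1) i t * ∑ j, (y + r) i j t
      = -(ρ k * inner ℝ (toEuclidean (a (k + 1)) - toEuclidean (a k)) (toEuclidean y))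
        + inner ℝ (toEuclidean (l (k + 1))) (toEuclidean r) := by
  rw [h.sum_price_mul k hz, ← toEuclidean_sub, ← toEuclidean_smul, ← toEuclidean_sub,
    show toEuclidean (y + r) = toEuclidean y + toEuclidean r from rfl, inner_sub_left,
    inner_add_right, inner_add_right, inner_smul_left, inner_smul_left, toEuclidean_sub]
  have h1 : inner ℝ (toEuclidean (a (k + 1) - a k)) (toEuclidean r) = 0 :=
    inner_toEuclidean_eq_zero (fun i j t => by
      simp only [Pi.sub_apply]
      rw [h.anti (k + 1) i j, h.anti k i j]
      ring) hr
  have h2 : inner ℝ (toEuclidean (l (k + 1))) (toEuclidean y) = 0 := by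
    rw [real_inner_comm]
    exact inner_toEuclidean_eq_zero hy (h.symm (k + 1))
  rw [h1, h2, conj_trivial]
  ring

/-- The exchange iteration from its third step on as an abstract split iteration. -/
theorem splitRun (h : ExchangeRun G ρ x a l g) (hρ : ∀ k, 0 < ρ k) {f : ℕ → ℝ}
    (hf : ∀ k m, f (k + 1) + ∑ i ∈ G, ∑ t, g (k + 1) i t
      * (∑ j, x (m + 1) i j t - ∑ j, x (k + 1) i j t) ≤ f (m + 1)) :
    SplitRun ρ (fun k => toEuclidean (a k)) (fun k => toEuclidean (l k))
      (fun k => toEuclidean (x k - a k)) f := by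
  refine ⟨fun k => ?_, fun k m => ?_⟩
  · rw [toEuclidean_smul, toEuclidean_sub]
    congr 1
    funext i j t
    exact h.step k i j t
  · refine le_trans (le_of_eq ?_) (hf k m)
    have h1 := h.sum_price_mul' k (y := a (m + 1) - a (k + 1))
      (r := (x (m + 1) - a (m + 1)) - (x (k + 1) - a (k + 1)))
      (fun i j t => by
        simp only [Pi.sub_apply]
        rw [h.anti (m + 1) i j, h.anti (k + 1) i j]
        ring)
      (fun i j t => by
        simp only [Pi.sub_apply]
        rw [h.residual_symm hρ m i j, h.residual_symm hρ k i j])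
      (fun i j t hp => by
        simp [h.off_x _ i j t hp, h.off_a _ i j t hp])
    simp only [toEuclidean_sub] at h1 ⊢
    rw [sub_eq_add_neg, add_assoc, ← h1]
    congr 1
    refine Finset.sum_congr rfl fun i _ => Finset.sum_congr rfl fun t _ => ?_
    rw [← Finset.sum_sub_distrib]
    congr 1
    refine Finset.sum_congr rfl fun j _ => ?_
    simp only [Pi.add_apply, Pi.sub_apply]
    ring

/-- The subgradient inequality at a point that satisfies the clearing constraints. -/
theorem le_of_clearing (h : ExchangeRun G ρ x a l g) (hρ : ∀ k, 0 < ρ k) {f : ℕ → ℝ} {f' : ℝ}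
    {y : M → M → τ → ℝ} (hy : ∀ i j t, y i j t = -y j i t)
    (hy0 : ∀ i j t, ¬ (i ∈ G ∧ j ∈ G ∧ i ≠ j) → y i j t = 0)
    (hf : ∀ k, f (k + 1) + ∑ i ∈ G, ∑ t, g (k + 1) i t
      * (∑ j, y i j t - ∑ j, x (k + 1) i j t) ≤ f') (k : ℕ) :
    f (k + 1) - ρ k * inner ℝ (toEuclidean (a (k + 1)) - toEuclidean (a k))
        (toEuclidean y - toEuclidean (a (k + 1)))
      - inner ℝ (toEuclidean (l (k + 1))) (toEuclidean (x (k + 1) - a (k + 1))) ≤ f' := by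
  refine le_trans (le_of_eq ?_) (hf k)
  -- A clearing array has residual zero, so the displacement of the residual is minus the current
  -- one.
  have h1 := h.sum_price_mul' k (y := y - a (k + 1)) (r := -(x (k + 1) - a (k + 1)))
    (fun i j t => by
      simp only [Pi.sub_apply]
      rw [hy i j, h.anti (k + 1) i j]
      ring)
    (fun i j t => by
      simp only [Pi.sub_apply, Pi.neg_apply]
      rw [h.residual_symm hρ k i j])
    (fun i j t hp => by
      simp [h.off_x _ i j t hp, h.off_a _ i j t hp, hy0 i j t hp])
  have h2 : inner ℝ (toEuclidean (l (k + 1))) (toEuclidean (-(x (k + 1) - a (k + 1))))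
      = -inner ℝ (toEuclidean (l (k + 1))) (toEuclidean (x (k + 1) - a (k + 1))) := by
    rw [← inner_neg_right]
    rfl
  rw [h2] at h1
  simp only [toEuclidean_sub] at h1 ⊢
  rw [sub_eq_add_neg, sub_eq_add_neg, add_assoc, ← h1]
  congr 1
  refine Finset.sum_congr rfl fun i _ => Finset.sum_congr rfl fun t _ => ?_
  rw [← Finset.sum_sub_distrib]
  congr 1
  refine Finset.sum_congr rfl fun j _ => ?_
  simp only [Pi.add_apply, Pi.sub_apply, Pi.neg_apply]
  ring

/-- A common price `μ` of all nodes as a multiplier of the clearing constraints. -/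
theorem inner_common_price (h : ExchangeRun G ρ x a l g) (μ : τ → ℝ) (k : ℕ) :
    inner ℝ (toEuclidean fun _ _ t => μ t) (toEuclidean (x (k + 1) - a (k + 1)))
      = ∑ i ∈ G, ∑ t, μ t * ∑ j, x (k + 1) i j t := by
  have h1 : inner ℝ (toEuclidean fun _ _ t => μ t) (toEuclidean (x (k + 1) - a (k + 1)))
      = inner ℝ (toEuclidean fun _ _ t => μ t) (toEuclidean (x (k + 1))) := by
    rw [← toEuclidean_sub, inner_sub_right, real_inner_comm (toEuclidean (a (k + 1))),
      inner_toEuclidean_eq_zero (h.anti (k + 1)) (fun _ _ _ => rfl), sub_zero]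
  rw [h1, inner_toEuclidean, ← Finset.sum_subset (Finset.subset_univ G)
    fun i _ hi => Finset.sum_eq_zero fun j _ => Finset.sum_eq_zero fun t _ => by
      rw [h.off_x _ i j t (fun hc => hi hc.1), mul_zero]]
  refine Finset.sum_congr rfl fun i _ => ?_
  rw [Finset.sum_comm]
  exact Finset.sum_congr rfl fun t _ => (Finset.mul_sum _ _ _).symm

end ExchangeRun

/-! ### Nash bargaining over the payments -/

/-- The graph of the convex function `-log` lies above its tangent at `s`. -/
theorem neg_log_add_le {s s' : ℝ} (hs : 0 < s) (hs' : 0 < s') :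
    -Real.log s + 1 / s * (s - s') ≤ -Real.log s' := by
  have h := Real.log_le_sub_one_of_pos (div_pos hs' hs)
  rw [Real.log_div hs'.ne' hs.ne'] at h
  have : 1 / s * (s - s') = 1 - s' / s := by field_simp
  rw [this]
  linarith

/-- The inequality of arithmetic and geometric means: each factor satisfies `s i ≤ D * exp (s i / D
- 1)`, and the exponents sum to zero. -/
theorem prod_le_pow_card {ι : Type*} (G : Finset ι) {s : ι → ℝ} {D : ℝ} (hD : 0 < D)
    (hs : ∀ i ∈ G, 0 ≤ s i) (h : ∑ i ∈ G, s i = G.card * D) : ∏ i ∈ G, s i ≤ ∏ _i ∈ G, D := by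
  have h1 : ∏ i ∈ G, s i ≤ ∏ i ∈ G, D * Real.exp (s i / D - 1) := by
    refine Finset.prod_le_prod hs fun i _ => ?_
    have := Real.add_one_le_exp (s i / D - 1)
    rw [sub_add_cancel, div_le_iff₀ hD] at this
    linarith
  refine h1.trans (le_of_eq ?_)
  rw [Finset.prod_mul_distrib, ← Real.exp_sum, Finset.sum_sub_distrib, ← Finset.sum_div, h]
  have : (G.card : ℝ) * D / D - ∑ _i ∈ G, (1 : ℝ) = 0 := by
    rw [mul_div_cancel_right₀ _ hD.ne']
    simp
  rw [this, Real.exp_zero, mul_one]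

section Payment

variable {M : Type*} [DecidableEq M] {G : Finset M} {δ : M → ℝ}

theorem payment_eq_sum [Fintype M] {i : M} {p : M → ℝ} (h : ∀ j, j ∉ G.erase i → p j = 0) :
    payment G i p = ∑ j, p j :=
  Finset.sum_subset (Finset.subset_univ _) fun j _ hj => h j hj

theorem P2Feasible.sum_eq {p : M → M → ℝ} (h : P2Feasible G δ p) :
    ∑ i ∈ G, payment G i (p i) = 0 := by
  have h0 : ∀ i ∈ G, payment G i (p i) = ∑ j ∈ G, p i j := by
    intro i hi
    rw [payment, ← Finset.add_sum_erase G (p i) hi, h.support i i (by simp), zero_add]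
  rw [Finset.sum_congr rfl h0]
  have h1 : ∑ i ∈ G, ∑ j ∈ G, p i j = -∑ i ∈ G, ∑ j ∈ G, p i j := by
    conv_lhs => rw [Finset.sum_comm]
    simp only [← Finset.sum_neg_distrib]
    refine Finset.sum_congr rfl fun i hi => Finset.sum_congr rfl fun j hj => ?_
    rcases eq_or_ne j i with rfl | hij
    · rw [h.support j j (by simp), neg_zero]
    · linarith [h.clearing i hi j (Finset.mem_erase.2 ⟨hij, hj⟩)]
  linarith

/-- Equal division of the total gain is optimal. -/
theorem p2Optimal_of_equal {D : ℝ} (hD : 0 < D) (hsum : ∑ i ∈ G, δ i = G.card * D)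
    {p : M → M → ℝ} (hs : ∀ i j, ¬ (i ∈ G ∧ j ∈ G.erase i) → p i j = 0)
    (hc : ∀ i ∈ G, ∀ j ∈ G.erase i, p i j + p j i = 0)
    (hp : ∀ i ∈ G, payment G i (p i) = δ i - D) : P2Optimal G δ p := by
  refine ⟨⟨hs, hc, fun i hi => by linarith [hp i hi]⟩, fun p' hp' => ?_⟩
  have h1 : nashProduct G δ p = ∏ _i ∈ G, D :=
    Finset.prod_congr rfl fun i hi => by rw [hp i hi]; ring
  rw [h1]
  refine prod_le_pow_card G hD (fun i hi => by linarith [hp'.rational i hi]) ?_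
  rw [Finset.sum_sub_distrib, hp'.sum_eq, hsum, sub_zero]

theorem exists_localSolution2 {i : M} (hi : (G.erase i).Nonempty) {ρ : ℝ} (hρ : 0 < ρ)
    (pHat gam : M → ℝ) : ∃ p, LocalSolution2 G δ i ρ pHat gam p := by
  set m : ℝ := ((G.erase i).card : ℝ) with hm
  have hm0 : 0 < m := by rw [hm]; exact_mod_cast hi.card_pos
  set b : M → ℝ := fun j => pHat j + gam j / ρ with hb
  set A := δ i - ∑ j ∈ G.erase i, b j with hA
  have hpos : 0 < 4 * m / ρ := by positivity
  -- Stationarity asks for `p j = b j - 1 / (ρ * s)` with `s` the slack. Summing over the partners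
  -- gives `s ^ 2 = A * s + m / ρ`, and this is its positive root.
  set s := (A + √(A ^ 2 + 4 * m / ρ)) / 2 with hs
  have hsq : √(A ^ 2 + 4 * m / ρ) ^ 2 = A ^ 2 + 4 * m / ρ := Real.sq_sqrt (by positivity)
  have hs0 : 0 < s := by
    have : |A| < √(A ^ 2 + 4 * m / ρ) := by
      rw [← Real.sqrt_sq_eq_abs]
      exact Real.sqrt_lt_sqrt (sq_nonneg A) (by linarith)
    have := neg_abs_le A
    rw [hs]
    linarith
  have hs2 : s ^ 2 = A * s + m / ρ := by
    have : s ^ 2 - A * s = (√(A ^ 2 + 4 * m / ρ) ^ 2 - A ^ 2) / 4 := by rw [hs]; ring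
    rw [hsq] at this
    linear_combination this
  set p : M → ℝ := fun j => if j ∈ G.erase i then b j - 1 / (ρ * s) else 0 with hp
  have hpay : δ i - payment G i p = s := by
    have h1 : payment G i p = ∑ j ∈ G.erase i, (b j - 1 / (ρ * s)) :=
      Finset.sum_congr rfl fun j hj => if_pos hj
    rw [h1, Finset.sum_sub_distrib, Finset.sum_const, nsmul_eq_mul, ← hm]
    have h2 : ∑ j ∈ G.erase i, b j = δ i - A := by rw [hA]; ring
    have h3 : m / ρ = s * (s - A) := by linarith
    have h4 : m * (1 / (ρ * s)) = s - A := by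
      have : m * (1 / (ρ * s)) = (m / ρ) / s := by field_simp
      rw [this, h3]
      field_simp
    rw [h2, h4]
    ring
  refine ⟨p, ⟨fun j hj => if_neg hj, by linarith⟩, fun p' hp' => ?_⟩
  have hs' : 0 < δ i - payment G i p' := by linarith [hp'.rational]
  have hlog := neg_log_add_le hs0 hs'
  have hdiff : s - (δ i - payment G i p') = ∑ j ∈ G.erase i, (p' j - p j) := by
    rw [Finset.sum_sub_distrib, ← hpay]
    simp only [payment]
    ring
  rw [hdiff, Finset.mul_sum] at hlog
  unfold localObjective2
  rw [hpay]
  have hterm : ∀ j ∈ G.erase i, (ρ / 2 * (pHat j - p j) ^ 2 - gam j * p j)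
      ≤ 1 / s * (p' j - p j) + (ρ / 2 * (pHat j - p' j) ^ 2 - gam j * p' j) := by
    intro j hj
    have h1 : p j = pHat j + gam j / ρ - 1 / (ρ * s) := if_pos hj
    have h2 : gam j + ρ * (pHat j - p j) = 1 / s := by
      rw [h1]
      field_simp
      ring
    rw [← h2]
    have : 0 ≤ ρ / 2 * (p' j - p j) ^ 2 := by positivity
    linarith
  have h3 := Finset.sum_le_sum hterm
  rw [Finset.sum_add_distrib] at h3
  linarith

theorem exists_step2Run (hG : ∀ i ∈ G, (G.erase i).Nonempty) {ρ : ℕ → ℝ} (hρ : ∀ k, 0 < ρ k)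
    (pHat₀ : M → M → ℝ) : ∃ R : Step2Run G δ ρ, R.pHat 0 = pHat₀ := by
  classical
  have hex : ∀ (k : ℕ) (pHat gam : M → M → ℝ), ∃ p : M → M → ℝ,
      (∀ i ∈ G, LocalSolution2 G δ i (ρ k) (pHat i) (gam i) (p i)) ∧ ∀ i ∉ G, p i = 0 := by
    intro k pHat gam
    have : ∀ i, ∃ q : M → ℝ, (i ∈ G → LocalSolution2 G δ i (ρ k) (pHat i) (gam i) q) ∧
        (i ∉ G → q = 0) := by
      intro i
      by_cases hi : i ∈ G
      · obtain ⟨q, hq⟩ := exists_localSolution2 (δ := δ) (hG i hi) (hρ k) (pHat i) (gam i)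
        exact ⟨q, fun _ => hq, fun h => absurd hi h⟩
      · exact ⟨0, fun h => absurd h hi, fun _ => rfl⟩
    choose p hp using this
    exact ⟨p, fun i => (hp i).1, fun i => (hp i).2⟩
  choose P hP hP0 using hex
  let hat : ℕ → (M → M → ℝ) → (M → M → ℝ) → M → M → ℝ := fun k p gam i j =>
    (ρ k * (p i j - p j i) - (gam i j - gam j i)) / (2 * ρ k)
  let next : ℕ → (M → M → ℝ) × (M → M → ℝ) × (M → M → ℝ) →
      (M → M → ℝ) × (M → M → ℝ) × (M → M → ℝ) := fun k s =>
    (P k s.2.1 s.2.2, hat k (P k s.2.1 s.2.2) s.2.2, fun i j => s.2.2 i j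
      + ρ k * (hat k (P k s.2.1 s.2.2) s.2.2 i j - P k s.2.1 s.2.2 i j))
  let st : ℕ → (M → M → ℝ) × (M → M → ℝ) × (M → M → ℝ) := fun k =>
    Nat.rec (0, pHat₀, 0) (fun k s => next k s) k
  exact ⟨⟨fun k => (st k).1, fun k => (st k).2.1, fun k => (st k).2.2, rfl,
    fun k i hi => hP k _ _ i hi, fun k i hi => hP0 k _ _ i hi, fun k i j => rfl,
    fun k i j => rfl⟩, rfl⟩

/-- The optimality condition of the local problem. -/
theorem LocalSolution2.price {i : M} {ρ : ℝ} {pHat gam p : M → ℝ}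
    (h : LocalSolution2 G δ i ρ pHat gam p) {j : M} (hj : j ∈ G.erase i) :
    gam j + ρ * (pHat j - p j) = 1 / (δ i - payment G i p) := by
  set s := δ i - payment G i p with hs
  have hs0 : 0 < s := by linarith [h.feasible.rational]
  -- The part of the objective that varies when only the payment to `j` is shifted by `u`; small
  -- shifts stay feasible because the constraint is strict.
  let F : ℝ → ℝ := fun u => -Real.log (s - u)
    + (ρ / 2 * (pHat j - (p j + u)) ^ 2 - gam j * (p j + u))
  have hpay : ∀ u, payment G i (Function.update p j (p j + u)) = payment G i p + u := by
    intro u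
    simp only [payment]
    rw [Finset.sum_update_of_mem hj, ← Finset.add_sum_erase _ _ hj, Finset.sdiff_singleton_eq_erase]
    ring
  have hobj : ∀ u, localObjective2 G δ i ρ pHat gam (Function.update p j (p j + u)) =
      F u + ∑ m ∈ (G.erase i).erase j, (ρ / 2 * (pHat m - p m) ^ 2 - gam m * p m) := by
    intro u
    simp only [localObjective2, hpay, F, ← Finset.add_sum_erase _ _ hj, Function.update_self]
    have : ∑ m ∈ (G.erase i).erase j, (ρ / 2 * (pHat m - Function.update p j (p j + u) m) ^ 2
        - gam m * Function.update p j (p j + u) m)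
        = ∑ m ∈ (G.erase i).erase j, (ρ / 2 * (pHat m - p m) ^ 2 - gam m * p m) :=
      Finset.sum_congr rfl fun m hm => by
        rw [Function.update_of_ne (Finset.ne_of_mem_erase hm)]
    rw [this, hs]
    ring_nf
  have hmin : IsLocalMin F 0 := by
    filter_upwards [Iio_mem_nhds hs0] with u hu
    have hu' : u < s := hu
    have h1 := h.le (Function.update p j (p j + u)) ⟨fun m hm => by
      rw [Function.update_of_ne (fun hc : m = j => hm (by rwa [hc]))]
      exact h.feasible.support m hm, by rw [hpay]; linarith⟩
    have h2 := hobj 0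
    rw [add_zero, Function.update_eq_self] at h2
    rw [hobj, h2] at h1
    linarith
  have hderiv : HasDerivAt F (1 / s - ρ * (pHat j - p j) - gam j) 0 := by
    have h1 : HasDerivAt (fun u : ℝ => s - u) (-1) 0 := (hasDerivAt_id (0 : ℝ)).const_sub s
    have h2 := (h1.log (by simpa using hs0.ne')).neg
    have h3 : HasDerivAt (fun u : ℝ => p j + u) 1 0 := (hasDerivAt_id (0 : ℝ)).const_add (p j)
    have h4 := (((h3.const_sub (pHat j)).pow 2).const_mul (ρ / 2)).sub (h3.const_mul (gam j))
    refine (h2.add h4).congr_deriv ?_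
    simp
    ring
  have := hmin.hasDerivAt_eq_zero hderiv
  linarith

end Payment

/-! ### Bounds and limits of the exchange from those of the net exchanges -/

namespace ExchangeRun

variable {M τ : Type*} [Fintype M] {G : Finset M} {ρ : ℕ → ℝ}
  {x a l : ℕ → M → M → τ → ℝ} {g : ℕ → M → τ → ℝ}

theorem exists_norm_consensus_le [Fintype τ] (h : ExchangeRun G ρ x a l g) (hρ : ProperStepsize ρ)
    (hx : ∀ i ∈ G, ∀ t, ∃ B, ∀ k, |∑ j, x (k + 1) i j t| ≤ B) :
    ∃ B, ∀ k, ‖toEuclidean (a k)‖ ≤ B := by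
  have hx' : ∀ i t, ∃ B, i ∈ G → ∀ k, |∑ j, x (k + 1) i j t| ≤ B := by
    intro i t
    by_cases hi : i ∈ G
    · obtain ⟨B, hB⟩ := hx i hi t
      exact ⟨B, fun _ => hB⟩
    · exact ⟨0, fun hc => absurd hc hi⟩
  choose b hb using hx'
  refine h.consensus_bounded hρ (B := ∑ p : M × τ, |b p.1 p.2|) fun k i hi t =>
    (hb i t hi k).trans ((le_abs_self _).trans ?_)
  exact Finset.single_le_sum (f := fun p : M × τ => |b p.1 p.2|)
    (fun p _ => abs_nonneg _) (Finset.mem_univ (i, t))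

/-- Convergence of the exchange, if the net exchanges of all nodes converge. -/
theorem tendsto_of_net (h : ExchangeRun G ρ x a l g) (hρ : ∀ k, 0 < ρ k) {i j : M} {t : τ}
    (hr : ∀ i j, Tendsto (fun k => x k i j t - a k i j t) atTop (𝓝 0)) {N : M → ℝ}
    (hN : ∀ i ∈ G, Tendsto (fun k => ∑ j, x k i j t) atTop (𝓝 (N i)))
    (hi : i ∈ G) (hj : j ∈ G) :
    Tendsto (fun k => a k i j t) atTop (𝓝 (a 0 i j t
      - (∑ m, a 0 i m t - ∑ m, a 0 j m t) / G.card + (N i - N j) / G.card)) := by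
  have hH : ∀ i ∈ G, Tendsto (fun k => ∑ m, a k i m t) atTop (𝓝 (N i)) := by
    intro i hi
    have h1 := (hN i hi).sub (tendsto_finsetSum Finset.univ fun j _ => hr i j)
    simp only [Finset.sum_const_zero, sub_zero, Finset.sum_sub_distrib, sub_sub_cancel] at h1
    exact h1
  refine ((((hH i hi).sub (hH j hj)).div_const (G.card : ℝ)).const_add _).congr fun k => ?_
  rw [← h.circulation hρ k hi hj t]
  ring

end ExchangeRun

/-! ### Convergence of the payments in Step 2 -/

namespace Step2Run

variable {M : Type*} [DecidableEq M] {G : Finset M} {δ : M → ℝ} {ρ : ℕ → ℝ}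

theorem exchangeRun (R : Step2Run G δ ρ) (hρ : ∀ k, 0 < ρ k) :
    ExchangeRun G (fun k => ρ (k + 1)) (fun k i j (_ : Unit) => R.p (k + 1) i j)
      (fun k i j _ => R.pHat (k + 1) i j) (fun k i j _ => R.gam (k + 1) i j)
      (fun k i _ => 1 / (δ i - payment G i (R.p (k + 1) i))) := by
  refine ExchangeRun.of_updates (x := fun k i j (_ : Unit) => R.p k i j)
    (a := fun k i j _ => R.pHat k i j) (l := fun k i j _ => R.gam k i j)
    (g := fun k i _ => 1 / (δ i - payment G i (R.p k i))) hρ ?_ (fun k i j _ hp => ?_)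
    (fun k i j _ => R.pHat_succ k i j) (fun k i j _ => R.gam_succ k i j)
    fun k i hi j hj hij _ => (R.lower k i hi).price (Finset.mem_erase.2 ⟨hij.symm, hj⟩)
  · simp only [R.gam_zero]
    rfl
  · by_cases hi : i ∈ G
    · refine (R.lower k i hi).feasible.support j fun hj => hp ⟨hi, Finset.mem_of_mem_erase hj,
        (Finset.ne_of_mem_erase hj).symm⟩
    · simp only [R.outside k i hi]
      rfl

theorem sum_p [Fintype M] (R : Step2Run G δ ρ) (k : ℕ) {i : M} (hi : i ∈ G) :
    ∑ j, R.p (k + 1) i j = payment G i (R.p (k + 1) i) :=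
  (payment_eq_sum (R.lower k i hi).feasible.support).symm

/-- The retained gains of the members. -/
theorem slack_pos (R : Step2Run G δ ρ) (k : ℕ) {i : M} (hi : i ∈ G) :
    0 < δ i - payment G i (R.p (k + 1) i) := by
  linarith [(R.lower k i hi).feasible.rational]

variable [Fintype M]

/-- The price sum cannot decrease to a value below `b`: if it is below `b`, every slack is at least
the mean gain, so the total of the payments is nonpositive, and by `sum_sum_residual` the price sum
has not dropped in that step. This replaces the missing compactness of the local constraints. -/
theorem sum_inv_slack_ge (R : Step2Run G δ ρ) (hρ : ∀ k, 0 < ρ k) (hG : 2 ≤ G.card)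
    (hδ : 0 < ∑ i ∈ G, δ i) :
    ∃ m, 0 < m ∧ ∀ k, m ≤ ∑ i ∈ G, 1 / (δ i - payment G i (R.p (k + 2) i)) := by
  have hne : G.Nonempty := Finset.card_pos.1 (by omega)
  have hn2 : (2 : ℝ) ≤ G.card := by exact_mod_cast hG
  set S : ℕ → ℝ := fun k => ∑ i ∈ G, 1 / (δ i - payment G i (R.p (k + 2) i)) with hS
  have hterm : ∀ k, ∀ i ∈ G, 0 < 1 / (δ i - payment G i (R.p (k + 2) i)) := fun k i hi =>
    one_div_pos.2 (R.slack_pos (k + 1) hi)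
  have hS0 : ∀ k, 0 < S k := fun k => Finset.sum_pos (hterm k) hne
  set b := (G.card : ℝ) / ∑ i ∈ G, δ i with hb
  have hb0 : 0 < b := div_pos (by linarith) hδ
  refine ⟨min (S 0) b, lt_min (hS0 0) hb0, fun k => ?_⟩
  induction k with
  | zero => exact min_le_left _ _
  | succ k ih =>
    rcases le_or_gt b (S (k + 1)) with hk | hk
    · exact (min_le_right _ _).trans hk
    · refine ih.trans ?_
      have h1 := (R.exchangeRun hρ).sum_sum_residual (fun k => hρ (k + 1)) k ()
      have h2 : ∑ i ∈ G, ∑ j, R.p (k + 3) i j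
          = ∑ i ∈ G, δ i - ∑ i ∈ G, (δ i - payment G i (R.p (k + 3) i)) := by
        rw [Finset.sum_sub_distrib, sub_sub_cancel]
        exact Finset.sum_congr rfl fun i hi => R.sum_p (k + 2) hi
      have h3 : ∑ i ∈ G, δ i ≤ ∑ i ∈ G, (δ i - payment G i (R.p (k + 3) i)) := by
        have h4 : ∀ i ∈ G, 1 / b ≤ δ i - payment G i (R.p (k + 3) i) := by
          intro i hi
          have hp := R.slack_pos (k + 2) hi
          rw [one_div_le hb0 hp]
          exact (Finset.single_le_sum (fun i hi => (hterm (k + 1) i hi).le) hi).trans hk.le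
        refine le_trans (le_of_eq ?_) (Finset.sum_le_sum h4)
        rw [Finset.sum_const, nsmul_eq_mul, hb, one_div_div, mul_div_cancel₀ _ (by linarith)]
      have h5 : ((G.card : ℝ) - 1) * (S k - S (k + 1)) / ρ (k + 2) ≤ 0 := by
        have : ∑ i ∈ G, ∑ j, R.p (k + 3) i j
          = ((G.card : ℝ) - 1) * (S k - S (k + 1)) / ρ (k + 2) := h1
        rw [← this, h2]
        linarith
      have h6 : ((G.card : ℝ) - 1) * (S k - S (k + 1)) ≤ 0 := by
        by_contra hc
        push Not at hc
        exact absurd h5 (not_le.2 (div_pos hc (hρ _)))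
      by_contra hc
      push Not at hc
      have : 0 < ((G.card : ℝ) - 1) * (S k - S (k + 1)) :=
        mul_pos (by linarith) (sub_pos.2 hc)
      linarith

theorem subgradient (R : Step2Run G δ ρ) (k : ℕ) {N : M → ℝ} (hN : ∀ i ∈ G, N i < δ i) :
    ∑ i ∈ G, -Real.log (δ i - payment G i (R.p (k + 1) i))
      + ∑ i ∈ G, ∑ _t : Unit, 1 / (δ i - payment G i (R.p (k + 1) i))
        * (N i - ∑ j, R.p (k + 1) i j) ≤ ∑ i ∈ G, -Real.log (δ i - N i) := by
  rw [← Finset.sum_add_distrib]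
  refine Finset.sum_le_sum fun i hi => ?_
  have h1 := neg_log_add_le (R.slack_pos k hi) (show 0 < δ i - N i by linarith [hN i hi])
  rw [Fintype.sum_unique, R.sum_p k hi]
  refine le_trans (le_of_eq ?_) h1
  ring

/-- The Fejér estimate needs no bound on the payments, so it comes first and equalizes the prices.
Together with the lower bound on their sum it bounds the slacks, which gives the bounded consensus
variables needed for vanishing residuals. -/
theorem convergence (R : Step2Run G δ ρ) (hρ : ProperStepsize ρ) (hG : 2 ≤ G.card)
    (hδ : 0 < ∑ i ∈ G, δ i) :
    (∀ i j, Tendsto (fun k => R.p (k + 1) i j - R.pHat (k + 1) i j) atTop (𝓝 0)) ∧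
    ∀ i ∈ G, Tendsto (fun k => ∑ j, R.p (k + 1) i j) atTop
      (𝓝 (δ i - (∑ m ∈ G, δ m) / G.card)) := by
  have hn0 : (0 : ℝ) < G.card := by exact_mod_cast (show 0 < G.card by omega)
  set D := (∑ m ∈ G, δ m) / G.card with hD
  have hD0 : 0 < D := div_pos hδ hn0
  have hX := R.exchangeRun hρ.pos
  have hρ' := hρ.succ
  set s : ℕ → M → ℝ := fun k i => δ i - payment G i (R.p (k + 1) i) with hs
  set f : ℕ → ℝ := fun k => ∑ i ∈ G, -Real.log (s k i) with hf
  -- A clearing payment matrix that leaves every member the slack `D`.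
  set y : M → M → Unit → ℝ := fun i j _ =>
    if i ∈ G ∧ j ∈ G then (δ i - δ j) / G.card else 0 with hy
  have hysum : ∀ i ∈ G, ∑ j, y i j () = δ i - D := by
    intro i hi
    rw [← Finset.sum_subset (Finset.subset_univ G) fun j _ hj => if_neg fun hc => hj hc.2]
    rw [Finset.sum_congr rfl fun j hj => if_pos ⟨hi, hj⟩, ← Finset.sum_div,
      Finset.sum_sub_distrib, Finset.sum_const, nsmul_eq_mul, hD]
    field_simp
  have hsplit := hX.splitRun hρ'.pos (f := f) fun k m => by
    have := R.subgradient (k + 1) (N := fun i => ∑ j, R.p (m + 2) i j) fun i hi => by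
      rw [R.sum_p (m + 1) hi]
      exact (R.lower (m + 1) i hi).feasible.rational
    refine this.trans_eq (Finset.sum_congr rfl fun i hi => ?_)
    simp only [hs]
    rw [R.sum_p (m + 1) hi]
  have hfeas := hX.le_of_clearing hρ'.pos (f := f) (f' := ∑ _i ∈ G, -Real.log D) (y := y)
    (fun i j _ => by
      simp only [hy, and_comm (a := j ∈ G)]
      split_ifs
      · rw [← neg_div, neg_sub]
      · rw [neg_zero])
    (fun i j _ hp => by
      simp only [hy]
      split_ifs with hc
      · have : i = j := by
          by_contra hij
          exact hp ⟨hc.1, hc.2, hij⟩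
        rw [this, sub_self, zero_div]
      · rfl)
    (fun k => by
      have := R.subgradient (k + 1) (N := fun i => ∑ j, y i j ()) fun i hi => by
        rw [hysum i hi]
        linarith
      refine this.trans_eq (Finset.sum_congr rfl fun i hi => ?_)
      rw [hysum i hi, sub_sub_cancel])
  -- At equal division all members have the marginal value `1 / D`, so this common price is the
  -- multiplier.
  have hmult : ∀ k, ∑ _i ∈ G, -Real.log D
      + inner ℝ (toEuclidean fun (_ _ : M) (_ : Unit) => 1 / D)
        (toEuclidean ((fun i j (_ : Unit) => R.p (k + 1 + 1) i j)
          - fun i j _ => R.pHat (k + 1 + 1) i j)) ≤ f (k + 1) := by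
    intro k
    have h1 := hX.inner_common_price (fun _ => 1 / D) k
    rw [h1, ← Finset.sum_add_distrib]
    have h2 : ∀ i ∈ G, -Real.log D + (∑ _t : Unit, 1 / D * ∑ j, R.p (k + 1 + 1) i j)
        ≤ -Real.log (s (k + 1) i) + 1 / D * (δ i - D) := by
      intro i hi
      have h3 := neg_log_add_le hD0 (R.slack_pos (k + 1) hi)
      rw [Fintype.sum_unique, R.sum_p (k + 1) hi]
      simp only [hs]
      linarith
    refine (Finset.sum_le_sum h2).trans (le_of_eq ?_)
    rw [Finset.sum_add_distrib, ← Finset.mul_sum, Finset.sum_sub_distrib, Finset.sum_const,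
      nsmul_eq_mul, hD, mul_div_cancel₀ _ hn0.ne', sub_self, mul_zero, add_zero]
  have hdp := (hsplit.fejer hρ' hfeas hmult).2
  -- Price differences are, up to the factor -2, the scaled consensus increments, which vanish by
  -- `SplitRun.fejer`.
  have hgg : ∀ i ∈ G, ∀ j ∈ G, Tendsto (fun k => 1 / s (k + 1) i - 1 / s (k + 1) j)
      atTop (𝓝 0) := by
    intro i hi j hj
    have h1 : Tendsto (fun k => -2 * (ρ (k + 1) * (R.pHat (k + 2) i j - R.pHat (k + 1) i j)))
        atTop (𝓝 0) := by
      rw [← mul_zero (-2 : ℝ)]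
      refine Tendsto.const_mul _ (squeeze_zero_norm (fun k => ?_) (by simpa using hdp.norm))
      exact abs_le_norm_toEuclidean (fun i j (_ : Unit) =>
        ρ (k + 1) * (R.pHat (k + 2) i j - R.pHat (k + 1) i j)) i j ()
    refine h1.congr fun k => ?_
    have h2 := hX.diff_eq hρ'.pos k hi hj ()
    have hp := (hρ.pos (k + 1)).ne'
    rw [show R.pHat (k + 2) i j - R.pHat (k + 1) i j = _ from h2]
    simp only [hs]
    field_simp
    ring
  obtain ⟨m, hm0, hm⟩ := R.sum_inv_slack_ge hρ.pos hG hδ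
  -- Nearly equal prices with sum at least `m` are each eventually at least `m / (2 * G.card)`.
  have hsb : ∀ i ∈ G, ∀ᶠ k in atTop, |s (k + 1) i| ≤ 2 * G.card / m := by
    intro i hi
    have hev : ∀ᶠ k in atTop, ∀ j ∈ G, 1 / s (k + 1) j - 1 / s (k + 1) i ≤ m / (2 * G.card) := by
      rw [Filter.eventually_all_finset]
      intro j hj
      exact (hgg j hj i hi).eventually_le_const (by positivity)
    filter_upwards [hev] with k hk
    have hsp : 0 < s (k + 1) i := R.slack_pos (k + 1) hi
    have h1 : m ≤ ∑ j ∈ G, 1 / s (k + 1) j := hm k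
    have h2 : ∑ j ∈ G, (1 / s (k + 1) j - 1 / s (k + 1) i) ≤ ∑ _j ∈ G, m / (2 * G.card) :=
      Finset.sum_le_sum hk
    rw [Finset.sum_sub_distrib, Finset.sum_const, Finset.sum_const, nsmul_eq_mul,
      nsmul_eq_mul] at h2
    have h3 : (G.card : ℝ) * (m / (2 * G.card)) = m / 2 := by field_simp
    have h4 : m / 2 ≤ G.card * (1 / s (k + 1) i) := by linarith
    rw [abs_of_pos hsp, le_div_iff₀ hm0]
    rw [mul_one_div, le_div_iff₀ hsp] at h4
    linarith
  obtain ⟨B, hB⟩ := hX.exists_norm_consensus_le hρ' fun i hi _ => by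
    refine exists_abs_le_of_eventually (b := |δ i| + 2 * G.card / m) ?_
    filter_upwards [hsb i hi] with k hk
    have : ∑ j, R.p (k + 1 + 1) i j = δ i - s (k + 1) i := by
      rw [R.sum_p (k + 1) hi]
      simp only [hs]
      ring
    rw [this]
    exact (abs_sub _ _).trans (add_le_add le_rfl hk)
  have hres := hsplit.tendsto_residual_zero hρ' hB hfeas
  have hr : ∀ i j, Tendsto (fun k => R.p (k + 1) i j - R.pHat (k + 1) i j) atTop (𝓝 0) := by
    intro i j
    refine squeeze_zero_norm (fun k => ?_) (by simpa using hres.norm)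
    exact abs_le_norm_toEuclidean (fun i j (_ : Unit) =>
      R.p (k + 1) i j - R.pHat (k + 1) i j) i j ()
  refine ⟨hr, fun i hi => ?_⟩
  have hss : ∀ j ∈ G, Tendsto (fun k => s (k + 1) i - s (k + 1) j) atTop (𝓝 0) := by
    intro j hj
    have h1 := (hgg j hj i hi).norm
    rw [norm_zero] at h1
    refine squeeze_zero_norm' (a := fun k => ‖1 / s (k + 1) j - 1 / s (k + 1) i‖
      * (2 * G.card / m) * (2 * G.card / m)) ?_ (by simpa using (h1.mul_const _).mul_const _)
    filter_upwards [hsb i hi, hsb j hj] with k h2 h3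
    have hi0 : s (k + 1) i ≠ 0 := (R.slack_pos (k + 1) hi).ne'
    have hj0 : s (k + 1) j ≠ 0 := (R.slack_pos (k + 1) hj).ne'
    have h4 : s (k + 1) i - s (k + 1) j
        = (1 / s (k + 1) j - 1 / s (k + 1) i) * s (k + 1) i * s (k + 1) j := by
      field_simp
    rw [h4, norm_mul, norm_mul]
    have hc : 0 ≤ 2 * (G.card : ℝ) / m := by positivity
    exact mul_le_mul (mul_le_mul_of_nonneg_left h2 (norm_nonneg _)) h3 (norm_nonneg _)
      (mul_nonneg (norm_nonneg _) hc)
  -- The consensus payments sum to zero and the residuals vanish, so asymptotically nothing of the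
  -- total gain is lost.
  have hsum : Tendsto (fun k => ∑ j ∈ G, s (k + 1) j) atTop (𝓝 (∑ j ∈ G, δ j)) := by
    have h1 := (tendsto_finsetSum G fun i _ =>
      tendsto_finsetSum Finset.univ fun j _ => hr i j).comp (tendsto_add_atTop_nat 1)
    have h2 := h1.const_sub (∑ j ∈ G, δ j)
    simp only [Finset.sum_const_zero, sub_zero] at h2
    refine h2.congr fun k => ?_
    simp only [Function.comp, Finset.sum_sub_distrib]
    have h3 : ∑ i ∈ G, ∑ j, R.pHat (k + 1 + 1) i j = 0 := hX.sum_sum_eq_zero (k + 1) ()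
    rw [h3, sub_zero, Finset.sum_congr rfl fun i hi => R.sum_p (k + 1) hi,
      ← Finset.sum_sub_distrib]
  have hlim : Tendsto (fun k => s (k + 1) i) atTop (𝓝 D) := by
    have h1 := (hsum.add (tendsto_finsetSum G hss)).div_const (G.card : ℝ)
    simp only [Finset.sum_const_zero, add_zero] at h1
    refine h1.congr fun k => ?_
    rw [← Finset.sum_add_distrib]
    simp only [add_sub_cancel, Finset.sum_const, nsmul_eq_mul]
    rw [mul_div_cancel_left₀ _ hn0.ne']
  refine (tendsto_add_atTop_iff_nat 1).1 ((hlim.const_sub (δ i)).congr fun k => ?_)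
  rw [R.sum_p (k + 1) hi]
  simp only [hs]
  ring

/-- Convergence of Step 2. -/
theorem main (R : Step2Run G δ ρ) (hρ : ProperStepsize ρ) (hG : G.Nonempty → 2 ≤ G.card)
    (hδ : G.Nonempty → 0 < ∑ i ∈ G, δ i) :
    Tendsto R.residual atTop (𝓝 0) ∧ ∃ p', P2Optimal G δ p' ∧
      ∀ i j, Tendsto (fun k => R.p k i j) atTop (𝓝 (p' i j)) ∧
        Tendsto (fun k => R.pHat k i j) atTop (𝓝 (p' i j)) := by
  have hX := R.exchangeRun hρ.pos
  rcases G.eq_empty_or_nonempty with rfl | hne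
  · refine ⟨tendsto_const_nhds.congr fun k => by simp [residual], 0, ⟨⟨by simp, by simp, by simp⟩, fun p' _ => by
      simp [nashProduct]⟩, fun i j => ?_⟩
    refine ⟨(tendsto_add_atTop_iff_nat 1).1 ?_, (tendsto_add_atTop_iff_nat 1).1 ?_⟩
    · exact tendsto_const_nhds.congr fun k => (hX.off_x k i j () (by simp)).symm
    · exact tendsto_const_nhds.congr fun k => (hX.off_a k i j () (by simp)).symm
  obtain ⟨hr, hN⟩ := R.convergence hρ (hG hne) (hδ hne)
  have hn0 : (0 : ℝ) < G.card := by exact_mod_cast hne.card_pos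
  set D := (∑ m ∈ G, δ m) / G.card with hD
  have hD0 : 0 < D := div_pos (hδ hne) hn0
  constructor
  · refine (tendsto_add_atTop_iff_nat 1).1 ?_
    have h1 : ∀ i ∈ G, Tendsto (fun k => √(∑ j ∈ G.erase i,
        (R.pHat (k + 1) i j - R.p (k + 1) i j) ^ 2)) atTop (𝓝 0) := by
      intro i _
      have h2 := (Real.continuous_sqrt.tendsto _).comp
        (tendsto_finsetSum (G.erase i) fun j _ => (hr i j).pow 2)
      simp only [ne_eq, OfNat.ofNat_ne_zero, not_false_eq_true, zero_pow, Finset.sum_const_zero,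
        Real.sqrt_zero] at h2
      refine h2.congr fun k => ?_
      simp only [Function.comp]
      congr 1
      exact Finset.sum_congr rfl fun j _ => by ring
    have h2 := tendsto_finsetSum G h1
    rwa [Finset.sum_const_zero] at h2
  have hlim : ∀ i j, ∃ v, (¬ (i ∈ G ∧ j ∈ G ∧ i ≠ j) → v = 0) ∧
      Tendsto (fun k => R.pHat (k + 1) i j) atTop (𝓝 v) := by
    intro i j
    by_cases hp : i ∈ G ∧ j ∈ G ∧ i ≠ j
    · exact ⟨_, fun hc => absurd hp hc, hX.tendsto_of_net (fun k => hρ.pos (k + 1)) (t := ())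
        (fun i j => hr i j) (N := fun i => δ i - D) hN hp.1 hp.2.1⟩
    · exact ⟨0, fun _ => rfl, tendsto_const_nhds.congr fun k => (hX.off_a k i j () hp).symm⟩
  choose p' hp0 hp' using hlim
  have hp : ∀ i j, Tendsto (fun k => R.p (k + 1) i j) atTop (𝓝 (p' i j)) := by
    intro i j
    have := (hr i j).add (hp' i j)
    simpa using this
  have hsupp : ∀ i j, ¬ (i ∈ G ∧ j ∈ G.erase i) → p' i j = 0 := fun i j hc =>
    hp0 i j fun hc' => hc ⟨hc'.1, Finset.mem_erase.2 ⟨hc'.2.2.symm, hc'.2.1⟩⟩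
  refine ⟨p', p2Optimal_of_equal hD0 (by rw [hD]; field_simp) hsupp (fun i _ j _ => ?_)
    (fun i hi => ?_), fun i j => ⟨(tendsto_add_atTop_iff_nat 1).1 (hp i j),
      (tendsto_add_atTop_iff_nat 1).1 (hp' i j)⟩⟩
  · refine tendsto_nhds_unique ((hp' i j).add (hp' j i)) (tendsto_const_nhds.congr fun k => ?_)
    have := hX.anti k i j ()
    linarith
  · rw [payment_eq_sum fun j hj => hsupp i j fun hc => hj hc.2]
    exact tendsto_nhds_unique (tendsto_finsetSum Finset.univ fun j _ => hp i j) (hN i hi)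

end Step2Run

/-! ### Polyhedra, convex quadratic functions and multipliers -/

section Farkas

variable {V : Type*} [AddCommGroup V] [Module ℝ V]

/-- **Farkas' lemma** for finitely many linear functionals. -/
theorem farkas {ι : Type*} (s : Finset ι) (a : ι → V →ₗ[ℝ] ℝ) (c : V →ₗ[ℝ] ℝ)
    (h : ∀ x, (∀ i ∈ s, a i x ≤ 0) → c x ≤ 0) :
    ∃ ν : ι → ℝ, (∀ i, 0 ≤ ν i) ∧ c = ∑ i ∈ s, ν i • a i := by
  classical
  induction s using Finset.induction_on generalizing a c with
  | empty =>
    refine ⟨0, fun i => le_rfl, LinearMap.ext fun x => ?_⟩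
    have h1 := h x (by simp)
    have h2 := h (-x) (by simp)
    rw [map_neg] at h2
    simp only [Finset.sum_empty, LinearMap.zero_apply]
    linarith
  | insert j s hj ih =>
    -- Either the functional `a j` is superfluous and gets coefficient zero, or some `z` violates
    -- the implication without it. In the second case `a j z` must be positive.
    by_cases hs : ∀ x, (∀ i ∈ s, a i x ≤ 0) → c x ≤ 0
    · obtain ⟨ν, hν, hc⟩ := ih a c hs
      refine ⟨Function.update ν j 0, fun i => ?_, ?_⟩
      · rcases eq_or_ne i j with rfl | hij
        · simp
        · rw [Function.update_of_ne hij]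
          exact hν i
      · rw [Finset.sum_insert hj, Function.update_self, zero_smul, zero_add, hc]
        exact Finset.sum_congr rfl fun i hi => by
          rw [Function.update_of_ne (fun hij : i = j => hj (hij ▸ hi))]
    · push Not at hs
      obtain ⟨z, hz, hcz⟩ := hs
      have haz : 0 < a j z := by
        by_contra hcon
        push Not at hcon
        refine absurd (h z fun i hi => ?_) (not_le.2 hcz)
        rcases Finset.mem_insert.1 hi with rfl | hi
        · exact hcon
        · exact hz i hi
      set x₀ := (a j z)⁻¹ • z with hx₀
      have hax : a j x₀ = 1 := by
        rw [hx₀, map_smul, smul_eq_mul, inv_mul_cancel₀ haz.ne']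
      have hx : ∀ i ∈ s, a i x₀ ≤ 0 := fun i hi => by
        rw [hx₀, map_smul, smul_eq_mul]
        exact mul_nonpos_of_nonneg_of_nonpos (inv_pos.2 haz).le (hz i hi)
      have hcx : 0 < c x₀ := by
        rw [hx₀, map_smul, smul_eq_mul]
        positivity
      -- Composition with the projection along `x₀` onto the kernel of `a j` removes this
      -- functional, so the induction hypothesis applies to the projected functionals.
      obtain ⟨ν, hν, hc⟩ := ih (fun i => a i - a i x₀ • a j) (c - c x₀ • a j) fun x hx' => by
        have h1 := h (x - a j x • x₀) fun i hi => by
          rcases Finset.mem_insert.1 hi with rfl | hi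
          · simp [hax]
          · have := hx' i hi
            simp only [LinearMap.sub_apply, LinearMap.smul_apply, smul_eq_mul] at this
            simp only [map_sub, map_smul, smul_eq_mul]
            linarith
        simp only [map_sub, map_smul, smul_eq_mul] at h1
        simp only [LinearMap.sub_apply, LinearMap.smul_apply, smul_eq_mul]
        linarith
      refine ⟨Function.update ν j (c x₀ - ∑ i ∈ s, ν i * a i x₀), fun i => ?_, ?_⟩
      · rcases eq_or_ne i j with rfl | hij
        · rw [Function.update_self]
          have : ∑ i ∈ s, ν i * a i x₀ ≤ 0 :=
            Finset.sum_nonpos fun i hi => mul_nonpos_of_nonneg_of_nonpos (hν i) (hx i hi)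
          linarith
        · rw [Function.update_of_ne hij]
          exact hν i
      · rw [Finset.sum_insert hj, Function.update_self]
        have h1 : ∑ i ∈ s, Function.update ν j (c x₀ - ∑ i ∈ s, ν i * a i x₀) i • a i
            = ∑ i ∈ s, ν i • a i := Finset.sum_congr rfl fun i hi => by
          rw [Function.update_of_ne (fun hij : i = j => hj (hij ▸ hi))]
        rw [h1]
        refine LinearMap.ext fun x => ?_
        have h2 := LinearMap.congr_fun hc x
        simp only [LinearMap.sub_apply, LinearMap.smul_apply, smul_eq_mul, LinearMap.sum_apply,
          LinearMap.add_apply, mul_sub, Finset.sum_sub_distrib] at h2 ⊢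
        have h3 : ∑ i ∈ s, ν i * (a i x₀ * a j x) = (∑ i ∈ s, ν i * a i x₀) * a j x := by
          rw [Finset.sum_mul]
          exact Finset.sum_congr rfl fun i _ => by ring
        rw [h3] at h2
        linarith

end Farkas

/-- Division by `s` and passage to the limit: the first-order term of a minimum, used for all
variational inequalities with quadratic remainder. -/
theorem nonneg_of_eventually_quadratic {a b : ℝ}
    (h : ∀ᶠ s in 𝓝[>] (0 : ℝ), 0 ≤ s * a + s ^ 2 * b) : 0 ≤ a := by
  have h1 : Tendsto (fun s : ℝ => a + s * b) (𝓝[>] 0) (𝓝 a) := by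
    have : Tendsto (fun s : ℝ => a + s * b) (𝓝 0) (𝓝 (a + 0 * b)) :=
      (continuous_const.add (continuous_id.mul continuous_const)).tendsto 0
    rw [zero_mul, add_zero] at this
    exact this.mono_left nhdsWithin_le_nhds
  refine ge_of_tendsto h1 ?_
  filter_upwards [h, self_mem_nhdsWithin] with s hs hs0
  have hs0' : (0 : ℝ) < s := hs0
  have : 0 ≤ s * (a + s * b) := by linarith
  exact nonneg_of_mul_nonneg_right this hs0'

/-- Affine real functions. -/
def IsAffineFn {V : Type*} [AddCommGroup V] [Module ℝ V] (f : V → ℝ) : Prop :=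
  ∃ (ℓ : V →ₗ[ℝ] ℝ) (c : ℝ), ∀ y, f y = ℓ y + c

/-- Convex quadratic functions, described by their expansions at all points. -/
def IsConvexQuadratic {V : Type*} [AddCommGroup V] [Module ℝ V] (f : V → ℝ) : Prop :=
  ∀ y, ∃ (ℓ : V →ₗ[ℝ] ℝ) (q : V → ℝ), (∀ d, 0 ≤ q d) ∧ (∀ (s : ℝ) (d : V), q (s • d) = s ^ 2 * q d) ∧
    ∀ d, f (y + d) = f y + ℓ d + q d

/-- Polyhedra: intersections of finitely many half-spaces. -/
def IsPolyhedron {V : Type*} [AddCommGroup V] [Module ℝ V] (P : Set V) : Prop :=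
  ∃ A : Finset ((V →ₗ[ℝ] ℝ) × ℝ), P = {y | ∀ p ∈ A, p.1 y ≤ p.2}

section Polyhedra

variable {V W : Type*} [AddCommGroup V] [Module ℝ V] [AddCommGroup W] [Module ℝ W]

namespace IsAffineFn

theorem const (c : ℝ) : IsAffineFn (fun _ : V => c) := ⟨0, c, by simp⟩

theorem linear (ℓ : V →ₗ[ℝ] ℝ) : IsAffineFn (fun v => ℓ v) := ⟨ℓ, 0, by simp⟩

theorem add {f g : V → ℝ} (hf : IsAffineFn f) (hg : IsAffineFn g) :
    IsAffineFn (fun v => f v + g v) := by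
  obtain ⟨ℓ, c, h⟩ := hf
  obtain ⟨ℓ', c', h'⟩ := hg
  exact ⟨ℓ + ℓ', c + c', fun y => by simp only [h, h', LinearMap.add_apply]; ring⟩

theorem const_mul {f : V → ℝ} (hf : IsAffineFn f) (r : ℝ) : IsAffineFn (fun v => r * f v) := by
  obtain ⟨ℓ, c, h⟩ := hf
  exact ⟨r • ℓ, r * c, fun y => by
    simp only [h, LinearMap.smul_apply, smul_eq_mul]
    ring⟩

theorem sub {f g : V → ℝ} (hf : IsAffineFn f) (hg : IsAffineFn g) :
    IsAffineFn (fun v => f v - g v) := by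
  have h := hf.add (hg.const_mul (-1))
  refine (funext fun v => ?_ : (fun v => f v + -1 * g v) = fun v => f v - g v) ▸ h
  ring

theorem div_const {f : V → ℝ} (hf : IsAffineFn f) (r : ℝ) : IsAffineFn (fun v => f v / r) := by
  have h := hf.const_mul r⁻¹
  refine (funext fun v => ?_ : (fun v => r⁻¹ * f v) = fun v => f v / r) ▸ h
  rw [div_eq_inv_mul]

theorem sum {ι : Type*} (s : Finset ι) {f : ι → V → ℝ} (hf : ∀ i, IsAffineFn (f i)) :
    IsAffineFn (fun v => ∑ i ∈ s, f i v) := by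
  choose ℓ c h using hf
  refine ⟨∑ i ∈ s, ℓ i, ∑ i ∈ s, c i, fun y => ?_⟩
  rw [LinearMap.sum_apply, ← Finset.sum_add_distrib]
  exact Finset.sum_congr rfl fun i _ => h i y

theorem comp {f : W → ℝ} (hf : IsAffineFn f) (L : V →ₗ[ℝ] W) : IsAffineFn (fun v => f (L v)) := by
  obtain ⟨ℓ, c, h⟩ := hf
  exact ⟨ℓ ∘ₗ L, c, fun y => h (L y)⟩

theorem apply_segment {f : V → ℝ} (hf : IsAffineFn f) (s : ℝ) (y z : V) :
    f (y + s • (z - y)) = f y + s * (f z - f y) := by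
  obtain ⟨ℓ, c, h⟩ := hf
  simp only [h, map_add, map_smul, map_sub, smul_eq_mul]
  ring

end IsAffineFn

namespace IsConvexQuadratic

theorem of_affine {f : V → ℝ} (hf : IsAffineFn f) : IsConvexQuadratic f := by
  obtain ⟨ℓ, c, h⟩ := hf
  exact fun y => ⟨ℓ, 0, by simp, by simp, fun d => by rw [h, h, map_add, Pi.zero_apply]; ring⟩

theorem sq {f : V → ℝ} (hf : IsAffineFn f) : IsConvexQuadratic (fun v => f v ^ 2) := by
  obtain ⟨ℓ, c, h⟩ := hf
  refine fun y => ⟨(2 * f y) • ℓ, fun d => ℓ d ^ 2, fun d => sq_nonneg _, fun s d => ?_,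
    fun d => ?_⟩
  · simp only [map_smul, smul_eq_mul, mul_pow]
  · simp only [h, map_add, LinearMap.smul_apply, smul_eq_mul]
    ring

theorem add {f g : V → ℝ} (hf : IsConvexQuadratic f) (hg : IsConvexQuadratic g) :
    IsConvexQuadratic (fun v => f v + g v) := by
  intro y
  obtain ⟨ℓ, q, h0, h1, h2⟩ := hf y
  obtain ⟨ℓ', q', h0', h1', h2'⟩ := hg y
  refine ⟨ℓ + ℓ', fun d => q d + q' d, fun d => add_nonneg (h0 d) (h0' d), fun s d => ?_,
    fun d => ?_⟩
  · simp only [h1, h1']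
    ring
  · simp only [h2, h2', LinearMap.add_apply]
    ring

theorem const_mul {f : V → ℝ} (hf : IsConvexQuadratic f) {r : ℝ} (hr : 0 ≤ r) :
    IsConvexQuadratic (fun v => r * f v) := by
  intro y
  obtain ⟨ℓ, q, h0, h1, h2⟩ := hf y
  refine ⟨r • ℓ, fun d => r * q d, fun d => mul_nonneg hr (h0 d), fun s d => ?_, fun d => ?_⟩
  · simp only [h1]
    ring
  · simp only [h2, LinearMap.smul_apply, smul_eq_mul]
    ring

theorem sum {ι : Type*} (s : Finset ι) {f : ι → V → ℝ} (hf : ∀ i, IsConvexQuadratic (f i)) :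
    IsConvexQuadratic (fun v => ∑ i ∈ s, f i v) := by
  classical
  induction s using Finset.induction_on with
  | empty => simpa using of_affine (IsAffineFn.const (V := V) 0)
  | insert j s hj ih =>
    simp only [Finset.sum_insert hj]
    exact (hf j).add ih

theorem comp {f : W → ℝ} (hf : IsConvexQuadratic f) (L : V →ₗ[ℝ] W) :
    IsConvexQuadratic (fun v => f (L v)) := by
  intro y
  obtain ⟨ℓ, q, h0, h1, h2⟩ := hf (L y)
  exact ⟨ℓ ∘ₗ L, fun d => q (L d), fun d => h0 _, fun s d => by simp only [map_smul, h1],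
    fun d => by simp only [map_add, h2, LinearMap.comp_apply]⟩

theorem segment_le {f : V → ℝ} (hf : IsConvexQuadratic f) {s : ℝ} (hs0 : 0 ≤ s) (hs1 : s ≤ 1)
    (y z : V) : f (y + s • (z - y)) ≤ f y + s * (f z - f y) := by
  obtain ⟨ℓ, q, h0, h1, h2⟩ := hf y
  have h3 := h2 (z - y)
  rw [add_sub_cancel] at h3
  rw [h2, h1, map_smul, smul_eq_mul, h3]
  have : s ^ 2 * q (z - y) ≤ s * q (z - y) :=
    mul_le_mul_of_nonneg_right (by nlinarith) (h0 _)
  linarith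

end IsConvexQuadratic

namespace IsPolyhedron

theorem inter {P Q : Set V} (hP : IsPolyhedron P) (hQ : IsPolyhedron Q) : IsPolyhedron (P ∩ Q) := by
  classical
  obtain ⟨A, rfl⟩ := hP
  obtain ⟨B, rfl⟩ := hQ
  refine ⟨A ∪ B, Set.ext fun y => ?_⟩
  simp only [Set.mem_inter_iff, Set.mem_ofPred_eq, Finset.mem_union]
  exact ⟨fun h p hp => hp.elim (h.1 p) (h.2 p), fun h => ⟨fun p hp => h p (Or.inl hp),
    fun p hp => h p (Or.inr hp)⟩⟩

theorem and {p q : V → Prop} (hp : IsPolyhedron {v | p v}) (hq : IsPolyhedron {v | q v}) :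
    IsPolyhedron {v | p v ∧ q v} := hp.inter hq

theorem le {f g : V → ℝ} (hf : IsAffineFn f) (hg : IsAffineFn g) :
    IsPolyhedron {v | f v ≤ g v} := by
  obtain ⟨ℓ, c, h⟩ := hf
  obtain ⟨ℓ', c', h'⟩ := hg
  refine ⟨{(ℓ - ℓ', c' - c)}, Set.ext fun y => ?_⟩
  simp only [Set.mem_ofPred_eq, Finset.mem_singleton, forall_eq, LinearMap.sub_apply, h, h']
  constructor <;> intro <;> linarith

theorem eq {f g : V → ℝ} (hf : IsAffineFn f) (hg : IsAffineFn g) :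
    IsPolyhedron {v | f v = g v} := by
  have := (le hf hg).and (le hg hf)
  simpa only [← le_antisymm_iff] using this

theorem all {ι : Type*} [Finite ι] {p : ι → V → Prop} (h : ∀ i, IsPolyhedron {v | p i v}) :
    IsPolyhedron {v | ∀ i, p i v} := by
  classical
  cases nonempty_fintype ι
  choose A hA using h
  refine ⟨Finset.univ.biUnion A, Set.ext fun y => ?_⟩
  have h1 : ∀ i, p i y ↔ ∀ q ∈ A i, q.1 y ≤ q.2 := fun i => Set.ext_iff.1 (hA i) y
  simp only [Set.mem_ofPred_eq, h1, Finset.mem_biUnion, Finset.mem_univ, true_and]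
  exact ⟨fun h q ⟨i, hq⟩ => h i q hq, fun h i q hq => h q ⟨i, hq⟩⟩

theorem preimage {P : Set W} (hP : IsPolyhedron P) (L : V →ₗ[ℝ] W) :
    IsPolyhedron {v | L v ∈ P} := by
  classical
  obtain ⟨A, rfl⟩ := hP
  refine ⟨A.image fun p => (p.1 ∘ₗ L, p.2), Set.ext fun y => ?_⟩
  simp only [Set.mem_ofPred_eq, Finset.forall_mem_image, LinearMap.comp_apply]

theorem segment_mem {P : Set V} (hP : IsPolyhedron P) {s : ℝ} (hs0 : 0 ≤ s) (hs1 : s ≤ 1) {y z : V}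
    (hy : y ∈ P) (hz : z ∈ P) : y + s • (z - y) ∈ P := by
  obtain ⟨A, rfl⟩ := hP
  intro p hp
  have h1 := hy p hp
  have h2 := hz p hp
  rw [map_add, map_smul, map_sub, smul_eq_mul]
  nlinarith

theorem isClosed {V : Type*} [NormedAddCommGroup V] [NormedSpace ℝ V] [FiniteDimensional ℝ V]
    {P : Set V} (hP : IsPolyhedron P) : IsClosed P := by
  obtain ⟨A, rfl⟩ := hP
  simp only [Set.ofPred_forall]
  exact isClosed_iInter fun p => isClosed_iInter fun _ =>
    isClosed_le p.1.continuous_of_finiteDimensional continuous_const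

end IsPolyhedron

theorem IsAffineFn.continuous {V : Type*} [NormedAddCommGroup V] [NormedSpace ℝ V]
    [FiniteDimensional ℝ V] {f : V → ℝ} (hf : IsAffineFn f) : Continuous f := by
  obtain ⟨ℓ, c, h⟩ := hf
  rw [funext h]
  exact ℓ.continuous_of_finiteDimensional.add continuous_const

theorem IsAffineFn.tendsto_sub {V : Type*} [NormedAddCommGroup V] [NormedSpace ℝ V]
    [FiniteDimensional ℝ V] {f : V → ℝ} (hf : IsAffineFn f) {u v : ℕ → V}
    (h : Tendsto (fun k => u k - v k) atTop (𝓝 0)) :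
    Tendsto (fun k => f (u k) - f (v k)) atTop (𝓝 0) := by
  obtain ⟨ℓ, c, hℓ⟩ := hf
  have h1 := (ℓ.continuous_of_finiteDimensional.tendsto 0).comp h
  rw [map_zero] at h1
  refine h1.congr fun k => ?_
  simp only [Function.comp, hℓ, map_sub]
  ring

/-- Lagrange multipliers of affine equations for the minimum of a convex quadratic function over
a polyhedron. -/
theorem exists_multiplier {τ : Type*} [Fintype τ] {P : Set V} (hP : IsPolyhedron P) {F : V → ℝ}
    (hF : IsConvexQuadratic F) {b : τ → V → ℝ} (hb : ∀ t, IsAffineFn (b t)) {y : V} (hy : y ∈ P)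
    (hby : ∀ t, b t y = 0) (hmin : ∀ z ∈ P, (∀ t, b t z = 0) → F y ≤ F z) :
    ∃ μ : τ → ℝ, ∀ z ∈ P, F y + ∑ t, μ t * b t z ≤ F z := by
  classical
  obtain ⟨A, rfl⟩ := hP
  choose β γ hβ using hb
  obtain ⟨c, q, hq0, hq, hFd⟩ := hF y
  set I := A.filter fun p => p.1 y = p.2 with hI
  -- Inactive constraints tolerate a short step, so for a polyhedron linearized feasibility is
  -- actual feasibility and no constraint qualification is needed.
  have key : ∀ d, (∀ p ∈ I, p.1 d ≤ 0) → (∀ t, β t d = 0) → 0 ≤ c d := by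
    intro d hd hβd
    apply nonneg_of_eventually_quadratic (b := q d)
    have hfeas : ∀ᶠ s in 𝓝[>] (0 : ℝ), ∀ p ∈ A, p.1 (y + s • d) ≤ p.2 := by
      rw [Filter.eventually_all_finset]
      intro p hp
      rcases eq_or_lt_of_le (hy p hp) with h | h
      · filter_upwards [self_mem_nhdsWithin] with s hs
        have hs' : (0 : ℝ) < s := hs
        rw [map_add, map_smul, smul_eq_mul, h]
        have := mul_nonpos_of_nonneg_of_nonpos hs'.le (hd p (Finset.mem_filter.2 ⟨hp, h⟩))
        linarith
      · have h1 : Tendsto (fun s : ℝ => p.1 y + s * p.1 d) (𝓝[>] 0) (𝓝 (p.1 y + 0 * p.1 d)) :=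
          ((continuous_const.add (continuous_id.mul continuous_const)).tendsto 0).mono_left
            nhdsWithin_le_nhds
        rw [zero_mul, add_zero] at h1
        filter_upwards [h1.eventually_lt_const h] with s hs
        rw [map_add, map_smul, smul_eq_mul]
        exact hs.le
    filter_upwards [hfeas] with s hs
    have h1 := hmin (y + s • d) hs fun t => by
      have := hby t
      rw [hβ] at this ⊢
      rw [map_add, map_smul, hβd, smul_zero, add_zero, this]
    rw [hFd, hq, map_smul, smul_eq_mul] at h1
    linarith
  -- Each equation enters as two opposite inequalities; its multiplier of free sign is the
  -- difference of their coefficients.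
  obtain ⟨ν, hν, hc⟩ := farkas (I.disjSum (Finset.univ.disjSum Finset.univ))
    (Sum.elim (fun p => p.1) (Sum.elim β fun t => -β t)) (-c) fun d hd => by
      rw [LinearMap.neg_apply, neg_nonpos]
      refine key d (fun p hp => hd (Sum.inl p) (Finset.inl_mem_disjSum.2 hp)) fun t => ?_
      have h1 : β t d ≤ 0 := hd (Sum.inr (Sum.inl t)) (by simp)
      have h2 : -β t d ≤ 0 := hd (Sum.inr (Sum.inr t)) (by simp)
      linarith
  refine ⟨fun t => ν (Sum.inr (Sum.inr t)) - ν (Sum.inr (Sum.inl t)), fun z hz => ?_⟩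
  have h1 := LinearMap.congr_fun hc (z - y)
  simp only [Finset.sum_disjSum, Sum.elim_inl, Sum.elim_inr, LinearMap.add_apply,
    LinearMap.sum_apply, LinearMap.smul_apply, LinearMap.neg_apply, smul_eq_mul] at h1
  have h2 : ∀ t, β t (z - y) = b t z := fun t => by
    have := hby t
    rw [hβ] at this ⊢
    rw [map_sub]
    linarith
  simp only [h2] at h1
  have h3 : ∑ p ∈ I, ν (Sum.inl p) * p.1 (z - y) ≤ 0 := by
    refine Finset.sum_nonpos fun p hp => mul_nonpos_of_nonneg_of_nonpos (hν _) ?_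
    obtain ⟨hpA, hpy⟩ := Finset.mem_filter.1 hp
    rw [map_sub, hpy]
    linarith [hz p hpA]
  have h4 := hFd (z - y)
  rw [add_sub_cancel] at h4
  simp only [sub_mul, Finset.sum_sub_distrib]
  simp only [mul_neg, Finset.sum_neg_distrib] at h1
  linarith [hq0 (z - y)]

end Polyhedra

/-- In a compact set, approximate zeros of a continuous function are close to zeros. -/
theorem exists_tendsto_sub_of_isCompact {V : Type*} [NormedAddCommGroup V] {K : Set V}
    (hK : IsCompact K) {h : V → ℝ} (hh : Continuous h) (hne : ∃ z ∈ K, h z = 0) {u : ℕ → V}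
    (hu : ∀ k, u k ∈ K) (hlim : Tendsto (fun k => h (u k)) atTop (𝓝 0)) :
    ∃ z : ℕ → V, (∀ k, z k ∈ K ∧ h (z k) = 0) ∧ Tendsto (fun k => u k - z k) atTop (𝓝 0) := by
  set Z := K ∩ h ⁻¹' {0} with hZ
  have hZc : IsCompact Z := hK.inter_right (isClosed_singleton.preimage hh)
  have hZne : Z.Nonempty := by
    obtain ⟨z, hz, hz0⟩ := hne
    exact ⟨z, hz, hz0⟩
  have hinf : Tendsto (fun k => Metric.infDist (u k) Z) atTop (𝓝 0) := by
    -- Every subsequence has a further one converging in the compact set, and by continuity its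
    -- limit is a zero.
    refine tendsto_of_subseq_tendsto fun ns hns => ?_
    obtain ⟨v, hv, φ, hφ, hlimv⟩ := hK.tendsto_subseq fun k => hu (ns k)
    refine ⟨φ, ?_⟩
    have h1 : h v = 0 := tendsto_nhds_unique ((hh.tendsto v).comp hlimv)
      (hlim.comp (hns.comp hφ.tendsto_atTop))
    have h2 := ((Metric.continuous_infDist_pt Z).tendsto v).comp hlimv
    rw [Metric.infDist_zero_of_mem (show v ∈ Z from ⟨hv, h1⟩)] at h2
    exact h2
  choose z hz hzd using fun k => hZc.exists_infDist_eq_dist hZne (u k)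
  refine ⟨z, hz, tendsto_zero_iff_norm_tendsto_zero.2 (hinf.congr fun k => ?_)⟩
  rw [hzd, dist_eq_norm]

/-! ### Schedules as vectors -/

/-- The vector space of the entries of a schedule. -/
abbrev SchedVec (N T : ℕ) : Type :=
  (Fin T → ℝ) × (Fin T → ℝ) × (Fin T → ℝ) × (Fin N → Fin T → ℝ) × (Fin T → ℝ) × (Fin T → ℝ)

/-- The schedule with given entries. -/
def SchedVec.toSched {N T : ℕ} (v : SchedVec N T) : Schedule N T :=
  ⟨v.1, v.2.1, v.2.2.1, v.2.2.2.1, v.2.2.2.2.1, v.2.2.2.2.2⟩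

/-- The entries of a schedule. -/
def Schedule.toVec {N T : ℕ} (x : Schedule N T) : SchedVec N T :=
  (x.wind, x.buy, x.sell, x.load, x.charge, x.discharge)

namespace SchedVec

variable {N T : ℕ}

theorem toSched_toVec (x : Schedule N T) : x.toVec.toSched = x := rfl

theorem isAffineFn_wind (t : Fin T) : IsAffineFn fun v : SchedVec N T => v.toSched.wind t :=
  .linear (IsLinearMap.mk' (fun v : SchedVec N T => v.toSched.wind t)
    ⟨fun _ _ => rfl, fun _ _ => rfl⟩)

theorem isAffineFn_buy (t : Fin T) : IsAffineFn fun v : SchedVec N T => v.toSched.buy t :=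
  .linear (IsLinearMap.mk' (fun v : SchedVec N T => v.toSched.buy t)
    ⟨fun _ _ => rfl, fun _ _ => rfl⟩)

theorem isAffineFn_sell (t : Fin T) : IsAffineFn fun v : SchedVec N T => v.toSched.sell t :=
  .linear (IsLinearMap.mk' (fun v : SchedVec N T => v.toSched.sell t)
    ⟨fun _ _ => rfl, fun _ _ => rfl⟩)

theorem isAffineFn_load (n : Fin N) (t : Fin T) :
    IsAffineFn fun v : SchedVec N T => v.toSched.load n t :=
  .linear (IsLinearMap.mk' (fun v : SchedVec N T => v.toSched.load n t)
    ⟨fun _ _ => rfl, fun _ _ => rfl⟩)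

theorem isAffineFn_charge (t : Fin T) : IsAffineFn fun v : SchedVec N T => v.toSched.charge t :=
  .linear (IsLinearMap.mk' (fun v : SchedVec N T => v.toSched.charge t)
    ⟨fun _ _ => rfl, fun _ _ => rfl⟩)

theorem isAffineFn_discharge (t : Fin T) :
    IsAffineFn fun v : SchedVec N T => v.toSched.discharge t :=
  .linear (IsLinearMap.mk' (fun v : SchedVec N T => v.toSched.discharge t)
    ⟨fun _ _ => rfl, fun _ _ => rfl⟩)

theorem tendsto_l1Dist {u v : ℕ → SchedVec N T}
    (h : Tendsto (fun k => u k - v k) atTop (𝓝 0)) :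
    Tendsto (fun k => (u k).toSched.l1Dist (v k).toSched) atTop (𝓝 0) := by
  have hc : Continuous fun w : SchedVec N T => w.toSched.l1Dist (0 : SchedVec N T).toSched := by
    unfold Schedule.l1Dist SchedVec.toSched
    fun_prop
  have h0 : (0 : SchedVec N T).toSched.l1Dist (0 : SchedVec N T).toSched = 0 := by
    simp [Schedule.l1Dist]
  have h1 := (hc.tendsto 0).comp h
  rw [h0] at h1
  refine h1.congr fun k => ?_
  simp [Schedule.l1Dist, SchedVec.toSched]

end SchedVec

/-! ### The compact polytope of feasible schedules of one microgrid -/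

namespace Microgrid

variable {T : ℕ} (m : Microgrid T)

/-- The net received energy that balances a schedule. -/
def netUse (x : Schedule m.users T) (t : Fin T) : ℝ :=
  x.sell t + x.charge t + m.inelastic t + (∑ n, x.load n t)
    - x.wind t - x.buy t - x.discharge t

/-- The schedules that satisfy all constraints for a suitable net received energy. -/
def feasibleSet : Set (SchedVec m.users T) := {v | m.Feasible v.toSched (m.netUse v.toSched)}

/-- The balance equation determines the net received energy from the schedule, so it can be
eliminated and the remaining constraint set does not depend on it. -/
theorem feasible_iff {x : Schedule m.users T} {E : Fin T → ℝ} :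
    m.Feasible x E ↔ x.toVec ∈ m.feasibleSet ∧ ∀ t, E t = m.netUse x t := by
  constructor
  · intro h
    have hE : ∀ t, E t = m.netUse x t := fun t => by
      have := h.balance t
      simp only [netUse]
      linarith
    refine ⟨?_, hE⟩
    rw [show E = m.netUse x from funext hE] at h
    exact h
  · rintro ⟨h, hE⟩
    rw [show E = m.netUse x from funext hE]
    exact h

theorem isAffineFn_netUse (t : Fin T) :
    IsAffineFn fun v : SchedVec m.users T => m.netUse v.toSched t :=
  (((((SchedVec.isAffineFn_sell t).add (SchedVec.isAffineFn_charge t)).add (.const _)).add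
    (.sum _ fun n => SchedVec.isAffineFn_load n t)).sub (SchedVec.isAffineFn_wind t)).sub
    (SchedVec.isAffineFn_buy t) |>.sub (SchedVec.isAffineFn_discharge t)

theorem isAffineFn_storage (k : ℕ) :
    IsAffineFn fun v : SchedVec m.users T => m.storage v.toSched k := by
  refine (IsAffineFn.const _).add (.sum _ fun τ => ?_)
  split_ifs
  · exact ((SchedVec.isAffineFn_charge τ).const_mul _).sub
      ((SchedVec.isAffineFn_discharge τ).div_const _)
  · exact .const _

theorem isPolyhedron_feasibleSet : IsPolyhedron m.feasibleSet := by
  have hP : IsPolyhedron {v : SchedVec m.users T |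
      (∀ t, 0 ≤ v.toSched.wind t ∧ v.toSched.wind t ≤ m.windFactor t * m.windCapacity) ∧
      (∀ t, 0 ≤ v.toSched.buy t ∧ v.toSched.buy t ≤ m.buyMax) ∧
      (∀ t, 0 ≤ v.toSched.sell t ∧ v.toSched.sell t ≤ m.sellMax) ∧
      (∀ n, ∑ t, v.toSched.load n t = m.demand n) ∧
      (∀ n t, m.loadMin n t ≤ v.toSched.load n t ∧ v.toSched.load n t ≤ m.loadMax n t) ∧
      (∀ t, 0 ≤ v.toSched.charge t ∧ v.toSched.charge t ≤ m.chargeMax) ∧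
      (∀ t, 0 ≤ v.toSched.discharge t ∧ v.toSched.discharge t ≤ m.dischargeMax) ∧
      (∀ t : Fin T, (1 - m.depth) * m.storageMax ≤ m.storage v.toSched (t + 1) ∧
        m.storage v.toSched (t + 1) ≤ m.storageMax) ∧
      m.storage v.toSched T = m.storageInit ∧
      ∀ t : Fin T, v.toSched.sell t
        ≤ m.windFactor t * m.windCapacity - v.toSched.wind t + m.storage v.toSched (t + 1)} := by
    refine .and (.all fun t => ?_) (.and (.all fun t => ?_) (.and (.all fun t => ?_)
      (.and (.all fun n => ?_) (.and (.all fun n => .all fun t => ?_) (.and (.all fun t => ?_)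
      (.and (.all fun t => ?_) (.and (.all fun t => ?_) (.and ?_ (.all fun t => ?_)))))))))
    · exact (IsPolyhedron.le (.const _) (SchedVec.isAffineFn_wind t)).and
        (IsPolyhedron.le (SchedVec.isAffineFn_wind t) (.const _))
    · exact (IsPolyhedron.le (.const _) (SchedVec.isAffineFn_buy t)).and
        (IsPolyhedron.le (SchedVec.isAffineFn_buy t) (.const _))
    · exact (IsPolyhedron.le (.const _) (SchedVec.isAffineFn_sell t)).and
        (IsPolyhedron.le (SchedVec.isAffineFn_sell t) (.const _))
    · exact IsPolyhedron.eq (.sum _ fun t => SchedVec.isAffineFn_load n t) (.const _)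
    · exact (IsPolyhedron.le (.const _) (SchedVec.isAffineFn_load n t)).and
        (IsPolyhedron.le (SchedVec.isAffineFn_load n t) (.const _))
    · exact (IsPolyhedron.le (.const _) (SchedVec.isAffineFn_charge t)).and
        (IsPolyhedron.le (SchedVec.isAffineFn_charge t) (.const _))
    · exact (IsPolyhedron.le (.const _) (SchedVec.isAffineFn_discharge t)).and
        (IsPolyhedron.le (SchedVec.isAffineFn_discharge t) (.const _))
    · exact (IsPolyhedron.le (.const _) (m.isAffineFn_storage _)).and
        (IsPolyhedron.le (m.isAffineFn_storage _) (.const _))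
    · exact IsPolyhedron.eq (m.isAffineFn_storage _) (.const _)
    · exact IsPolyhedron.le (SchedVec.isAffineFn_sell t)
        (((IsAffineFn.const _).sub (SchedVec.isAffineFn_wind t)).add (m.isAffineFn_storage _))
  convert hP using 1
  ext v
  exact ⟨fun h => ⟨h.wind, h.buy, h.sell, h.load_total, h.load, h.charge, h.discharge, h.storage,
      h.storage_terminal, h.sell_available⟩,
    fun ⟨h1, h2, h3, h4, h5, h6, h7, h8, h9, h10⟩ => ⟨h1, h2, h3, h4, h5, h6, h7, h8, h9, h10,
      fun t => by simp only [netUse]; ring⟩⟩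

theorem isCompact_feasibleSet : IsCompact m.feasibleSet := by
  refine (isCompact_Icc (a := ((0, 0, 0, m.loadMin, 0, 0) : SchedVec m.users T))
    (b := (fun t => m.windFactor t * m.windCapacity, fun _ => m.buyMax, fun _ => m.sellMax,
      m.loadMax, fun _ => m.chargeMax, fun _ => m.dischargeMax))).of_isClosed_subset
    m.isPolyhedron_feasibleSet.isClosed fun v (h : m.Feasible _ _) => ?_
  exact ⟨⟨fun t => (h.wind t).1, fun t => (h.buy t).1, fun t => (h.sell t).1,
      fun n t => (h.load n t).1, fun t => (h.charge t).1, fun t => (h.discharge t).1⟩,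
    ⟨fun t => (h.wind t).2, fun t => (h.buy t).2, fun t => (h.sell t).2,
      fun n t => (h.load n t).2, fun t => (h.charge t).2, fun t => (h.discharge t).2⟩⟩

end Microgrid

/-! ### Cost functions and local constraints as functions of vectors -/

namespace System

variable {M : Type*} {T : ℕ} (S : System M T)

/-- The vector space of the schedules of microgrid `i`. -/
abbrev Vec (i : M) : Type := SchedVec (S.grid i).users T

theorem isConvexQuadratic_opCost (i : M) :
    IsConvexQuadratic fun v : S.Vec i => S.opCost i v.toSched := by
  refine .add (.add (.of_affine (.sum _ fun t => ?_)) (.sum _ fun n => .const_mul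
    (.sum _ fun t => .sq ?_) ((S.grid i).sensitivity_nonneg n))) (.of_affine ?_)
  · exact ((SchedVec.isAffineFn_buy t).const_mul _).sub ((SchedVec.isAffineFn_sell t).const_mul _)
  · exact (SchedVec.isAffineFn_load n t).sub (.const _)
  · exact ((IsAffineFn.sum _ fun t => SchedVec.isAffineFn_charge t).add
      (.sum _ fun t => SchedVec.isAffineFn_discharge t)).const_mul _

theorem continuous_opCost (i : M) : Continuous fun v : S.Vec i => S.opCost i v.toSched := by
  unfold System.opCost SchedVec.toSched
  fun_prop

variable [Fintype M] [DecidableEq M]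

theorem localFeasible_iff {i : M} {x : S.Sched i} {e : M → Fin T → ℝ} :
    S.LocalFeasible i x e ↔ x.toVec ∈ (S.grid i).feasibleSet ∧
      (∀ t, ∑ j, e j t = (S.grid i).netUse x t) ∧ ∀ t, e i t = 0 := by
  constructor
  · intro h
    have h1 := (S.grid i).feasible_iff.1 h.schedule
    refine ⟨h1.1, fun t => ?_, h.diag⟩
    rw [← h1.2 t, ← Finset.add_sum_erase _ _ (Finset.mem_univ i), h.diag, zero_add]
  · rintro ⟨h1, h2, h3⟩
    refine ⟨(S.grid i).feasible_iff.2 ⟨h1, fun t => ?_⟩, h3⟩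
    rw [← h2 t, ← Finset.add_sum_erase _ _ (Finset.mem_univ i), h3, zero_add]

/-! ### The local problems of Step 1 -/

/-- Schedules range over a compact set but trades do not. Completing the square shows that the
objective is coercive in the trades, so points no worse than `(x₀, 0)` lie in the compact set `K`.
-/
theorem exists_localSolution1 {i : M} (hfeas : ∃ x : S.Sched i, (S.grid i).Feasible x 0) {ρ : ℝ}
    (hρ : 0 < ρ) (eHat lam : M → Fin T → ℝ) : ∃ x e, S.LocalSolution1 i ρ eHat lam x e := by
  obtain ⟨x₀, hx₀⟩ := hfeas
  have h0 : S.LocalFeasible i x₀ 0 := ⟨by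
    simp only [Pi.zero_apply, Finset.sum_const_zero]
    exact hx₀, fun t => rfl⟩
  obtain ⟨vm, hvm, hm⟩ := (S.grid i).isCompact_feasibleSet.exists_isMinOn
    ⟨_, (S.localFeasible_iff.1 h0).1⟩ (S.continuous_opCost i).continuousOn
  set m₀ := S.opCost i vm.toSched with hm₀
  set κ := ∑ j ∈ Finset.univ.erase i, ∑ t,
    (lam j t * eHat j t + lam j t ^ 2 / (2 * ρ)) with hκ
  set Q := S.localObjective1 i ρ eHat lam x₀ 0 + κ - m₀ with hQ
  set R : M → Fin T → ℝ := fun j t => |eHat j t + lam j t / ρ| + √(2 * Q / ρ) with hR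
  have hobj : ∀ x e, S.localObjective1 i ρ eHat lam x e = S.opCost i x
      + (∑ j ∈ Finset.univ.erase i, ∑ t, ρ / 2 * (e j t - (eHat j t + lam j t / ρ)) ^ 2) - κ := by
    intro x e
    rw [localObjective1, hκ, add_sub_assoc, ← Finset.sum_sub_distrib]
    congr 1
    refine Finset.sum_congr rfl fun j _ => ?_
    rw [← Finset.sum_sub_distrib]
    refine Finset.sum_congr rfl fun t _ => ?_
    field_simp
    ring
  set s : Set (S.Vec i × (M → Fin T → ℝ)) := {p | S.LocalFeasible i p.1.toSched p.2} with hs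
  have hsc : IsClosed s := by
    have : s = (Prod.fst ⁻¹' (S.grid i).feasibleSet) ∩
        ({p : S.Vec i × (M → Fin T → ℝ) | ∀ t, ∑ j, p.2 j t = (S.grid i).netUse p.1.toSched t} ∩
          {p : S.Vec i × (M → Fin T → ℝ) | ∀ t, p.2 i t = 0}) := by
      ext p
      exact S.localFeasible_iff
    rw [this]
    refine ((S.grid i).isPolyhedron_feasibleSet.isClosed.preimage continuous_fst).inter
      (IsClosed.inter ?_ ?_)
    · simp only [Set.ofPred_forall]
      refine isClosed_iInter fun t => isClosed_eq (by fun_prop) ?_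
      exact ((S.grid i).isAffineFn_netUse t).continuous.comp continuous_fst
    · simp only [Set.ofPred_forall]
      exact isClosed_iInter fun t => isClosed_eq (by fun_prop) continuous_const
  set K := s ∩ ((S.grid i).feasibleSet ×ˢ Set.Icc (-R) R) with hK
  have hKc : IsCompact K :=
    ((S.grid i).isCompact_feasibleSet.prod isCompact_Icc).inter_left hsc
  have hbound : ∀ x e, S.LocalFeasible i x e → S.localObjective1 i ρ eHat lam x e
      ≤ S.localObjective1 i ρ eHat lam x₀ 0 → (x.toVec, e) ∈ K := by
    intro x e hxe hle
    have hx := S.localFeasible_iff.1 hxe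
    have h1 : m₀ ≤ S.opCost i x := hm hx.1
    have h2 : ∀ j t, |e j t| ≤ R j t := by
      intro j t
      rcases eq_or_ne j i with rfl | hj
      · rw [hxe.diag, abs_zero]
        exact add_nonneg (abs_nonneg _) (Real.sqrt_nonneg _)
      · have h3 : ρ / 2 * (e j t - (eHat j t + lam j t / ρ)) ^ 2 ≤ Q := by
          have h4 := Finset.single_le_sum
            (f := fun t => ρ / 2 * (e j t - (eHat j t + lam j t / ρ)) ^ 2)
            (fun t _ => by positivity) (Finset.mem_univ t)
          have h5 := Finset.single_le_sum
            (f := fun j => ∑ t, ρ / 2 * (e j t - (eHat j t + lam j t / ρ)) ^ 2)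
            (fun j _ => Finset.sum_nonneg fun t _ => by positivity)
            (Finset.mem_erase.2 ⟨hj, Finset.mem_univ j⟩)
          have h6 := hobj x e
          linarith
        have h4 : |e j t - (eHat j t + lam j t / ρ)| ≤ √(2 * Q / ρ) := by
          refine Real.abs_le_sqrt ?_
          rw [le_div_iff₀ hρ]
          linarith
        have h5 := abs_sub_abs_le_abs_sub (e j t) (eHat j t + lam j t / ρ)
        simp only [hR]
        linarith
    exact ⟨hxe, hx.1, fun j t => (abs_le.1 (h2 j t)).1, fun j t => (abs_le.1 (h2 j t)).2⟩
  have hcont : Continuous fun p : S.Vec i × (M → Fin T → ℝ) =>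
      S.localObjective1 i ρ eHat lam p.1.toSched p.2 := by
    have := (S.continuous_opCost i).comp (continuous_fst (Y := M → Fin T → ℝ))
    refine this.add ?_
    fun_prop
  obtain ⟨p, hp, hmin⟩ := hKc.exists_isMinOn ⟨_, hbound x₀ 0 h0 le_rfl⟩ hcont.continuousOn
  refine ⟨p.1.toSched, p.2, hp.1, fun x' e' hxe => ?_⟩
  rcases le_total (S.localObjective1 i ρ eHat lam x' e')
    (S.localObjective1 i ρ eHat lam x₀ 0) with h | h
  · exact hmin (hbound x' e' hxe h)
  · exact le_trans (hmin (hbound x₀ 0 h0 le_rfl)) h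

theorem LocalFeasible.segment {i : M} {x x' : S.Sched i} {e e' : M → Fin T → ℝ}
    (h : S.LocalFeasible i x e) (h' : S.LocalFeasible i x' e') {s : ℝ} (hs0 : 0 ≤ s)
    (hs1 : s ≤ 1) :
    S.LocalFeasible i (SchedVec.toSched (x.toVec + s • (x'.toVec - x.toVec)))
      (e + s • (e' - e)) := by
  rw [localFeasible_iff] at h h' ⊢
  refine ⟨(S.grid i).isPolyhedron_feasibleSet.segment_mem hs0 hs1 h.1 h'.1, fun t => ?_,
    fun t => ?_⟩
  · rw [((S.grid i).isAffineFn_netUse t).apply_segment s x.toVec x'.toVec,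
      SchedVec.toSched_toVec, SchedVec.toSched_toVec, ← h.2.1, ← h'.2.1]
    simp only [Pi.add_apply, Pi.smul_apply, Pi.sub_apply, smul_eq_mul, Finset.sum_add_distrib,
      ← Finset.mul_sum, Finset.sum_sub_distrib]
  · simp [h.2.2, h'.2.2]

/-- The variational inequality of the local problem. -/
theorem LocalSolution1.le_opCost {i : M} {ρ : ℝ} {eHat lam : M → Fin T → ℝ} {x x' : S.Sched i}
    {e e' : M → Fin T → ℝ} (h : S.LocalSolution1 i ρ eHat lam x e)
    (h' : S.LocalFeasible i x' e') :
    S.opCost i x + ∑ j ∈ Finset.univ.erase i, ∑ t,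
      (lam j t + ρ * (eHat j t - e j t)) * (e' j t - e j t) ≤ S.opCost i x' := by
  set A := ∑ j ∈ Finset.univ.erase i, ∑ t,
      (lam j t + ρ * (eHat j t - e j t)) * (e' j t - e j t) with hA
  set B := ∑ j ∈ Finset.univ.erase i, ∑ t, ρ / 2 * (e' j t - e j t) ^ 2 with hB
  suffices h0 : 0 ≤ S.opCost i x' - S.opCost i x - A by linarith
  -- The minimizer is compared with points at parameter `s` on the segment to the competitor.
  -- Convexity bounds the cost, and the penalty differs from its linearization by exactly `s ^ 2 *
  -- B`.
  apply nonneg_of_eventually_quadratic (b := B)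
  filter_upwards [Ioo_mem_nhdsGT (show (0 : ℝ) < 1 by norm_num)] with s hs
  have h1 := h.le _ _ (h.feasible.segment S h' hs.1.le hs.2.le)
  have h2 := (S.isConvexQuadratic_opCost i).segment_le hs.1.le hs.2.le x.toVec x'.toVec
  rw [SchedVec.toSched_toVec, SchedVec.toSched_toVec] at h2
  unfold localObjective1 at h1
  have h3 : ∑ j ∈ Finset.univ.erase i, ∑ t, (ρ / 2 * (eHat j t - (e + s • (e' - e)) j t) ^ 2
        - lam j t * (e + s • (e' - e)) j t)
      = ∑ j ∈ Finset.univ.erase i, ∑ t, (ρ / 2 * (eHat j t - e j t) ^ 2 - lam j t * e j t)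
        - s * A + s ^ 2 * B := by
    simp only [hA, hB, Finset.mul_sum, ← Finset.sum_sub_distrib, ← Finset.sum_add_distrib]
    refine Finset.sum_congr rfl fun j _ => Finset.sum_congr rfl fun t _ => ?_
    simp only [Pi.add_apply, Pi.smul_apply, Pi.sub_apply, smul_eq_mul]
    ring
  rw [h3] at h1
  linarith

/-- At a local solution, all trading partners see the same price. -/
theorem LocalSolution1.price_eq {i : M} {ρ : ℝ} {eHat lam : M → Fin T → ℝ} {x : S.Sched i}
    {e : M → Fin T → ℝ} (h : S.LocalSolution1 i ρ eHat lam x e) {j j' : M} (hj : j ≠ i)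
    (hj' : j' ≠ i) (t : Fin T) :
    lam j t + ρ * (eHat j t - e j t) ≤ lam j' t + ρ * (eHat j' t - e j' t) := by
  rcases eq_or_ne j j' with rfl | hjj
  · exact le_rfl
  -- Rerouting one unit between two partners leaves the net energy, hence the schedule and its cost,
  -- unchanged.
  set d : M → Fin T → ℝ := Pi.single j (Pi.single t 1) - Pi.single j' (Pi.single t 1) with hd
  have hdi : d i = 0 := by
    simp [hd, Pi.single_eq_of_ne hj.symm, Pi.single_eq_of_ne hj'.symm]
  have hf := S.localFeasible_iff.1 h.feasible
  have h' : S.LocalFeasible i x (e + d) := by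
    refine S.localFeasible_iff.2 ⟨hf.1, fun u => ?_, fun u => ?_⟩
    · rw [← hf.2.1]
      have : ∑ m, d m u = 0 := by
        simp only [hd, Pi.sub_apply, Finset.sum_sub_distrib]
        have h2 : ∀ j : M, ∑ m, (Pi.single j (Pi.single t 1) : M → Fin T → ℝ) m u
            = (Pi.single t 1 : Fin T → ℝ) u := by
          intro j
          rw [Finset.sum_eq_single_of_mem j (Finset.mem_univ j)
            (fun m _ hm => by simp [Pi.single_eq_of_ne hm]), Pi.single_eq_same]
        rw [h2, h2, sub_self]
      simp only [Pi.add_apply, Finset.sum_add_distrib, this, add_zero]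
    · rw [Pi.add_apply, Pi.add_apply, hf.2.2, hdi, Pi.zero_apply, add_zero]
  have h1 := h.le_opCost S h'
  have h2 : ∑ m ∈ Finset.univ.erase i, ∑ u,
      (lam m u + ρ * (eHat m u - e m u)) * ((e + d) m u - e m u)
      = (lam j t + ρ * (eHat j t - e j t)) - (lam j' t + ρ * (eHat j' t - e j' t)) := by
    simp only [Pi.add_apply, add_sub_cancel_left]
    have h3 : ∀ j : M, j ≠ i → ∑ m ∈ Finset.univ.erase i, ∑ u,
        (lam m u + ρ * (eHat m u - e m u)) * (Pi.single j (Pi.single t 1) : M → Fin T → ℝ) m u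
        = lam j t + ρ * (eHat j t - e j t) := by
      intro j hj
      rw [Finset.sum_eq_single_of_mem j (Finset.mem_erase.2 ⟨hj, Finset.mem_univ j⟩)
        (fun m _ hm => by simp [Pi.single_eq_of_ne hm]), Finset.sum_eq_single_of_mem t
        (Finset.mem_univ t) (fun u _ hu => by simp [Pi.single_eq_of_ne hu])]
      simp
    rw [← h3 j hj, ← h3 j' hj', ← Finset.sum_sub_distrib]
    refine Finset.sum_congr rfl fun m _ => ?_
    rw [← Finset.sum_sub_distrib]
    refine Finset.sum_congr rfl fun u _ => ?_
    simp only [hd, Pi.sub_apply]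
    ring
  linarith

theorem exists_step1Run (hfeas : ∀ i, ∃ x : S.Sched i, (S.grid i).Feasible x 0) {ρ : ℕ → ℝ}
    (hρ : ∀ k, 0 < ρ k) (eHat₀ : Trade M T) : ∃ R : S.Step1Run ρ, R.eHat 0 = eHat₀ := by
  have hex := fun (k : ℕ) (eHat lam : Trade M T) (i : M) =>
    S.exists_localSolution1 (hfeas i) (hρ k) (eHat i) (lam i)
  choose X E hXE using hex
  choose x₀ _ using hfeas
  let hat : ℕ → Trade M T → Trade M T → Trade M T := fun k e lam i j t =>
    (ρ k * (e i j t - e j i t) - (lam i j t - lam j i t)) / (2 * ρ k)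
  let St := (∀ i, S.Sched i) × Trade M T × Trade M T × Trade M T
  let next : ℕ → St → St := fun k s =>
    (X k s.2.2.1 s.2.2.2, E k s.2.2.1 s.2.2.2, hat k (E k s.2.2.1 s.2.2.2) s.2.2.2,
      fun i j t => s.2.2.2 i j t + ρ k * (hat k (E k s.2.2.1 s.2.2.2) s.2.2.2 i j t
        - E k s.2.2.1 s.2.2.2 i j t))
  let st : ℕ → St := fun k => Nat.rec (x₀, 0, eHat₀, 0) (fun k s => next k s) k
  exact ⟨⟨fun k => (st k).1, fun k => (st k).2.1, fun k => (st k).2.2.1, fun k => (st k).2.2.2, rfl,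
    fun k i => hXE k _ _ i, fun k i j t => rfl, fun k i j t => rfl⟩, rfl⟩

end System

/-! ### Joint schedules, and P1 with the trades eliminated -/

namespace System

variable {M : Type*} {T : ℕ} (S : System M T)

/-- The vector space of the schedules of all microgrids. -/
abbrev JointVec : Type _ := ∀ i, S.Vec i

/-- The joint vector of given schedules. -/
def vecOf (x : ∀ i, S.Sched i) : S.JointVec := fun i => (x i).toVec

/-- The schedules of a joint vector. -/
def schedOf (y : S.JointVec) : ∀ i, S.Sched i := fun i => (y i).toSched

/-- The joint schedules that satisfy all constraints of the individual microgrids. -/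
def jointSet : Set S.JointVec := {y | ∀ i, y i ∈ (S.grid i).feasibleSet}

/-- The net received energy of microgrid `i`. -/
def netOf (y : S.JointVec) (i : M) (t : Fin T) : ℝ := (S.grid i).netUse (y i).toSched t

/-- The schedule of microgrid `i` as a linear function of the joint schedule. -/
def component (i : M) : S.JointVec →ₗ[ℝ] S.Vec i := LinearMap.proj i

theorem isAffineFn_netOf (i : M) (t : Fin T) : IsAffineFn fun y : S.JointVec => S.netOf y i t :=
  ((S.grid i).isAffineFn_netUse t).comp (S.component i)

theorem isCompact_jointSet : IsCompact S.jointSet := by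
  have := isCompact_univ_pi fun i => (S.grid i).isCompact_feasibleSet
  convert this using 1
  ext y
  simp [jointSet]

theorem isPolyhedron_jointSet [Finite M] : IsPolyhedron S.jointSet :=
  .all fun i => (S.grid i).isPolyhedron_feasibleSet.preimage (S.component i)

variable [Fintype M]

/-- The total cost of a joint schedule. -/
def jointCost (y : S.JointVec) : ℝ := ∑ i, S.opCost i (y i).toSched

theorem socialCost_eq (x : ∀ i, S.Sched i) : S.socialCost x = S.jointCost (S.vecOf x) := rfl

theorem socialCost_schedOf (y : S.JointVec) : S.socialCost (S.schedOf y) = S.jointCost y := rfl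

theorem isConvexQuadratic_jointCost : IsConvexQuadratic S.jointCost :=
  .sum _ fun i => (S.isConvexQuadratic_opCost i).comp (S.component i)

theorem continuous_jointCost : Continuous S.jointCost :=
  continuous_finsetSum _ fun i _ => (S.continuous_opCost i).comp (continuous_apply i)

/-- This is P1 in terms of schedules alone: clearing trades exist exactly when the net energies sum
to zero. What remains is a continuous function on a compact set, nonempty by the schedules without
trading. -/
theorem exists_joint_minimum (hfeas : ∀ i, ∃ x : S.Sched i, (S.grid i).Feasible x 0) :
    ∃ y ∈ S.jointSet, (∀ t, ∑ i, S.netOf y i t = 0) ∧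
      ∀ z ∈ S.jointSet, (∀ t, ∑ i, S.netOf z i t = 0) → S.jointCost y ≤ S.jointCost z := by
  have hb : ∀ t, IsAffineFn fun y : S.JointVec => ∑ i, S.netOf y i t := fun t =>
    .sum _ fun i => S.isAffineFn_netOf i t
  have hc : IsClosed {y : S.JointVec | ∀ t, ∑ i, S.netOf y i t = 0} := by
    simp only [Set.ofPred_forall]
    exact isClosed_iInter fun t => isClosed_eq (hb t).continuous continuous_const
  choose x hx using hfeas
  have hx' := fun i => (S.grid i).feasible_iff.1 (hx i)
  obtain ⟨y, hy, hmin⟩ := (S.isCompact_jointSet.inter_right hc).exists_isMinOn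
    ⟨fun i => (x i).toVec, fun i => (hx' i).1, fun t => Finset.sum_eq_zero fun i _ =>
      ((hx' i).2 t).symm⟩ S.continuous_jointCost.continuousOn
  exact ⟨y, hy.1, hy.2, fun z hz hz0 => hmin ⟨hz, hz0⟩⟩

variable [DecidableEq M]

theorem P1Feasible.mem_jointSet {x : ∀ i, S.Sched i} {e : Trade M T} (h : S.P1Feasible x e) :
    (S.vecOf x) ∈ S.jointSet := fun i => (S.localFeasible_iff.1 (h.loc i)).1

theorem P1Feasible.anti {x : ∀ i, S.Sched i} {e : Trade M T} (h : S.P1Feasible x e) (i j : M)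
    (t : Fin T) : e i j t = -e j i t := by
  rcases eq_or_ne i j with rfl | hij
  · rw [(h.loc i).diag, neg_zero]
  · linarith [h.clearing i j t hij]

theorem P1Feasible.sum_netOf {x : ∀ i, S.Sched i} {e : Trade M T} (h : S.P1Feasible x e)
    (t : Fin T) : ∑ i, S.netOf (S.vecOf x) i t = 0 := by
  have h1 : ∀ i, S.netOf (S.vecOf x) i t = ∑ j, e i j t := fun i =>
    ((S.localFeasible_iff.1 (h.loc i)).2.1 t).symm
  simp only [h1]
  have h2 : ∑ i, ∑ j, e i j t = -∑ i, ∑ j, e i j t := by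
    conv_lhs => rw [Finset.sum_comm]
    simp only [← Finset.sum_neg_distrib]
    exact Finset.sum_congr rfl fun i _ => Finset.sum_congr rfl fun j _ => h.anti S j i t
  linarith

/-- Trades that realize given net exchanges, up to a circulation `c`. -/
theorem p1Feasible_of_net {y : S.JointVec} (hy : y ∈ S.jointSet)
    (h0 : ∀ t, ∑ i, S.netOf y i t = 0) {c : Trade M T} (hc : ∀ i j t, c i j t = -c j i t)
    (hc0 : ∀ i t, ∑ j, c i j t = 0) :
    S.P1Feasible (S.schedOf y) (fun i j t =>
      c i j t + (S.netOf y i t - S.netOf y j t) / Fintype.card M) := by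
  refine ⟨fun i => S.localFeasible_iff.2 ⟨hy i, fun t => ?_, fun t => ?_⟩, fun i j t _ => ?_⟩
  · have hn : (Fintype.card M : ℝ) ≠ 0 := by
      have : Nonempty M := ⟨i⟩
      exact_mod_cast Fintype.card_ne_zero
    rw [Finset.sum_add_distrib, hc0, zero_add, ← Finset.sum_div, Finset.sum_sub_distrib, h0,
      Finset.sum_const, nsmul_eq_mul, Finset.card_univ, sub_zero, mul_div_cancel_left₀ _ hn]
    rfl
  · have := hc i i t
    have h1 : c i i t = 0 := by linarith
    simp [h1]
  · rw [hc i j]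
    ring

theorem p1Optimal_of_le {x : ∀ i, S.Sched i} {e : Trade M T} (h : S.P1Feasible x e)
    {y : S.JointVec} (hmin : ∀ z ∈ S.jointSet, (∀ t, ∑ i, S.netOf z i t = 0) →
      S.jointCost y ≤ S.jointCost z) (hle : S.socialCost x ≤ S.jointCost y) : S.P1Optimal x e :=
  ⟨h, fun x' _ h' => by
    rw [S.socialCost_eq x']
    exact hle.trans (hmin _ (h'.mem_jointSet S) (h'.sum_netOf S))⟩

/-! ### Convergence of Step 1 -/

namespace Step1Run

variable {S} {ρ : ℕ → ℝ}

/-- The run as an exchange iteration, with prices at all nodes. -/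
theorem exists_exchangeRun (R : S.Step1Run ρ) (hρ : ∀ k, 0 < ρ k) :
    ∃ g : ℕ → M → Fin T → ℝ,
      ExchangeRun Finset.univ (fun k => ρ (k + 1)) (fun k => R.e (k + 1)) (fun k => R.eHat (k + 1))
        (fun k => R.lam (k + 1)) g ∧
      ∀ k i x' e', S.LocalFeasible i x' e' → S.opCost i (R.x (k + 1) i)
        + ∑ t, g k i t * (∑ j, e' j t - ∑ j, R.e (k + 1) i j t) ≤ S.opCost i x' := by
  have hg : ∀ k i, ∃ p : Fin T → ℝ, ∀ j, j ≠ i → ∀ t,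
      R.lam k i j t + ρ k * (R.eHat k i j t - R.e (k + 1) i j t) = p t := by
    intro k i
    by_cases hj : ∃ j, j ≠ i
    · obtain ⟨j, hj⟩ := hj
      exact ⟨_, fun j' hj' t => le_antisymm ((R.lower k i).price_eq S hj' hj t)
        ((R.lower k i).price_eq S hj hj' t)⟩
    -- A single microgrid has no partners, and any price serves.
    · exact ⟨0, fun j hj' => absurd ⟨j, hj'⟩ hj⟩
  choose p hp using hg
  -- The price `p k` belongs to the trades `R.e (k + 1)`, hence the index `k - 1`; its value at zero
  -- is never used.
  have hX := ExchangeRun.of_updates (G := Finset.univ) (x := R.e) (a := R.eHat) (l := R.lam)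
    (g := fun k => p (k - 1)) hρ R.lam_zero
    (fun k i j t hij => by
      have : i = j := by
        by_contra hc
        exact hij ⟨Finset.mem_univ i, Finset.mem_univ j, hc⟩
      rw [← this]
      exact (R.lower k i).feasible.diag t)
    R.eHat_succ R.lam_succ (fun k i _ j _ hij t => hp k i j hij.symm t)
  refine ⟨p, hX, fun k i x' e' h' => ?_⟩
  refine le_trans (le_of_eq ?_) ((R.lower k i).le_opCost S h')
  congr 1
  have h1 : ∀ t, ∑ j, e' j t - ∑ j, R.e (k + 1) i j t
      = ∑ j ∈ Finset.univ.erase i, (e' j t - R.e (k + 1) i j t) := by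
    intro t
    rw [← Finset.sum_sub_distrib, ← Finset.add_sum_erase _ _ (Finset.mem_univ i), h'.diag,
      (R.lower k i).feasible.diag, sub_zero, zero_add]
  simp only [h1, Finset.mul_sum]
  rw [Finset.sum_comm]
  refine Finset.sum_congr rfl fun j hj => Finset.sum_congr rfl fun t _ => ?_
  rw [hp k i j (Finset.ne_of_mem_erase hj)]

theorem sum_e (R : S.Step1Run ρ) (k : ℕ) (i : M) (t : Fin T) :
    ∑ j, R.e (k + 1) i j t = S.netOf (S.vecOf (R.x (k + 1))) i t :=
  (S.localFeasible_iff.1 (R.lower k i).feasible).2.1 t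

theorem mem_jointSet (R : S.Step1Run ρ) (k : ℕ) :
    (S.vecOf (R.x (k + 1))) ∈ S.jointSet := fun i =>
  (S.localFeasible_iff.1 (R.lower k i).feasible).1

/-- Convergence of the residuals and of the total cost in Step 1. -/
theorem tendsto_residual_and_cost (R : S.Step1Run ρ) (hρ : ProperStepsize ρ) {y : S.JointVec}
    (hy : y ∈ S.jointSet) (hy0 : ∀ t, ∑ i, S.netOf y i t = 0)
    (hmin : ∀ z ∈ S.jointSet, (∀ t, ∑ i, S.netOf z i t = 0) → S.jointCost y ≤ S.jointCost z) :
    (∀ i j t, Tendsto (fun k => R.e (k + 1) i j t - R.eHat (k + 1) i j t) atTop (𝓝 0)) ∧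
      Tendsto (fun k => S.socialCost (R.x (k + 1))) atTop (𝓝 (S.jointCost y)) := by
  obtain ⟨g, hX, hsub⟩ := R.exists_exchangeRun hρ.pos
  have hρ' := hρ.succ
  have hyf := S.p1Feasible_of_net hy hy0 (c := 0) (by simp) (by simp)
  set e' : Trade M T := fun i j t =>
    (0 : Trade M T) i j t + (S.netOf y i t - S.netOf y j t) / Fintype.card M with he'
  have hsplit := hX.splitRun hρ'.pos (f := fun k => S.socialCost (R.x (k + 1))) fun k m => by
    simp only [socialCost]
    rw [← Finset.sum_add_distrib]
    exact Finset.sum_le_sum fun i _ => hsub (k + 1) i _ _ (R.lower (m + 1) i).feasible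
  have hfeas := hX.le_of_clearing hρ'.pos (f := fun k => S.socialCost (R.x (k + 1)))
    (f' := S.jointCost y) (y := e') (hyf.anti S)
    (fun i j t hij => by
      have : i = j := by
        by_contra hc
        exact hij ⟨Finset.mem_univ i, Finset.mem_univ j, hc⟩
      rw [← this]
      exact (hyf.loc i).diag t)
    (fun k => by
      rw [← S.socialCost_schedOf]
      simp only [socialCost]
      rw [← Finset.sum_add_distrib]
      exact Finset.sum_le_sum fun i _ => hsub (k + 1) i _ _ (hyf.loc i))
  -- One multiplier per slot suffices: the price of the balance of net energies acts as a common
  -- price on all edges.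
  obtain ⟨μ, hμ⟩ := exists_multiplier S.isPolyhedron_jointSet S.isConvexQuadratic_jointCost
    (b := fun t z => ∑ i, S.netOf z i t) (fun t => .sum _ fun i => S.isAffineFn_netOf i t) hy hy0
    hmin
  have hmult : ∀ k, S.jointCost y + inner ℝ (toEuclidean fun (_ _ : M) t => μ t)
      (toEuclidean (R.e (k + 1 + 1) - R.eHat (k + 1 + 1))) ≤ S.socialCost (R.x (k + 1 + 1)) := by
    intro k
    rw [S.socialCost_eq]
    refine le_trans (le_of_eq ?_) (hμ _ (R.mem_jointSet (k + 1)))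
    congr 1
    rw [hX.inner_common_price μ k, Finset.sum_comm]
    refine Finset.sum_congr rfl fun t _ => ?_
    rw [← Finset.mul_sum]
    exact congrArg _ (Finset.sum_congr rfl fun i _ => R.sum_e (k + 1) i t)
  obtain ⟨B, hB⟩ := hX.exists_norm_consensus_le hρ' fun i _ t => by
    obtain ⟨B, hB⟩ := S.isCompact_jointSet.exists_bound_of_continuousOn
      (S.isAffineFn_netOf i t).continuous.continuousOn
    exact ⟨B, fun k => by
      rw [R.sum_e (k + 1) i t]
      exact hB _ (R.mem_jointSet (k + 1))⟩
  have hres := hsplit.tendsto_residual_zero hρ' hB hfeas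
  refine ⟨fun i j t => ?_, (tendsto_add_atTop_iff_nat 1).1
    (hsplit.tendsto_value hρ' hB hfeas hmult)⟩
  refine squeeze_zero_norm (fun k => ?_) (by simpa using hres.norm)
  exact abs_le_norm_toEuclidean (R.e (k + 1) - R.eHat (k + 1)) i j t

theorem tendsto_residual (R : S.Step1Run ρ)
    (h : ∀ i j t, Tendsto (fun k => R.e (k + 1) i j t - R.eHat (k + 1) i j t) atTop (𝓝 0)) :
    Tendsto R.residual atTop (𝓝 0) := by
  refine (tendsto_add_atTop_iff_nat 1).1 ?_
  have h1 : ∀ i : M, Tendsto (fun k => √(∑ j ∈ Finset.univ.erase i, ∑ t,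
      (R.eHat (k + 1) i j t - R.e (k + 1) i j t) ^ 2)) atTop (𝓝 0) := by
    intro i
    have h2 := (Real.continuous_sqrt.tendsto _).comp (tendsto_finsetSum (Finset.univ.erase i)
      fun j _ => tendsto_finsetSum Finset.univ fun t _ => (h i j t).pow 2)
    simp only [ne_eq, OfNat.ofNat_ne_zero, not_false_eq_true, zero_pow, Finset.sum_const_zero,
      Real.sqrt_zero] at h2
    refine h2.congr fun k => ?_
    simp only [Function.comp]
    congr 1
    exact Finset.sum_congr rfl fun j _ => Finset.sum_congr rfl fun t _ => by ring
  have h2 := tendsto_finsetSum Finset.univ fun i _ => h1 i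
  rwa [Finset.sum_const_zero] at h2

/-- Convergence of Step 1. -/
theorem main (R : S.Step1Run ρ) (hρ : ProperStepsize ρ)
    (hfeas : ∀ i, ∃ x : S.Sched i, (S.grid i).Feasible x 0) :
    Tendsto R.residual atTop (𝓝 0) ∧
    (∀ x' e', S.P1Optimal x' e' →
      Tendsto (fun k => S.socialCost (R.x k)) atTop (𝓝 (S.socialCost x'))) ∧
    ∃ (xs : ℕ → ∀ i, S.Sched i) (es : ℕ → Trade M T),
      (∀ k, S.P1Optimal (xs k) (es k)) ∧
      (∀ i, Tendsto (fun k => (R.x k i).l1Dist (xs k i)) atTop (𝓝 0)) ∧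
      ∀ i j t, Tendsto (fun k => R.e k i j t - es k i j t) atTop (𝓝 0) ∧
        Tendsto (fun k => R.eHat k i j t - es k i j t) atTop (𝓝 0) := by
  obtain ⟨y, hy, hy0, hmin⟩ := S.exists_joint_minimum hfeas
  obtain ⟨hr, hcost⟩ := R.tendsto_residual_and_cost hρ hy hy0 hmin
  refine ⟨R.tendsto_residual hr, fun x' e' hopt => ?_, ?_⟩
  · have h1 := S.p1Feasible_of_net hy hy0 (c := 0) (by simp) (by simp)
    have h2 : S.socialCost x' = S.jointCost y := by
      refine le_antisymm ?_ ?_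
      · rw [← S.socialCost_schedOf]
        exact hopt.le _ _ h1
      · rw [S.socialCost_eq]
        exact hmin _ (hopt.feasible.mem_jointSet S) (hopt.feasible.sum_netOf S)
    rw [h2]
    exact (tendsto_add_atTop_iff_nat 1).1 hcost
  obtain ⟨g, hX, -⟩ := R.exists_exchangeRun hρ.pos
  set u : ℕ → S.JointVec := fun k => S.vecOf (R.x (k + 1)) with hu
  -- Its zeros in the joint feasible set are exactly the optimal joint schedules.
  set v : S.JointVec → ℝ := fun z =>
    (∑ t, |∑ i, S.netOf z i t|) + |S.jointCost z - S.jointCost y| with hv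
  have hvc : Continuous v :=
    (continuous_finsetSum _ fun t _ => (continuous_finsetSum _ fun i _ =>
      (S.isAffineFn_netOf i t).continuous).abs).add
      (S.continuous_jointCost.sub continuous_const).abs
  have hvy : v y = 0 := by simp [hv, hy0]
  have hsumN : ∀ t, Tendsto (fun k => ∑ i, S.netOf (u k) i t) atTop (𝓝 0) := by
    intro t
    have h1 := tendsto_finsetSum Finset.univ fun i _ =>
      tendsto_finsetSum Finset.univ fun j _ => hr i j t
    simp only [Finset.sum_const_zero, Finset.sum_sub_distrib] at h1
    refine h1.congr fun k => ?_
    have h2 : ∑ i, ∑ j, R.eHat (k + 1) i j t = 0 := hX.sum_sum_eq_zero k t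
    rw [h2, sub_zero]
    exact Finset.sum_congr rfl fun i _ => R.sum_e k i t
  have hvu : Tendsto (fun k => v (u k)) atTop (𝓝 0) := by
    have h1 := (tendsto_finsetSum Finset.univ fun t _ => (hsumN t).abs).add
      (hcost.sub_const (S.jointCost y)).abs
    simp only [abs_zero, Finset.sum_const_zero, sub_self, add_zero] at h1
    exact h1
  obtain ⟨z, hz, hlim⟩ := exists_tendsto_sub_of_isCompact S.isCompact_jointSet hvc ⟨y, hy, hvy⟩
    R.mem_jointSet hvu
  have hz0 : ∀ k t, ∑ i, S.netOf (z k) i t = 0 := by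
    intro k t
    have h1 := (hz k).2
    have h2 : ∑ t, |∑ i, S.netOf (z k) i t| = 0 := by
      have h3 : 0 ≤ ∑ t, |∑ i, S.netOf (z k) i t| := Finset.sum_nonneg fun t _ => abs_nonneg _
      have h4 := abs_nonneg (S.jointCost (z k) - S.jointCost y)
      simp only [hv] at h1
      linarith
    exact abs_eq_zero.1 ((Finset.sum_eq_zero_iff_of_nonneg fun t _ => abs_nonneg _).1 h2 t
      (Finset.mem_univ t))
  have hzc : ∀ k, S.jointCost (z k) = S.jointCost y := by
    intro k
    have h1 := (hz k).2
    simp only [hv, hz0, abs_zero, Finset.sum_const_zero, zero_add] at h1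
    exact sub_eq_zero.1 (abs_eq_zero.1 h1)
  -- The circulation part of the run, constant from the first update on. It is added to the trades
  -- that realize the nets of `z k`, since optimal trades are determined only up to circulations.
  set c : Trade M T := fun i j t => R.eHat 1 i j t
    - (∑ m, R.eHat 1 i m t - ∑ m, R.eHat 1 j m t) / Fintype.card M with hc
  have hcanti : ∀ i j t, c i j t = -c j i t := by
    intro i j t
    have h1 : R.eHat 1 i j t = -R.eHat 1 j i t := hX.anti 0 i j t
    simp only [hc, h1]
    ring
  have hcsum : ∀ i t, ∑ j, c i j t = 0 := by
    intro i t
    have hn : (Fintype.card M : ℝ) ≠ 0 := by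
      have : Nonempty M := ⟨i⟩
      exact_mod_cast Fintype.card_ne_zero
    have h1 : ∑ i, ∑ j, R.eHat 1 i j t = 0 := hX.sum_sum_eq_zero 0 t
    simp only [hc]
    rw [Finset.sum_sub_distrib, ← Finset.sum_div, Finset.sum_sub_distrib, h1, Finset.sum_const,
      nsmul_eq_mul, Finset.card_univ, sub_zero, mul_div_cancel_left₀ _ hn, sub_self]
  set es : ℕ → Trade M T := fun k i j t =>
    c i j t + (S.netOf (z k) i t - S.netOf (z k) j t) / Fintype.card M with hes
  have hopt : ∀ k, S.P1Optimal (S.schedOf (z k)) (es k) := fun k =>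
    S.p1Optimal_of_le (S.p1Feasible_of_net (hz k).1 (hz0 k) hcanti hcsum) hmin
      (by rw [S.socialCost_schedOf, hzc])
  have hhat : ∀ i j t, Tendsto (fun k => R.eHat (k + 1) i j t - es k i j t) atTop (𝓝 0) := by
    intro i j t
    have hnet : ∀ i, Tendsto (fun k => ∑ m, R.eHat (k + 1) i m t - S.netOf (z k) i t)
        atTop (𝓝 0) := by
      intro i
      have h1 := ((S.isAffineFn_netOf i t).tendsto_sub hlim).sub
        (tendsto_finsetSum Finset.univ fun j _ => hr i j t)
      simp only [Finset.sum_const_zero, sub_zero, Finset.sum_sub_distrib] at h1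
      refine h1.congr fun k => ?_
      rw [R.sum_e k i t]
      ring
    have h1 := ((hnet i).sub (hnet j)).div_const (Fintype.card M : ℝ)
    rw [sub_zero, zero_div] at h1
    refine h1.congr fun k => ?_
    have h2 := hX.circulation (fun k => hρ.pos (k + 1)) k (Finset.mem_univ i) (Finset.mem_univ j) t
    rw [Finset.card_univ] at h2
    simp only [hes, hc]
    rw [show (0 : ℕ) + 1 = 1 from rfl] at h2
    rw [← h2]
    ring
  -- The point `z k` approximates the iterate with index `k + 1`; at index zero truncated
  -- subtraction supplies some optimal solution, irrelevant for the limit.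
  refine ⟨fun k => S.schedOf (z (k - 1)), fun k => es (k - 1), fun k => hopt (k - 1),
    fun i => ?_, fun i j t => ⟨?_, ?_⟩⟩
  · refine (tendsto_add_atTop_iff_nat 1).1 ?_
    have h1 := (tendsto_pi_nhds.1 hlim) i
    exact SchedVec.tendsto_l1Dist (u := fun k => (R.x (k + 1) i).toVec) (v := fun k => z k i) h1
  · refine (tendsto_add_atTop_iff_nat 1).1 ?_
    have h1 := (hr i j t).add (hhat i j t)
    rw [zero_add] at h1
    refine h1.congr fun k => ?_
    simp
  · exact (tendsto_add_atTop_iff_nat 1).1 (hhat i j t)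

end Step1Run

/-! ### The group of traders -/

/-- By antisymmetry a nonzero trade makes its partner a trader as well, and the zero diagonal makes
the partner different. -/
theorem P1Feasible.two_le_card_traders {S : System M T} {x : ∀ i, S.Sched i} {e : Trade M T}
    (h : S.P1Feasible x e) (hne : (traders e).Nonempty) : 2 ≤ (traders e).card := by
  obtain ⟨i, hi⟩ := hne
  obtain ⟨j, t, hij⟩ := (Finset.mem_filter.1 hi).2
  refine Finset.one_lt_card.2 ⟨i, hi, j, Finset.mem_filter.2 ⟨Finset.mem_univ j, i, t, ?_⟩, ?_⟩
  · rw [h.anti S j i]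
    exact neg_ne_zero.2 hij
  · rintro rfl
    exact hij ((h.loc i).diag t)

end System

end Microgrids

/-! ### The main theorem -/

theorem theorem2 {M : Type*} [Fintype M] [DecidableEq M] {T : ℕ} (S : System M T)
    (hfeas : ∀ i, ∃ x : S.Sched i, (S.grid i).Feasible x 0) :
    ProperStepsize harmonicStep ∧
    ∀ ρ₁ ρ₂ : ℕ → ℝ, ProperStepsize ρ₁ → ProperStepsize ρ₂ →
      -- Step 1: the algorithm is well defined and converges to optimal solutions of P1
      ((∀ eHat₀ : Trade M T, ∃ R : S.Step1Run ρ₁, R.eHat 0 = eHat₀) ∧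
        ∀ R : S.Step1Run ρ₁,
          Tendsto R.residual atTop (𝓝 0) ∧
          (∀ x' e', S.P1Optimal x' e' →
            Tendsto (fun k => S.socialCost (R.x k)) atTop (𝓝 (S.socialCost x'))) ∧
          ∃ (xs : ℕ → ∀ i, S.Sched i) (es : ℕ → Trade M T),
            (∀ k, S.P1Optimal (xs k) (es k)) ∧
            (∀ i, Tendsto (fun k => (R.x k i).l1Dist (xs k i)) atTop (𝓝 0)) ∧
            ∀ i j t, Tendsto (fun k => R.e k i j t - es k i j t) atTop (𝓝 0) ∧
              Tendsto (fun k => R.eHat k i j t - es k i j t) atTop (𝓝 0)) ∧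
      -- Step 2: for every optimal solution of P1, the algorithm is well defined and converges to
      -- an optimal solution of P2
      ∀ (x' : ∀ i, S.Sched i) (e' : Trade M T), S.P1Optimal x' e' →
        ((traders e').Nonempty →
          ∑ i ∈ traders e', S.opCost i (x' i) < ∑ i ∈ traders e', S.nonCost i) →
        (∀ pHat₀ : M → M → ℝ,
          ∃ R : Step2Run (traders e') (S.gain x') ρ₂, R.pHat 0 = pHat₀) ∧
        ∀ R : Step2Run (traders e') (S.gain x') ρ₂,
          Tendsto R.residual atTop (𝓝 0) ∧
          ∃ p' : M → M → ℝ, P2Optimal (traders e') (S.gain x') p' ∧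
            ∀ i j, Tendsto (fun k => R.p k i j) atTop (𝓝 (p' i j)) ∧
              Tendsto (fun k => R.pHat k i j) atTop (𝓝 (p' i j)) := by
  refine ⟨properStepsize_harmonicStep, fun ρ₁ ρ₂ h₁ h₂ =>
    ⟨⟨S.exists_step1Run hfeas h₁.pos, fun R => R.main h₁ hfeas⟩, fun x' e' hopt hgain => ?_⟩⟩
  have hG : (traders e').Nonempty → 2 ≤ (traders e').card := hopt.feasible.two_le_card_traders
  refine ⟨exists_step2Run (fun i hi => ?_) h₂.pos, fun R => R.main h₂ hG fun hne => ?_⟩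
  · rw [← Finset.card_pos, Finset.card_erase_of_mem hi]
    have := hG ⟨i, hi⟩
    omega
  · simp only [System.gain, Finset.sum_sub_distrib]
    exact sub_pos.2 (hgain hne)
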